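/- **Setting.** Fix an infinite set $\Omega$. A *ribbon graph* is a nonempty finite connected graph $\Gamma$, whose set of half-edges is a subset of $\Omega$, in which all vertices have valence $\ge 3$ and the half-edges at every vertex are cyclically ordered. A morphism $\Gamma\to\Gamma'$ is a spanning forest $F$ of $\Gamma$ together with an isomorphism of ribbon graphs $\Gamma/F\cong\Gamma'$; this defines the category $\mathcal{F}at$. The codimension of $\Gamma$ is $\sum_v(\mathrm{val}(v)-3)$. An orientation of $\Gamma$ is an orientation of the real vector space spanned by its vertices and half-edges. If $e=\{e^-,e^+\}$ is a non-loop edge from $v_1\ni e^-$ to $v_2\ni e^+$, the orientation $v_1v_2e^-e^+\cdots$ of $\Gamma$ induces the orientation $v_*\cdots$ of $\Gamma/e$, where $v_*$ is the merged vertex. A trivalent ribbon graph has a natural orientation: list each vertex followed by its half-edges in cyclic order. Let $\mathcal G^n$ be the abelian group generated by the isomorphism classes $[\Gamma]$ of oriented ribbon graphs of codimension $n$ modulo $[-\Gamma]=-[\Gamma]$, with $\partial[\Gamma]=\sum_e[\Gamma/e]$ (sum over non-loop edges). On $\mathrm{Hom}(\mathcal G^*,\mathbb Z)$ put $d f=f\circ\partial$,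 let $[\Gamma]^*$ be the dual generator ($0$ if $\Gamma$ has an orientation reversing automorphism), $\langle\Gamma\rangle=|\mathrm{Aut}(\Gamma)|\,[\Gamma]^*$, and let $\mathcal G_*^{\mathbb Z}$ be the subcomplex generated by all $\langle\Gamma\rangle$ (with $\langle\Gamma\rangle$ in degree the codimension of $\Gamma$). For a ribbon graph $\Gamma_0$ let $F_k(\Gamma_0)$ be the abelian group generated by the isomorphism classes over $\Gamma_0$ of morphisms $f:\Gamma\to\Gamma_0$ with $\Gamma$ oriented of codimension $k$, reversal of orientation being reversal of sign. Put $d[f]=\sum_i[f\circ g_i]$, the sum over right equivalence classes of morphisms $g_i:\Gamma_i\to\Gamma$ collapsing one edge, $\Gamma_i$ having the orientation that induces the one of $\Gamma$; $\varepsilon[f:\Gamma\to\Gamma_0]=\pm1$ for trivalent $\Gamma$, according to whether its orientation is the natural one; $p[f:\Gamma\to\Gamma_0]=\langle\Gamma\rangle$; and $g_*[f]=[g\circ f]$ for a morphism $g:\Gamma_0\to\Gamma_1$. For a small category $\mathcal A$ let $C_*(\mathcal A)$ be the chain complex with $C_n(\mathcal A)$ free on the $n$-simplices $X_0\to\cdots\to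 X_n$ of the nerve. A chain map $\phi:C_*(\mathcal{F}at)\to\mathcal G_*^{\mathbb Z}$ is *carried by* $F_*$ if for all simplices $\Gamma_*=(\Gamma_0\to\cdots\to\Gamma_n)$ there are $\widetilde\phi(\Gamma_*)\in F_n(\Gamma_n)$ with $p\widetilde\phi(\Gamma_*)=\phi(\Gamma_*)$, with $\varepsilon\widetilde\phi(\Gamma_0)=1$ for $n=0$, and with $$d\widetilde\phi(\Gamma_*)=\sum_{i=0}^{n-1}(-1)^i\widetilde\phi(\partial_i\Gamma_*)+(-1)^n g_*\widetilde\phi(\partial_n\Gamma_*)\qquad(n\ge1),$$ where $g:\Gamma_{n-1}\to\Gamma_n$ is the last morphism of $\Gamma_*$. Let $\mathcal{F}in\subset\mathcal{F}at$ be a full subcategory containing exactly one object from every isomorphism class, with inclusion $\iota$. For an oriented ribbon graph $\Gamma$ of codimension $n$ the *average dual cell* is $$\overline D(\Gamma)=\sum\frac{o(\Gamma_*)}{|\mathrm{Aut}(\Gamma_0)|\cdots|\mathrm{Aut}(\Gamma_n)|}\,(\Gamma_0\to\cdots\to\Gamma_n)\in C_n(\mathcal{F}in;\mathbb Q),$$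 the sum over all sequences $\Gamma_0\to\cdots\to\Gamma_n\xrightarrow{\approx}\Gamma$ with $\Gamma_i\in\mathcal{F}in$ of codimension $i$, where $o(\Gamma_*)=1$ if the orientation of $\Gamma$ is the one induced, along the sequence, by the natural orientation of $\Gamma_0$, and $o(\Gamma_*)=-1$ otherwise. **Theorem.** $(\mathcal G_*^{\mathbb Z},d)$ is a chain complex, and every chain map $\phi:C_*(\mathcal{F}at)\to\mathcal G_*^{\mathbb Z}$ carried by $F_*$ is a rational homotopy equivalence, i.e. $\phi\otimes\mathbb Q$ is a chain homotopy equivalence. Moreover, for every $\mathcal{F}in$ as above there is a chain map $\psi:\mathcal G_*^{\mathbb Z}\otimes\mathbb Q\to C_*(\mathcal{F}in;\mathbb Q)$ with $$\psi\langle\Gamma\rangle=(-1)^{\binom{n+1}2}\,\overline D(\Gamma)$$ for every oriented ribbon graph $\Gamma$ of codimension $n$, and for every $\phi$ carried by $F_*$ one has (with rational coefficients) $\phi\,\iota\,\psi=\mathrm{id}$ and $\psi\,\phi\,\iota\simeq\mathrm{id}$ on $C_*(\mathcal{F}in;\mathbb Q)$; in particular $\iota\psi$ is a homotopy inverse of $\phi\otimes\mathbb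 Q$. -/

import Mathlib

open CategoryTheory
open scoped ChangeOfRings

universe u

noncomputable section

namespace FatGraph

/-! ### Ribbon graphs -/

/-- A ribbon graph with half-edges in `Ω`: a finite set `H` of half-edges, a fixed point free
involution `τ` whose orbits are the edges, and a permutation `σ` whose cycles are the cyclically
ordered vertices, all of valence at least three.  The graph is nonempty and connected. -/
structure RibbonGraph (Ω : Type u) where
  H : Finset Ω
  τ : Equiv.Perm H
  σ : Equiv.Perm H
  τ_ne : ∀ x, τ x ≠ x
  τ_τ : ∀ x, τ (τ x) = x
  σ_ne : ∀ x, σ x ≠ x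
  σ_σ_ne : ∀ x, σ (σ x) ≠ x
  nonempty : H.Nonempty
  connected : ∀ x y, Relation.EqvGen (fun a b => b = σ a ∨ b = τ a) x y

namespace RibbonGraph

variable {Ω : Type u}

/-- The set of vertices: the cycles of `σ`. -/
def V (Γ : RibbonGraph Ω) : Type u := Quotient (Equiv.Perm.SameCycle.setoid Γ.σ)

/-- The vertex to which a half-edge is incident. -/
def vert (Γ : RibbonGraph Ω) (x : Γ.H) : Γ.V := Quotient.mk _ x

/-- The codimension `∑_v (val v - 3) = |H| - 3 |V|`. -/
def codim (Γ : RibbonGraph Ω) : ℕ := Γ.H.card - 3 * Nat.card Γ.V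

/-- For a set `S` of half-edges that is closed under `τ`: two half-edges are related if their
vertices lie in the same component of the spanning subgraph whose edges are the edges of `Γ` that
are not in `S`. -/
def Conn (Γ : RibbonGraph Ω) (S : Set Γ.H) : Γ.H → Γ.H → Prop :=
  Relation.EqvGen (fun x y => Γ.σ.SameCycle x y ∨ (x ∉ S ∧ y = Γ.τ x))

/-- `Γ.First S a b`: starting at `a` and walking around the spanning subgraph whose edges are the
edges of `Γ` outside `S` (cross the edge, then turn to the next half-edge at the new vertex), the
first half-edge in `S` that is met is `b`. -/
inductive First (Γ : RibbonGraph Ω) (S : Set Γ.H) : Γ.H → Γ.H → Prop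
  | here (a : Γ.H) (ha : a ∈ S) : First Γ S a a
  | step (a b : Γ.H) (ha : a ∉ S) (h : First Γ S (Γ.σ (Γ.τ a)) b) : First Γ S a b

/-- A morphism of ribbon graphs `Γ ⟶ Δ`, that is, a spanning forest `F` of `Γ` and an isomorphism
of ribbon graphs `Γ/F ≅ Δ`.  It is given by the inverse images of the half-edges of `Δ`; the edges
of `F` are those which are not inverse images of edges of `Δ`. -/
@[ext]
structure Hom (Γ Δ : RibbonGraph Ω) where
  pre : Δ.H → Γ.H
  pre_injective : Function.Injective pre
  /-- edges of `Δ` are edges of `Γ` -/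
  pre_τ : ∀ h, pre (Δ.τ h) = Γ.τ (pre h)
  /-- vertices of `Δ` correspond to components of `F`: a vertex is the set of leaves of a
  component, -/
  sameVertex : ∀ h h', Δ.σ.SameCycle h h' ↔ Γ.Conn (Set.range pre) (pre h) (pre h')
  /-- and every component has leaves -/
  exists_leaf : ∀ x, ∃ h, Γ.Conn (Set.range pre) x (pre h)
  /-- the cyclic order at a vertex of `Δ` is that of the leaves of the component -/
  cyclic : ∀ h, Γ.First (Set.range pre) (Γ.σ (pre h)) (pre (Δ.σ h))
  /-- `F` is a forest: its number of vertices `|V Γ|` is its number of components `|V Δ|` plus its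
  number of edges `(|H Γ| - |H Δ|) / 2` -/
  forest : 2 * Nat.card Γ.V + Δ.H.card = 2 * Nat.card Δ.V + Γ.H.card

theorem conn_refl (Γ : RibbonGraph Ω) (S : Set Γ.H) (x : Γ.H) : Γ.Conn S x x :=
  Relation.EqvGen.refl x

theorem conn_mono (Γ : RibbonGraph Ω) {S T : Set Γ.H} (h : T ⊆ S) {x y : Γ.H}
    (hxy : Γ.Conn S x y) : Γ.Conn T x y :=
  Relation.EqvGen.mono (fun _ _ hab => Or.imp id (fun hb => ⟨fun ha => hb.1 (h ha), hb.2⟩) hab)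
    x y hxy

theorem conn_univ (Γ : RibbonGraph Ω) {x y : Γ.H} :
    Γ.Conn Set.univ x y ↔ Γ.σ.SameCycle x y := by
  constructor
  · intro h
    induction h with
    | rel x y h => simpa using h
    | refl x => exact Equiv.Perm.SameCycle.refl _ _
    | symm x y _ ih => exact ih.symm
    | trans x y z _ _ ih1 ih2 => exact ih1.trans ih2
  · intro h
    exact Relation.EqvGen.rel _ _ (Or.inl h)

/-- The identity morphism. -/
def Hom.id (Γ : RibbonGraph Ω) : Hom Γ Γ where
  pre := fun h => h
  pre_injective := fun _ _ h => h
  pre_τ := fun _ => rfl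
  sameVertex := fun h h' => by
    have : Set.range (fun h : Γ.H => h) = Set.univ := by ext; simp
    rw [this, conn_univ]
  exists_leaf := fun x => ⟨x, conn_refl _ _ _⟩
  cyclic := fun h => First.here _ ⟨_, rfl⟩
  forest := rfl

theorem Hom.conn_pre {Γ Δ : RibbonGraph Ω} (f : Hom Γ Δ) (T : Set Δ.H) {u v : Δ.H}
    (h : Δ.Conn T u v) : Γ.Conn (f.pre '' T) (f.pre u) (f.pre v) := by
  have hsub : f.pre '' T ⊆ Set.range f.pre := Set.image_subset_range _ _
  induction h with
  | rel x y h =>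
    rcases h with h | ⟨hx, rfl⟩
    · exact conn_mono _ hsub ((f.sameVertex _ _).1 h)
    · refine Relation.EqvGen.rel _ _ (Or.inr ⟨?_, f.pre_τ _⟩)
      rintro ⟨z, hz, hzx⟩
      exact hx (f.pre_injective hzx ▸ hz)
  | refl x => exact conn_refl _ _ _
  | symm x y _ ih => exact Relation.EqvGen.symm _ _ ih
  | trans x y z _ _ ih1 ih2 => exact Relation.EqvGen.trans _ _ _ ih1 ih2

theorem Hom.conn_of_pre {Γ Δ : RibbonGraph Ω} (f : Hom Γ Δ) (T : Set Δ.H) {x y : Γ.H}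
    (h : Γ.Conn (f.pre '' T) x y) : ∀ u v, Γ.Conn (Set.range f.pre) x (f.pre u) →
      Γ.Conn (Set.range f.pre) y (f.pre v) → Δ.Conn T u v := by
  have key : ∀ x u v, Γ.Conn (Set.range f.pre) x (f.pre u) →
      Γ.Conn (Set.range f.pre) x (f.pre v) → Δ.Conn T u v := fun x u v hu hv =>
    Relation.EqvGen.rel _ _ (Or.inl ((f.sameVertex _ _).2
      (Relation.EqvGen.trans _ _ _ (Relation.EqvGen.symm _ _ hu) hv)))
  induction h with
  | rel x y h =>
    intro u v hu hv
    rcases h with h | ⟨hx, rfl⟩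
    · exact key x u v hu (Relation.EqvGen.trans _ _ _ (Relation.EqvGen.rel _ _ (Or.inl h)) hv)
    · by_cases hxr : x ∈ Set.range f.pre
      · obtain ⟨w, rfl⟩ := hxr
        rw [← f.pre_τ] at hv
        have hw : w ∉ T := fun hw => hx ⟨w, hw, rfl⟩
        exact Relation.EqvGen.trans _ _ _ (key _ u w hu (conn_refl _ _ _))
          (Relation.EqvGen.trans _ _ _ (Relation.EqvGen.rel _ _ (Or.inr ⟨hw, rfl⟩))
            (key _ _ v (conn_refl _ _ _) hv))
      · exact key x u v hu
          (Relation.EqvGen.trans _ _ _ (Relation.EqvGen.rel _ _ (Or.inr ⟨hxr, rfl⟩)) hv)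
  | refl x => exact key x
  | symm x y _ ih => exact fun u v hu hv => Relation.EqvGen.symm _ _ (ih v u hv hu)
  | trans x y z _ _ ih1 ih2 =>
    intro u v hu hv
    obtain ⟨w, hw⟩ := f.exists_leaf y
    exact Relation.EqvGen.trans _ _ _ (ih1 u w hu hw) (ih2 w v hw hv)

theorem First.trans {Γ : RibbonGraph Ω} {S T : Set Γ.H} (hTS : T ⊆ S) {a b c : Γ.H}
    (h1 : Γ.First S a b) (h2 : Γ.First T b c) : Γ.First T a c := by
  induction h1 with
  | here a ha => exact h2
  | step a b ha _ ih => exact First.step a c (fun h => ha (hTS h)) (ih h2)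

theorem First.eq_of_mem {Γ : RibbonGraph Ω} {S : Set Γ.H} {a b : Γ.H}
    (h : Γ.First S a b) (ha : a ∈ S) : a = b := by
  cases h with
  | here => rfl
  | step _ _ h => exact absurd ha h

theorem Hom.first_pre {Γ Δ : RibbonGraph Ω} (f : Hom Γ Δ) (T : Set Δ.H) {a b : Δ.H}
    (h : Δ.First T a b) : Γ.First (f.pre '' T) (f.pre a) (f.pre b) := by
  induction h with
  | here a ha => exact First.here _ ⟨a, ha, rfl⟩
  | step a b ha _ ih =>
    refine First.step _ _ ?_ ?_
    · rintro ⟨z, hz, hza⟩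
      exact ha (f.pre_injective hza ▸ hz)
    · rw [← f.pre_τ]
      exact First.trans (Set.image_subset_range _ _) (f.cyclic _) ih

/-- Composition of morphisms. -/
def Hom.comp {Γ Δ Θ : RibbonGraph Ω} (f : Hom Γ Δ) (g : Hom Δ Θ) : Hom Γ Θ where
  pre := fun h => f.pre (g.pre h)
  pre_injective := fun _ _ h => g.pre_injective (f.pre_injective h)
  pre_τ := fun h => by rw [g.pre_τ, f.pre_τ]
  sameVertex := fun h h' => by
    have hr : Set.range (fun h => f.pre (g.pre h)) = f.pre '' Set.range g.pre :=
      Set.range_comp f.pre g.pre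
    rw [hr, g.sameVertex]
    exact ⟨f.conn_pre _, fun hc => f.conn_of_pre _ hc _ _ (conn_refl _ _ _) (conn_refl _ _ _)⟩
  exists_leaf := fun x => by
    have hr : Set.range (fun h => f.pre (g.pre h)) = f.pre '' Set.range g.pre :=
      Set.range_comp f.pre g.pre
    obtain ⟨y, hy⟩ := f.exists_leaf x
    obtain ⟨z, hz⟩ := g.exists_leaf y
    rw [hr]
    exact ⟨z, Relation.EqvGen.trans _ _ _ (conn_mono _ (Set.image_subset_range _ _) hy)
      (f.conn_pre _ hz)⟩
  cyclic := fun h => by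
    have hr : Set.range (fun h => f.pre (g.pre h)) = f.pre '' Set.range g.pre :=
      Set.range_comp f.pre g.pre
    rw [hr]
    exact First.trans (Set.image_subset_range _ _) (f.cyclic _) (f.first_pre _ (g.cyclic h))
  forest := by have := f.forest; have := g.forest; omega

/-- The category of ribbon graphs. -/
instance : Category.{u} (RibbonGraph Ω) where
  Hom := Hom
  id := Hom.id
  comp := Hom.comp

@[simp] theorem id_pre (Γ : RibbonGraph Ω) (h : Γ.H) : Hom.pre (𝟙 Γ) h = h := rfl

@[simp] theorem comp_pre {Γ Δ Θ : RibbonGraph Ω} (f : Γ ⟶ Δ) (g : Δ ⟶ Θ) (h : Θ.H) :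
    Hom.pre (f ≫ g) h = f.pre (g.pre h) := rfl

/-! ### Orientations -/

/-- An orientation of the vector space with basis `X` (for finite `X`): a sign for every ordering
of the basis, alternating under permutations. -/
@[ext]
structure Orn (X : Type u) where
  sgn : ∀ {k : ℕ}, (Fin k ≃ X) → ℤˣ
  sgn_perm : ∀ {k : ℕ} (e : Fin k ≃ X) (π : Equiv.Perm (Fin k)),
    sgn (π.trans e) = Equiv.Perm.sign π * sgn e

/-- The opposite orientation. -/
instance {X : Type u} : Neg (Orn X) where
  neg o := ⟨fun e => -o.sgn e, fun e π => by rw [o.sgn_perm, mul_neg]⟩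

@[simp] theorem Orn.sgn_neg {X : Type u} (o : Orn X) {k : ℕ} (e : Fin k ≃ X) :
    (-o).sgn e = -o.sgn e := rfl

theorem Orn.neg_neg' {X : Type u} (o : Orn X) : -(-o) = o := by
  ext; simp

/-- The set of vertices and half-edges. -/
abbrev Cell (Γ : RibbonGraph Ω) : Type u := Γ.V ⊕ Γ.H

/-- An orientation of a graph is an orientation of the vector space spanned by the vertices and
half-edges. -/
abbrev Orientn (Γ : RibbonGraph Ω) : Type u := Orn Γ.Cell

/-- `f.Maps x y`: the cell `x` of `Γ` is mapped to the cell `y` of `Δ` (for vertices `x`, `y`: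
`x` is in the tree which is the inverse image of `y`). -/
def Hom.Maps {Γ Δ : RibbonGraph Ω} (f : Hom Γ Δ) : Γ.Cell → Δ.Cell → Prop
  | Sum.inl v, Sum.inl w =>
      ∃ x h, Γ.vert x = v ∧ Δ.vert h = w ∧ Γ.Conn (Set.range f.pre) x (f.pre h)
  | Sum.inr x, Sum.inr h => x = f.pre h
  | _, _ => False

/-- The bijection of half-edges of an isomorphism. -/
def isoH {Γ Δ : RibbonGraph Ω} (k : Γ ≅ Δ) : Γ.H ≃ Δ.H where
  toFun := k.inv.pre
  invFun := k.hom.pre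
  left_inv x := by rw [← comp_pre, k.hom_inv_id]; rfl
  right_inv x := by rw [← comp_pre, k.inv_hom_id]; rfl

theorem isoH_σ {Γ Δ : RibbonGraph Ω} (k : Γ ≅ Δ) (x : Γ.H) :
    isoH k (Γ.σ x) = Δ.σ (isoH k x) := by
  exact ((k.inv.cyclic x).eq_of_mem ((isoH k).surjective _)).symm

theorem isoH_sameCycle {Γ Δ : RibbonGraph Ω} (k : Γ ≅ Δ) (x y : Γ.H) :
    Δ.σ.SameCycle (isoH k x) (isoH k y) ↔ Γ.σ.SameCycle x y := by
  have hr : Set.range k.inv.pre = Set.univ := Set.range_eq_univ.2 (isoH k).surjective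
  rw [k.inv.sameVertex, hr, conn_univ]
  rfl

/-- The bijection of vertices and half-edges of an isomorphism. -/
def isoCell {Γ Δ : RibbonGraph Ω} (k : Γ ≅ Δ) : Γ.Cell ≃ Δ.Cell :=
  Equiv.sumCongr (Quotient.congr (isoH k) fun x y => (isoH_sameCycle k x y).symm) (isoH k)

/-- The isomorphism `k` carries the orientation `o` to the orientation `o'`. -/
def PreservesOr {Γ Δ : RibbonGraph Ω} (k : Γ ≅ Δ) (o : Γ.Orientn) (o' : Δ.Orientn) : Prop :=
  ∀ (m : ℕ) (e : Fin m ≃ Γ.Cell), o'.sgn (e.trans (isoCell k)) = o.sgn e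

/-- The morphism `f` collapses a single edge and the orientation `o'` of its target is induced by
the orientation `o` of its source: for an edge `{a, τ a}` directed from the vertex of `a` to the
vertex of `τ a` one replaces `(source, target, a, τ a, rest)` by `(coalesced vertex, rest)`. -/
def Induces {Γ Δ : RibbonGraph Ω} (f : Γ ⟶ Δ) (o : Γ.Orientn) (o' : Δ.Orientn) : Prop :=
  ∃ (m : ℕ) (e : Fin (m + 4) ≃ Γ.Cell) (e' : Fin (m + 1) ≃ Δ.Cell) (a : Γ.H),
    a ∉ Set.range f.pre ∧
    e 0 = Sum.inl (Γ.vert a) ∧ e 1 = Sum.inl (Γ.vert (Γ.τ a)) ∧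
    e 2 = Sum.inr a ∧ e 3 = Sum.inr (Γ.τ a) ∧
    f.Maps (e 0) (e' 0) ∧
    (∀ i : Fin m, f.Maps (e (i.addNat 4)) (e' i.succ)) ∧
    o.sgn e = o'.sgn e'

/-- `o` is the natural orientation of a trivalent ribbon graph, in which every vertex is followed
by its three half-edges in cyclic order. -/
def IsNatural {Γ : RibbonGraph Ω} (o : Γ.Orientn) : Prop :=
  ∃ (m : ℕ) (e : Fin m × Fin 4 ≃ Γ.Cell),
    (∀ i, ∃ h : Γ.H, e (i, 0) = Sum.inl (Γ.vert h) ∧ e (i, 1) = Sum.inr h ∧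
      e (i, 2) = Sum.inr (Γ.σ h) ∧ e (i, 3) = Sum.inr (Γ.σ (Γ.σ h))) ∧
    o.sgn (finProdFinEquiv.symm.trans e) = 1

/-! Compatibility of these notions with isomorphisms and with reversal of orientation. -/

theorem isoCell_refl (Γ : RibbonGraph Ω) : isoCell (Iso.refl Γ) = Equiv.refl _ := by
  ext x
  rcases x with v | x
  · induction v using Quotient.inductionOn
    rfl
  · rfl

theorem isoCell_trans {Γ Δ Θ : RibbonGraph Ω} (k : Γ ≅ Δ) (l : Δ ≅ Θ) :
    isoCell (k ≪≫ l) = (isoCell k).trans (isoCell l) := by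
  ext x
  rcases x with v | x
  · induction v using Quotient.inductionOn
    rfl
  · rfl

theorem isoCell_symm {Γ Δ : RibbonGraph Ω} (k : Γ ≅ Δ) :
    isoCell k.symm = (isoCell k).symm := by
  ext x
  rcases x with v | x
  · induction v using Quotient.inductionOn
    rfl
  · rfl

theorem PreservesOr.refl {Γ : RibbonGraph Ω} (o : Γ.Orientn) : PreservesOr (Iso.refl Γ) o o :=
  fun _ e => by rw [isoCell_refl]; rfl

theorem PreservesOr.trans {Γ Δ Θ : RibbonGraph Ω} {k : Γ ≅ Δ} {l : Δ ≅ Θ} {o : Γ.Orientn}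
    {o' : Δ.Orientn} {o'' : Θ.Orientn} (h : PreservesOr k o o') (h' : PreservesOr l o' o'') :
    PreservesOr (k ≪≫ l) o o'' :=
  fun _ e => by rw [isoCell_trans, ← h _ e, ← h' _ (e.trans _)]; rfl

theorem PreservesOr.symm {Γ Δ : RibbonGraph Ω} {k : Γ ≅ Δ} {o : Γ.Orientn}
    {o' : Δ.Orientn} (h : PreservesOr k o o') : PreservesOr k.symm o' o :=
  fun _ e => by
    rw [isoCell_symm, ← h _ (e.trans _)]
    congr 1
    ext; simp

theorem PreservesOr.neg {Γ Δ : RibbonGraph Ω} {k : Γ ≅ Δ} {o : Γ.Orientn}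
    {o' : Δ.Orientn} (h : PreservesOr k o o') : PreservesOr k (-o) (-o') :=
  fun _ e => by rw [Orn.sgn_neg, Orn.sgn_neg, h _ e]

theorem Induces.neg {Γ Δ : RibbonGraph Ω} {f : Γ ⟶ Δ} {o : Γ.Orientn} {o' : Δ.Orientn}
    (h : Induces f o o') : Induces f (-o) (-o') := by
  obtain ⟨m, e, e', a, h1, h2, h3, h4, h5, h6, h7, h8⟩ := h
  exact ⟨m, e, e', a, h1, h2, h3, h4, h5, h6, h7, by rw [Orn.sgn_neg, Orn.sgn_neg, h8]⟩

theorem range_comp_iso {Γ Δ Θ : RibbonGraph Ω} (f : Γ ⟶ Δ) (l : Δ ≅ Θ) :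
    Set.range (Hom.pre (f ≫ l.hom)) = Set.range f.pre := by
  ext x
  constructor
  · rintro ⟨y, rfl⟩; exact ⟨_, rfl⟩
  · rintro ⟨y, rfl⟩
    exact ⟨isoH l y, by rw [comp_pre]; exact congrArg _ ((isoH l).left_inv y)⟩

theorem Maps.comp_iso {Γ Δ Θ : RibbonGraph Ω} {f : Γ ⟶ Δ} (l : Δ ≅ Θ) {x : Γ.Cell} {y : Δ.Cell}
    (h : Hom.Maps f x y) : Hom.Maps (f ≫ l.hom) x (isoCell l y) := by
  rcases x with v | x <;> rcases y with w | y
  · obtain ⟨x, y, rfl, rfl, hc⟩ := h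
    refine ⟨x, isoH l y, rfl, rfl, ?_⟩
    have : Hom.pre (f ≫ l.hom) (isoH l y) = f.pre y := congrArg f.pre ((isoH l).left_inv y)
    rwa [range_comp_iso, this]
  · exact h
  · exact h
  · exact Eq.trans h (congrArg f.pre ((isoH l).left_inv y)).symm

theorem Maps.iso_comp {Γ Δ Θ : RibbonGraph Ω} (k : Γ ≅ Δ) {f : Δ ⟶ Θ} {x : Δ.Cell} {y : Θ.Cell}
    (h : Hom.Maps f x y) : Hom.Maps (k.hom ≫ f) ((isoCell k).symm x) y := by
  have hr : Set.range (Hom.pre (k.hom ≫ f)) = k.hom.pre '' Set.range f.pre :=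
    Set.range_comp k.hom.pre f.pre
  rcases x with v | x <;> rcases y with w | y
  · obtain ⟨x, y, rfl, rfl, hc⟩ := h
    refine ⟨k.hom.pre x, y, rfl, rfl, ?_⟩
    rw [hr]
    exact k.hom.conn_pre _ hc
  · exact h
  · exact h
  · exact congrArg k.hom.pre h

theorem Induces.comp_iso {Γ Δ Θ : RibbonGraph Ω} {f : Γ ⟶ Δ} {l : Δ ≅ Θ} {o : Γ.Orientn}
    {o' : Δ.Orientn} {o'' : Θ.Orientn} (h : Induces f o o') (hl : PreservesOr l o' o'') :
    Induces (f ≫ l.hom) o o'' := by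
  obtain ⟨m, e, e', a, h1, h2, h3, h4, h5, h6, h7, h8⟩ := h
  exact ⟨m, e, e'.trans (isoCell l), a, by rwa [range_comp_iso], h2, h3, h4, h5,
    Maps.comp_iso l h6, fun i => Maps.comp_iso l (h7 i), by rw [hl, h8]⟩

theorem Induces.iso_comp {Γ Δ Θ : RibbonGraph Ω} {k : Γ ≅ Δ} {f : Δ ⟶ Θ} {o : Γ.Orientn}
    {o' : Δ.Orientn} {o'' : Θ.Orientn} (hk : PreservesOr k o o') (h : Induces f o' o'') :
    Induces (k.hom ≫ f) o o'' := by
  obtain ⟨m, e, e', a, h1, h2, h3, h4, h5, h6, h7, h8⟩ := h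
  have hr : Set.range (Hom.pre (k.hom ≫ f)) = k.hom.pre '' Set.range f.pre :=
    Set.range_comp k.hom.pre f.pre
  refine ⟨m, e.trans (isoCell k).symm, e', k.hom.pre a, ?_, ?_, ?_, ?_, ?_,
    Maps.iso_comp k h6, fun i => Maps.iso_comp k (h7 i), ?_⟩
  · rw [hr]
    rintro ⟨z, hz, hza⟩
    exact h1 (k.hom.pre_injective hza ▸ hz)
  · rw [Equiv.trans_apply, h2]; rfl
  · rw [Equiv.trans_apply, h3, ← k.hom.pre_τ]; rfl
  · rw [Equiv.trans_apply, h4]; rfl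
  · rw [Equiv.trans_apply, h5, ← k.hom.pre_τ]; rfl
  · rw [← isoCell_symm, hk.symm _ e, h8]

theorem IsNatural.iso {Γ Δ : RibbonGraph Ω} {k : Γ ≅ Δ} {o : Γ.Orientn} {o' : Δ.Orientn}
    (hk : PreservesOr k o o') (h : IsNatural o) : IsNatural o' := by
  obtain ⟨m, e, h1, h2⟩ := h
  refine ⟨m, e.trans (isoCell k), fun i => ?_, ?_⟩
  · obtain ⟨x, hx0, hx1, hx2, hx3⟩ := h1 i
    refine ⟨isoH k x, ?_, ?_, ?_, ?_⟩
    · rw [Equiv.trans_apply, hx0]; rfl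
    · rw [Equiv.trans_apply, hx1]; rfl
    · rw [Equiv.trans_apply, hx2, ← isoH_σ]; rfl
    · rw [Equiv.trans_apply, hx3, ← isoH_σ, ← isoH_σ]; rfl
  · rw [← h2, ← hk]; rfl

end RibbonGraph

open RibbonGraph

/-! ### Oriented ribbon graphs and the graph homology complex -/

/-- An oriented ribbon graph of codimension `n`. -/
structure OGraph (Ω : Type u) (n : ℕ) where
  graph : RibbonGraph Ω
  codim_eq : graph.codim = n
  or : graph.Orientn

/-- The same ribbon graph with the opposite orientation. -/
def OGraph.neg {Ω : Type u} {n : ℕ} (x : OGraph Ω n) : OGraph Ω n :=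
  ⟨x.graph, x.codim_eq, -x.or⟩

/-- Isomorphism of oriented ribbon graphs. -/
def OGraph.IsoRel {Ω : Type u} {n : ℕ} (x y : OGraph Ω n) : Prop :=
  ∃ k : x.graph ≅ y.graph, PreservesOr k x.or y.or

open Classical in
/-- The indicator of a proposition. -/
def ind (p : Prop) : ℤ := if p then 1 else 0

/-- The abelian group generated by `X`, with `x` and `y` identified if `r x y`, and with
`[neg x] = -[x]`. -/
abbrev OddFree (X : Type u) (r : X → X → Prop) (neg : X → X) : Type u :=
  (X →₀ ℤ) ⧸ Submodule.span ℤ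
    ({z | ∃ x y, r x y ∧ z = Finsupp.single x 1 - Finsupp.single y 1} ∪
      {z | ∃ x, z = Finsupp.single (neg x) 1 + Finsupp.single x (1 : ℤ)})

namespace OddFree

variable {X : Type u} {r : X → X → Prop} {neg : X → X}

/-- The generator `[x]`. -/
def mk (x : X) : OddFree X r neg := Submodule.Quotient.mk (Finsupp.single x 1)

theorem mk_eq {x y : X} (h : r x y) : (mk x : OddFree X r neg) = mk y :=
  (Submodule.Quotient.eq _).2 (Submodule.subset_span (Or.inl ⟨x, y, h, rfl⟩))

theorem mk_neg (x : X) : (mk (neg x) : OddFree X r neg) = -mk x := by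
  rw [eq_neg_iff_add_eq_zero]
  exact (Submodule.Quotient.mk_eq_zero _).2 (Submodule.subset_span (Or.inr ⟨x, rfl⟩))

/-- The homomorphism with prescribed values on the generators. -/
def lift {M : Type*} [AddCommGroup M] (f : X → M) (hr : ∀ x y, r x y → f x = f y)
    (hn : ∀ x, f (neg x) = -f x) : OddFree X r neg →ₗ[ℤ] M :=
  Submodule.liftQ _ (Finsupp.linearCombination ℤ f) <| by
    rw [Submodule.span_le]
    rintro z (⟨x, y, h, rfl⟩ | ⟨x, rfl⟩)
    · simp [hr x y h]
    · simp [hn x]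

@[simp] theorem lift_mk {M : Type*} [AddCommGroup M] (f : X → M)
    (hr : ∀ x y, r x y → f x = f y) (hn : ∀ x, f (neg x) = -f x) (x : X) :
    lift f hr hn (mk x) = f x := by
  simp [lift, mk]

end OddFree

section

variable {Ω : Type u}

namespace OGraph

variable {n : ℕ}

theorem neg_neg' (x : OGraph Ω n) : x.neg.neg = x := by
  rcases x with ⟨g, h, o⟩
  exact congrArg (OGraph.mk g h) (Orn.neg_neg' o)

theorem IsoRel.symm {x y : OGraph Ω n} : x.IsoRel y → y.IsoRel x :=
  fun ⟨k, h⟩ => ⟨k.symm, h.symm⟩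

theorem IsoRel.trans {x y z : OGraph Ω n} : x.IsoRel y → y.IsoRel z → x.IsoRel z :=
  fun ⟨k, h⟩ ⟨l, h'⟩ => ⟨k ≪≫ l, h.trans h'⟩

theorem IsoRel.neg {x y : OGraph Ω n} : x.IsoRel y → x.neg.IsoRel y.neg :=
  fun ⟨k, h⟩ => ⟨k, h.neg⟩

theorem isoRel_neg_iff {x y : OGraph Ω n} : x.neg.IsoRel y ↔ x.IsoRel y.neg :=
  ⟨fun h => by simpa [neg_neg'] using h.neg, fun h => by simpa [neg_neg'] using h.neg⟩

/-- A morphism from `x` which collapses a single (non-loop) edge, with the induced orientation on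
its target. -/
@[ext]
structure Collapse (x : OGraph Ω n) where
  target : OGraph Ω (n + 1)
  map : x.graph ⟶ target.graph
  induces : Induces map x.or target.or

theorem Collapse.mk_congr {x : OGraph Ω n} {g : RibbonGraph Ω} {hg : g.codim = n + 1}
    {o o' : g.Orientn} (h : o = o') (f : x.graph ⟶ g) (hf : Induces f x.or o)
    (hf' : Induces f x.or o') :
    (⟨⟨g, hg, o⟩, f, hf⟩ : x.Collapse) = ⟨⟨g, hg, o'⟩, f, hf'⟩ := by
  subst h; rfl

/-- Left equivalence: isomorphism under `x`.  The classes correspond to the edges of `x` which are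
not loops, the class of an edge `e` being that of `x → x/e`. -/
def Collapse.Rel {x : OGraph Ω n} (c c' : x.Collapse) : Prop :=
  ∃ k : c.target.graph ≅ c'.target.graph, PreservesOr k c.target.or c'.target.or ∧
    c.map ≫ k.hom = c'.map

/-- A morphism to `x` which collapses a single edge, with an orientation on its source which
induces the one of `x`. -/
@[ext]
structure Expansion (x : OGraph Ω (n + 1)) where
  source : OGraph Ω n
  map : source.graph ⟶ x.graph
  induces : Induces map source.or x.or

theorem Expansion.mk_congr {x : OGraph Ω (n + 1)} {g : RibbonGraph Ω} {hg : g.codim = n}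
    {o o' : g.Orientn} (h : o = o') (f : g ⟶ x.graph) (hf : Induces f o x.or)
    (hf' : Induces f o' x.or) :
    (⟨⟨g, hg, o⟩, f, hf⟩ : x.Expansion) = ⟨⟨g, hg, o'⟩, f, hf'⟩ := by
  subst h; rfl

/-- Right equivalence: isomorphism over `x`. -/
def Expansion.Rel {x : OGraph Ω (n + 1)} (c c' : x.Expansion) : Prop :=
  ∃ k : c.source.graph ≅ c'.source.graph, PreservesOr k c.source.or c'.source.or ∧
    k.hom ≫ c'.map = c.map

end OGraph

/-- The graph homology group `𝒢ⁿ`. -/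
abbrev GraphHom (Ω : Type u) (n : ℕ) : Type u :=
  OddFree (OGraph Ω n) OGraph.IsoRel OGraph.neg

/-- `∑_e [x/e]`, the sum over all edges `e` of `x` which are not loops. -/
def collapseSum {n : ℕ} (x : OGraph Ω n) : GraphHom Ω (n + 1) :=
  ∑ᶠ q : Quot (OGraph.Collapse.Rel (x := x)),
    Quot.lift (fun c => (OddFree.mk c.target : GraphHom Ω (n + 1)))
      (fun _ _ ⟨k, hk, _⟩ => OddFree.mk_eq ⟨k, hk⟩) q

/-- Transport of collapses along an isomorphism. -/
def collapseEquiv {n : ℕ} {x y : OGraph Ω n} (k : x.graph ≅ y.graph)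
    (hk : PreservesOr k x.or y.or) : y.Collapse ≃ x.Collapse where
  toFun c := ⟨c.target, k.hom ≫ c.map, c.induces.iso_comp hk⟩
  invFun c := ⟨c.target, k.inv ≫ c.map, c.induces.iso_comp (k := k.symm) hk.symm⟩
  left_inv c := by cases c; simp
  right_inv c := by cases c; simp

/-- Reversal of the orientations in a collapse. -/
def collapseNeg {n : ℕ} (x : OGraph Ω n) : x.Collapse ≃ x.neg.Collapse where
  toFun c := ⟨c.target.neg, c.map, c.induces.neg⟩
  invFun c := ⟨c.target.neg, c.map, by
    have := c.induces.neg
    rwa [show -x.neg.or = x.or from Orn.neg_neg' _] at this⟩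
  left_inv c := by
    exact OGraph.Collapse.mk_congr (Orn.neg_neg' _) _ _ _
  right_inv c := by
    exact OGraph.Collapse.mk_congr (Orn.neg_neg' _) _ _ _

theorem collapseSum_iso {n : ℕ} (x y : OGraph Ω n) (h : x.IsoRel y) :
    collapseSum x = collapseSum y := by
  obtain ⟨k, hk⟩ := h
  symm
  refine finsum_eq_of_bijective (Quot.congr (collapseEquiv k hk) ?_) (Equiv.bijective _) ?_
  · intro c c'
    constructor
    · rintro ⟨l, hl, h⟩
      exact ⟨l, hl, by simp [collapseEquiv, ← h]⟩
    · rintro ⟨l, hl, h⟩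
      exact ⟨l, hl, by simpa [collapseEquiv] using h⟩
  · rintro ⟨c⟩
    rfl

theorem collapseSum_neg {n : ℕ} (x : OGraph Ω n) :
    collapseSum x.neg = -collapseSum x := by
  rw [collapseSum, collapseSum, ← finsum_neg_distrib]
  symm
  refine finsum_eq_of_bijective (Quot.congr (collapseNeg x) ?_) (Equiv.bijective _) ?_
  · intro c c'
    constructor
    · rintro ⟨l, hl, h⟩
      exact ⟨l, hl.neg, h⟩
    · rintro ⟨l, hl, h⟩
      refine ⟨l, ?_, h⟩
      have := hl.neg
      rwa [show -OGraph.or (collapseNeg x c).target = c.target.or from Orn.neg_neg' _,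
        show -OGraph.or (collapseNeg x c').target = c'.target.or from Orn.neg_neg' _] at this
  · rintro ⟨c⟩
    exact (OddFree.mk_neg c.target).symm

/-- The boundary operator `∂ : 𝒢ⁿ → 𝒢ⁿ⁺¹`, `∂[Γ] = ∑_e [Γ/e]`. -/
def graphBdry (Ω : Type u) (n : ℕ) : GraphHom Ω n →ₗ[ℤ] GraphHom Ω (n + 1) :=
  OddFree.lift collapseSum collapseSum_iso collapseSum_neg

/-! ### Graph cohomology and its integral subcomplex -/

/-- The boundary map `d f = f ∘ ∂` on `Hom(𝒢ⁿ, ℤ)`. -/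
def dualBdry (Ω : Type u) (n : ℕ) :
    (GraphHom Ω (n + 1) →ₗ[ℤ] ℤ) →ₗ[ℤ] (GraphHom Ω n →ₗ[ℤ] ℤ) :=
  (graphBdry Ω n).dualMap

/-- The dual generator `[Γ]^*`: it is `1` on `[Γ]`, `-1` on `[-Γ]` and `0` on the other generators,
and it is zero if `Γ` has an orientation reversing automorphism. -/
def dualGen {n : ℕ} (x : OGraph Ω n) : GraphHom Ω n →ₗ[ℤ] ℤ :=
  OddFree.lift (fun y => ind (y.IsoRel x) - ind (y.IsoRel x.neg))
    (fun y z h => by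
      have h1 : y.IsoRel x ↔ z.IsoRel x := ⟨h.symm.trans, h.trans⟩
      have h2 : y.IsoRel x.neg ↔ z.IsoRel x.neg := ⟨h.symm.trans, h.trans⟩
      simp [h1, h2])
    (fun y => by
      have h1 : y.neg.IsoRel x ↔ y.IsoRel x.neg := OGraph.isoRel_neg_iff
      have h2 : y.neg.IsoRel x.neg ↔ y.IsoRel x := by
        rw [OGraph.isoRel_neg_iff, OGraph.neg_neg']
      simp [h1, h2])

/-- `⟨Γ⟩ = |Aut Γ| [Γ]^*`. -/
def angle {n : ℕ} (x : OGraph Ω n) : GraphHom Ω n →ₗ[ℤ] ℤ :=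
  (Nat.card (Aut x.graph) : ℤ) • dualGen x

theorem angle_iso {n : ℕ} (x y : OGraph Ω n) (h : x.IsoRel y) : angle x = angle y := by
  have hc : Nat.card (Aut x.graph) = Nat.card (Aut y.graph) := by
    obtain ⟨k, _⟩ := h
    exact Nat.card_congr (Aut.autMulEquivOfIso k).toEquiv
  have hd : dualGen x = dualGen y := by
    refine Submodule.linearMap_qext _ (Finsupp.lhom_ext' fun z => LinearMap.ext_ring ?_)
    change dualGen x (OddFree.mk z) = dualGen y (OddFree.mk z)
    have h1 : z.IsoRel x ↔ z.IsoRel y := ⟨fun hz => hz.trans h, fun hz => hz.trans h.symm⟩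
    have h2 : z.IsoRel x.neg ↔ z.IsoRel y.neg :=
      ⟨fun hz => hz.trans h.neg, fun hz => hz.trans h.symm.neg⟩
    simp only [dualGen, OddFree.lift_mk, h1, h2]
  rw [angle, angle, hc, hd]

theorem angle_neg {n : ℕ} (x : OGraph Ω n) : angle x.neg = -angle x := by
  have hd : dualGen x.neg = -dualGen x := by
    refine Submodule.linearMap_qext _ (Finsupp.lhom_ext' fun y => LinearMap.ext_ring ?_)
    change dualGen x.neg (OddFree.mk y) = -dualGen x (OddFree.mk y)
    simp [dualGen, OGraph.neg_neg']
  rw [angle, hd, smul_neg]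
  rfl

/-- The generators `⟨Γ⟩` and their iterated boundaries. -/
inductive IntegralGen (Ω : Type u) : ∀ n : ℕ, (GraphHom Ω n →ₗ[ℤ] ℤ) → Prop
  | angle {n : ℕ} (x : OGraph Ω n) : IntegralGen Ω n (angle x)
  | bdry {n : ℕ} (f : GraphHom Ω (n + 1) →ₗ[ℤ] ℤ) (hf : IntegralGen Ω (n + 1) f) :
      IntegralGen Ω n (dualBdry Ω n f)

/-- Degree `n` of the integral subcomplex: the subcomplex of graph cohomology generated by the
elements `⟨Γ⟩`. -/
def integralSub (Ω : Type u) (n : ℕ) : Submodule ℤ (GraphHom Ω n →ₗ[ℤ] ℤ) :=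
  Submodule.span ℤ {f | IntegralGen Ω n f}

/-- `⟨Γ⟩` as an element of the integral subcomplex. -/
def gen {n : ℕ} (x : OGraph Ω n) : integralSub Ω n :=
  ⟨angle x, Submodule.subset_span (IntegralGen.angle x)⟩

/-- The boundary map of the integral subcomplex. -/
def integralBdry (Ω : Type u) (n : ℕ) : integralSub Ω (n + 1) →ₗ[ℤ] integralSub Ω n :=
  (dualBdry Ω n).restrict (p := integralSub Ω (n + 1)) (q := integralSub Ω n) <| by
    intro f hf
    have : integralSub Ω (n + 1) ≤ (integralSub Ω n).comap (dualBdry Ω n) :=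
      Submodule.span_le.2 fun g hg => Submodule.subset_span (IntegralGen.bdry g hg)
    exact this hf

/-- The integral subcomplex as a chain complex. -/
def integralComplex (Ω : Type u)
    (hd : ∀ n, integralBdry Ω n ∘ₗ integralBdry Ω (n + 1) = 0) :
    ChainComplex (ModuleCat.{u} ℤ) ℕ :=
  ChainComplex.of (fun n => ModuleCat.of ℤ (integralSub Ω n))
    (fun n => ModuleCat.ofHom (integralBdry Ω n))
    (fun n => by rw [← ModuleCat.ofHom_comp, hd]; rfl)

/-! ### The forest carrier -/

/-- An oriented ribbon graph of codimension `k` with a morphism to `Γ₀`. -/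
structure OOver (Γ₀ : RibbonGraph Ω) (k : ℕ) where
  top : OGraph Ω k
  map : top.graph ⟶ Γ₀

namespace OOver

variable {Γ₀ Γ₁ : RibbonGraph Ω} {k : ℕ}

/-- Orientation preserving isomorphism over `Γ₀`. -/
def IsoRel (x y : OOver Γ₀ k) : Prop :=
  ∃ l : x.top.graph ≅ y.top.graph, PreservesOr l x.top.or y.top.or ∧ l.hom ≫ y.map = x.map

/-- Reversal of the orientation. -/
def neg (x : OOver Γ₀ k) : OOver Γ₀ k := ⟨x.top.neg, x.map⟩

/-- Composition with a morphism of the base. -/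
def push (g : Γ₀ ⟶ Γ₁) (x : OOver Γ₀ k) : OOver Γ₁ k := ⟨x.top, x.map ≫ g⟩

end OOver

/-- The group `F_k(Γ₀)`. -/
abbrev Forest (Γ₀ : RibbonGraph Ω) (k : ℕ) : Type u :=
  OddFree (OOver Γ₀ k) OOver.IsoRel OOver.neg

namespace Forest

variable {Γ₀ Γ₁ : RibbonGraph Ω}

/-- `∑ [f ∘ g_i]`, the sum over right equivalence classes of morphisms `g_i : Γ_i → Γ` which
collapse a single edge. -/
def expandSum {k : ℕ} (x : OOver Γ₀ (k + 1)) : Forest Γ₀ k :=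
  ∑ᶠ q : Quot (OGraph.Expansion.Rel (x := x.top)),
    Quot.lift (fun c => (OddFree.mk ⟨c.source, c.map ≫ x.map⟩ : Forest Γ₀ k))
      (fun _ _ ⟨l, hl, h⟩ => OddFree.mk_eq ⟨l, hl, by simp [← h]⟩) q

/-- Transport of expansions along an isomorphism. -/
def expandEquiv {n : ℕ} {x y : OGraph Ω (n + 1)} (k : x.graph ≅ y.graph)
    (hk : PreservesOr k x.or y.or) : x.Expansion ≃ y.Expansion where
  toFun c := ⟨c.source, c.map ≫ k.hom, c.induces.comp_iso hk⟩
  invFun c := ⟨c.source, c.map ≫ k.inv, c.induces.comp_iso (l := k.symm) hk.symm⟩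
  left_inv c := by cases c; simp
  right_inv c := by cases c; simp

/-- Reversal of the orientations in an expansion. -/
def expandNeg {n : ℕ} (x : OGraph Ω (n + 1)) : x.Expansion ≃ x.neg.Expansion where
  toFun c := ⟨c.source.neg, c.map, c.induces.neg⟩
  invFun c := ⟨c.source.neg, c.map, by
    have := c.induces.neg
    rwa [show -x.neg.or = x.or from Orn.neg_neg' _] at this⟩
  left_inv c := by
    exact OGraph.Expansion.mk_congr (Orn.neg_neg' _) _ _ _
  right_inv c := by
    exact OGraph.Expansion.mk_congr (Orn.neg_neg' _) _ _ _

theorem expandSum_iso {k : ℕ} (x y : OOver Γ₀ (k + 1)) (h : x.IsoRel y) :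
    expandSum x = expandSum y := by
  obtain ⟨k, hk, hxy⟩ := h
  refine finsum_eq_of_bijective (Quot.congr (expandEquiv k hk) ?_) (Equiv.bijective _) ?_
  · intro c c'
    constructor
    · rintro ⟨l, hl, h⟩
      exact ⟨l, hl, by simp [expandEquiv, ← h]⟩
    · rintro ⟨l, hl, h⟩
      refine ⟨l, hl, ?_⟩
      have h' : l.hom ≫ c'.map ≫ k.hom = c.map ≫ k.hom := h
      exact (cancel_mono k.hom).1 ((Category.assoc l.hom c'.map k.hom).trans h')
  · rintro ⟨c⟩
    change (OddFree.mk ⟨c.source, c.map ≫ x.map⟩ : Forest Γ₀ _)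
      = OddFree.mk ⟨c.source, (c.map ≫ k.hom) ≫ y.map⟩
    rw [Category.assoc, hxy]

theorem expandSum_neg {k : ℕ} (x : OOver Γ₀ (k + 1)) :
    expandSum x.neg = -expandSum x := by
  rw [expandSum, expandSum, ← finsum_neg_distrib]
  symm
  refine finsum_eq_of_bijective (Quot.congr (expandNeg x.top) ?_) (Equiv.bijective _) ?_
  · intro c c'
    constructor
    · rintro ⟨l, hl, h⟩
      exact ⟨l, hl.neg, h⟩
    · rintro ⟨l, hl, h⟩
      refine ⟨l, ?_, h⟩
      have := hl.neg
      rwa [show -OGraph.or (expandNeg x.top c).source = c.source.or from Orn.neg_neg' _,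
        show -OGraph.or (expandNeg x.top c').source = c'.source.or from Orn.neg_neg' _] at this
  · rintro ⟨c⟩
    exact (OddFree.mk_neg (⟨c.source, c.map ≫ x.map⟩ : OOver Γ₀ k)).symm

/-- The boundary map `d : F_{k+1}(Γ₀) → F_k(Γ₀)`. -/
def bdry (Γ₀ : RibbonGraph Ω) (k : ℕ) : Forest Γ₀ (k + 1) →ₗ[ℤ] Forest Γ₀ k :=
  OddFree.lift expandSum expandSum_iso expandSum_neg

/-- The induced map `g_* : F_k(Γ₀) → F_k(Γ₁)`, `g_*[f] = [g ∘ f]`. -/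
def push (g : Γ₀ ⟶ Γ₁) (k : ℕ) : Forest Γ₀ k →ₗ[ℤ] Forest Γ₁ k :=
  OddFree.lift (fun x => OddFree.mk (x.push g))
    (fun _ _ ⟨l, hl, h⟩ => OddFree.mk_eq ⟨l, hl, by simp [OOver.push, ← h]⟩)
    (fun x => OddFree.mk_neg (x.push g))

/-- The projection to the integral subcomplex, `p[f : Γ → Γ₀] = ⟨Γ⟩`. -/
def proj (Γ₀ : RibbonGraph Ω) (k : ℕ) : Forest Γ₀ k →ₗ[ℤ] integralSub Ω k :=
  OddFree.lift (fun x => gen x.top)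
    (fun x y ⟨l, hl, _⟩ => Subtype.ext (angle_iso x.top y.top ⟨l, hl⟩))
    (fun x => Subtype.ext (angle_neg x.top))

/-- The augmentation `ε[Γ → Γ₀] = o(Γ)`, which is `1` if `Γ` has the natural orientation and `-1`
if it has the opposite one. -/
def aug (Γ₀ : RibbonGraph Ω) : Forest Γ₀ 0 →ₗ[ℤ] ℤ :=
  OddFree.lift
    (fun x => ind (IsNatural x.top.or) - ind (IsNatural (-x.top.or)))
    (fun x y ⟨l, hl, _⟩ => by
      have h1 : IsNatural x.top.or ↔ IsNatural y.top.or :=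
        ⟨IsNatural.iso hl, IsNatural.iso hl.symm⟩
      have h2 : IsNatural (-x.top.or) ↔ IsNatural (-y.top.or) :=
        ⟨IsNatural.iso hl.neg, IsNatural.iso hl.neg.symm⟩
      simp [h1, h2])
    (fun x => by
      change ind (IsNatural (-x.top.or)) - ind (IsNatural (- -x.top.or)) = _
      rw [Orn.neg_neg', neg_sub])

end Forest

end

/-! ### The chain complex of a category, rationalization, and carried chain maps -/

/-- The free abelian group functor. -/
def freeZ : Type u ⥤ ModuleCat.{u} ℤ where
  obj X := ModuleCat.of ℤ (X →₀ ℤ)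
  map f := ModuleCat.ofHom (Finsupp.lmapDomain ℤ ℤ f)

/-- The chain complex of a category with integer coefficients: degree `n` is free on the
`n`-simplices of the nerve, the differential is the alternating sum of the faces. -/
def nerveChains (C : Type u) [Category.{u} C] : ChainComplex (ModuleCat.{u} ℤ) ℕ :=
  (AlgebraicTopology.alternatingFaceMapComplex (ModuleCat.{u} ℤ)).obj
    (((SimplicialObject.whiskering (Type u) (ModuleCat.{u} ℤ)).obj freeZ).obj (nerve C))

/-- The chain map induced by a functor. -/
def nerveChainsMap {C D : Type u} [Category.{u} C] [Category.{u} D] (G : C ⥤ D) :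
    nerveChains C ⟶ nerveChains D :=
  (AlgebraicTopology.alternatingFaceMapComplex (ModuleCat.{u} ℤ)).map
    (((SimplicialObject.whiskering (Type u) (ModuleCat.{u} ℤ)).obj freeZ).map (nerveMap G))

/-- A simplex `X₀ → ⋯ → X_n` of the nerve as a chain. -/
def simplex {C : Type u} [Category.{u} C] {n : ℕ} (x : ComposableArrows C n) :
    (nerveChains C).X n :=
  (Finsupp.single x 1 : ComposableArrows C n →₀ ℤ)

/-- The `i`-th face of a simplex of the nerve. -/
def face {C : Type u} [Category.{u} C] {n : ℕ} (i : Fin (n + 2))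
    (x : ComposableArrows C (n + 1)) : ComposableArrows C n :=
  (nerve C).δ i x

/-- The morphism from the last object of a face to the last object of the simplex: the identity
for `i ≤ n`, and the last morphism of the simplex for `i = n + 1`. -/
def faceLast {C : Type u} [Category.{u} C] {n : ℕ} (i : Fin (n + 2))
    (x : ComposableArrows C (n + 1)) :
    (face i x).obj (Fin.last n) ⟶ x.obj (Fin.last (n + 1)) :=
  x.map (homOfLE (Fin.le_last (i.succAbove (Fin.last n))))

/-- The rationalization functor `ℚ ⊗ -` on chain complexes. -/
def rat : ChainComplex (ModuleCat.{u} ℤ) ℕ ⥤ ChainComplex (ModuleCat.{u} ℚ) ℕ :=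
  (ModuleCat.extendScalars.{0, 0, u} (Int.castRingHom ℚ)).mapHomologicalComplex _

/-- The element `1 ⊗ c` of the rationalization. -/
def toRat (K : ChainComplex (ModuleCat.{u} ℤ) ℕ) {n : ℕ} (c : K.X n) : (rat.obj K).X n :=
  ((1 : ℚ) ⊗ₜ[ℤ, Int.castRingHom ℚ] c :
    (ModuleCat.extendScalars.{0, 0, u} (Int.castRingHom ℚ)).obj (K.X n))

section

variable {Ω : Type u}

/-- A chain map from the chains of the category of ribbon graphs to the integral subcomplex is
carried by the forest carrier if it lifts to a family of elements
`φ'(Γ₀ → ⋯ → Γ_n) ∈ F_n(Γ_n)` which is compatible with the boundary maps and the augmentations. -/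
def CarriedByForest {hd : ∀ n, integralBdry Ω n ∘ₗ integralBdry Ω (n + 1) = 0}
    (φ : nerveChains (RibbonGraph Ω) ⟶ integralComplex Ω hd) : Prop :=
  ∃ φ' : ∀ (n : ℕ) (x : ComposableArrows (RibbonGraph Ω) n), Forest (x.obj (Fin.last n)) n,
    (∀ n x, (φ.f n).hom (simplex x) = Forest.proj _ n (φ' n x)) ∧
    (∀ x, Forest.aug _ (φ' 0 x) = 1) ∧
    (∀ n x, Forest.bdry _ n (φ' (n + 1) x) =
      ∑ i : Fin (n + 2), (-1 : ℤ) ^ (i : ℕ) • Forest.push (faceLast i x) n (φ' n (face i x)))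

/-- A chain map is a rational homotopy equivalence if its rationalization is a chain homotopy
equivalence. -/
def IsRationalHomotopyEquiv {K L : ChainComplex (ModuleCat.{u} ℤ) ℕ} (φ : K ⟶ L) : Prop :=
  ∃ e : HomotopyEquiv (rat.obj K) (rat.obj L), e.hom = rat.map φ

/-! ### Average dual cells -/

/-- `S` contains exactly one object from every isomorphism class of ribbon graphs. -/
def IsSkeleton (S : ObjectProperty (RibbonGraph Ω)) : Prop :=
  ∀ Γ, ∃! Δ, S Δ ∧ Nonempty (Γ ≅ Δ)

/-- The index set of the average dual cell of `y`: sequences `Γ₀ → ⋯ → Γ_n ≅ y` with all `Γ_i`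
in `S`, and with `Γ_i` of codimension `i`. -/
structure DualSimplex (S : ObjectProperty (RibbonGraph Ω)) {n : ℕ} (y : OGraph Ω n) where
  chain : ComposableArrows S.FullSubcategory n
  codim_eq : ∀ i, (chain.obj i).obj.codim = i
  iso : (chain.obj (Fin.last n)).obj ≅ y.graph

/-- The orientation of `y` agrees with the one induced from the natural orientation of `Γ₀`. -/
def DualSimplex.Positive {S : ObjectProperty (RibbonGraph Ω)} {n : ℕ} {y : OGraph Ω n}
    (c : DualSimplex S y) : Prop :=
  ∃ o : ∀ i : Fin (n + 1), (c.chain.obj i).obj.Orientn,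
    IsNatural (o 0) ∧
    (∀ i : Fin n, Induces (S.ι.map (c.chain.map (homOfLE i.castSucc_lt_succ.le)))
      (o i.castSucc) (o i.succ)) ∧
    PreservesOr c.iso (o (Fin.last n)) y.or

open Classical in
/-- The sign `o(Γ_*)`. -/
def DualSimplex.sign {S : ObjectProperty (RibbonGraph Ω)} {n : ℕ} {y : OGraph Ω n}
    (c : DualSimplex S y) : ℚ := if c.Positive then 1 else -1

/-- The average dual cell of `y`, in the rational chains of the full subcategory `S`. -/
def avgDualCell (S : ObjectProperty (RibbonGraph Ω)) {n : ℕ} (y : OGraph Ω n) :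
    (rat.obj (nerveChains S.FullSubcategory)).X n :=
  ∑ᶠ c : DualSimplex S y,
    (c.sign / ∏ i, (Nat.card (Aut (c.chain.obj i).obj) : ℚ)) • toRat _ (simplex c.chain)

/-- `⟨Γ⟩` as an element of the integral subcomplex. -/
def genX {hd : ∀ n, integralBdry Ω n ∘ₗ integralBdry Ω (n + 1) = 0} {n : ℕ} (y : OGraph Ω n) :
    (integralComplex Ω hd).X n :=
  gen y

end

end FatGraph

end

open FatGraph

universe v w

noncomputable section

namespace FatGraph

open RibbonGraph

/-! ### Orientations of finite sets -/

namespace RibbonGraph.Orn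

variable {X : Type u} {Y : Type v} {Z : Type w}

/-! The argument compares three systems over a ribbon graph `Γ`: the forest complex `F_*(Γ)`, the
rational chains on simplices of the nerve equipped with a morphism from their last graph to `Γ`,
and, after forgetting `Γ`, the complexes of the theorem.

Signs come first. Collapsing an edge removes three cells (one vertex and two half-edges), so
collapsing two edges in the two possible orders induces opposite orientations: a block of three
moves past a block of three. This gives `2 d² = 0` on `F_*` (`Forest.two_smul_bdry_bdry`). A vertex
of valence four has two expansions, and their natural orientations induce opposite orientations,
whence `ε d = 0` (`Forest.aug_bdry`). The value of `⟨Γ⟩` on `[Γ']` is the signed number of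
isomorphisms `Γ' ≅ Γ`. Consequently `d⟨Γ⟩` is the sum of the `⟨Γ'⟩` over all expansions `Γ'` of `Γ`
(`integralBdry_gen`), because both sides count the one-edge collapses `Γ' ⟶ Γ` with sign. Hence `p`
is a chain map, the elements `⟨Γ⟩` already span a subcomplex, and `d² = 0` there, since the values
lie in `ℤ`.

The average dual cell, as a chain over `Γ`, is the average, over the isomorphisms from the model of
`Γ` in the skeleton, of cones on the sum of the dual cells of the expansions of `Γ`
(`dualChain_succ`). The boundary formula of the cone gives, by induction, that the boundary of a
dual cell is `(-1)^n` times the sum of the dual cells of the expansions, `n` being the codimension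
(`bdry_dualChain`). The sign `(-1)^{n+1 choose 2}` absorbs these factors, so the signed dual cells
define a natural augmented chain map from `F_*` and also the chain map `ψ`.

`ψ φ ι ≃ id`, and likewise for the composite on the whole category: both maps are given by natural
augmented families of chains over the last graph of a simplex. Chains over an object have a cone
contraction, so the acyclic carrier argument yields a homotopy (`OverChains.nonempty_homotopy`).

`φ ι ψ = id` holds on the nose. The lift of `φ` takes the dual cell of `Γ` to an element of `ℚ ⊗
F_n(Γ)`. When `n` is the codimension of `Γ`, this space is spanned by the identity of `Γ`, and the
coefficient is fixed inductively by the boundary, or by the augmentation if `n = 0`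
(`Lift.forestMap_dualChain`). Acyclicity of `F_*` is never needed; it suffices that the boundary of
the identity is not zero. Infinitely many labels are needed only so that expansions exist. -/

theorem sgn_finCongr (o : Orn X) {k l : ℕ} (h : k = l) (e : Fin l ≃ X) :
    o.sgn ((finCongr h).trans e) = o.sgn e := by
  subst h; rfl

/-- Two enumerations differ by a permutation and signs alternate, so a single value determines
everything. Nearly all equalities of orientations below are checked on one convenient enumeration.
-/
theorem eq_of_sgn {o o' : Orn X} {k : ℕ} (e : Fin k ≃ X) (h : o.sgn e = o'.sgn e) : o = o' := by
  ext l e'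
  obtain rfl : l = k := Fin.equiv_iff_eq.1 ⟨e'.trans e.symm⟩
  have : e' = (e'.trans e.symm).trans e := by ext; simp
  rw [this, o.sgn_perm, o'.sgn_perm, h]

theorem eq_or_neg [Finite X] (o o' : Orn X) : o' = o ∨ o' = -o := by
  obtain ⟨k, ⟨e⟩⟩ := Finite.exists_equiv_fin X
  rcases Int.units_eq_one_or (o.sgn e.symm) with h | h <;>
    rcases Int.units_eq_one_or (o'.sgn e.symm) with h' | h'
  · exact Or.inl (eq_of_sgn e.symm (h'.trans h.symm))
  · exact Or.inr (eq_of_sgn e.symm (by rw [sgn_neg, h, h']))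
  · exact Or.inr (eq_of_sgn e.symm (by rw [sgn_neg, h, h']; rfl))
  · exact Or.inl (eq_of_sgn e.symm (h'.trans h.symm))

theorem ne_neg [Finite X] (o : Orn X) : o ≠ -o := by
  obtain ⟨k, ⟨e⟩⟩ := Finite.exists_equiv_fin X
  intro h
  have h' : o.sgn e.symm = -o.sgn e.symm := congrArg (fun o : Orn X => o.sgn e.symm) h
  rcases Int.units_eq_one_or (o.sgn e.symm) with h1 | h1 <;> rw [h1] at h' <;> revert h' <;> decide

theorem neg_inj' {o o' : Orn X} (h : -o = -o') : o = o' := by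
  rw [← neg_neg' o, h, neg_neg']

/-- Declare `e` positive and give any other enumeration the sign of its difference from `e`. The
`finCongr` is there because the lengths agree only propositionally. -/
theorem exists_sgn_eq_one {k : ℕ} (e : Fin k ≃ X) : ∃ o : Orn X, o.sgn e = 1 := by
  refine ⟨⟨fun {l} e' => Equiv.Perm.sign ((e'.trans e.symm).trans
    (finCongr (Fin.equiv_iff_eq.1 ⟨e.trans e'.symm⟩))), ?_⟩, ?_⟩
  · intro l e' π
    obtain rfl : l = k := Fin.equiv_iff_eq.1 ⟨e'.trans e.symm⟩
    change Equiv.Perm.sign ((e'.trans e.symm) * π) = _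
    rw [Equiv.Perm.sign_mul, mul_comm]
    rfl
  · change Equiv.Perm.sign ((e.trans e.symm).trans (Equiv.refl _)) = 1
    simp

instance [Finite X] : Nonempty (Orn X) := by
  obtain ⟨k, ⟨e⟩⟩ := Finite.exists_equiv_fin X
  exact ⟨(exists_sgn_eq_one e.symm).choose⟩

/-- Transport of an orientation along a bijection. -/
def map (f : X ≃ Y) (o : Orn X) : Orn Y where
  sgn e := o.sgn (e.trans f.symm)
  sgn_perm e π := o.sgn_perm (e.trans f.symm) π

theorem map_sgn (f : X ≃ Y) (o : Orn X) {k : ℕ} (e : Fin k ≃ Y) :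
    (o.map f).sgn e = o.sgn (e.trans f.symm) := rfl

theorem map_neg (f : X ≃ Y) (o : Orn X) : (-o).map f = -o.map f := rfl

theorem map_map (f : X ≃ Y) (g : Y ≃ Z) (o : Orn X) : (o.map f).map g = o.map (f.trans g) := rfl

theorem map_refl (o : Orn X) : o.map (Equiv.refl X) = o := rfl

theorem map_symm_map (f : X ≃ Y) (o : Orn Y) : (o.map f.symm).map f = o := by
  rw [map_map, Equiv.symm_trans_self, map_refl]

/-- Permuting the elements is conjugate, through `e`, to permuting the positions, and conjugation
preserves signs. -/
theorem sgn_trans_perm [Fintype X] [DecidableEq X] (o : Orn X) {k : ℕ} (e : Fin k ≃ X)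
    (π : Equiv.Perm X) : o.sgn (e.trans π) = Equiv.Perm.sign π * o.sgn e := by
  have : e.trans π = ((e.trans π).trans e.symm).trans e := by ext; simp
  rw [this, o.sgn_perm]
  congr 1
  exact Equiv.Perm.sign_symm_trans_trans π e.symm

theorem map_perm [Fintype X] [DecidableEq X] (o : Orn X) (π : Equiv.Perm X) :
    (Equiv.Perm.sign π = 1 → o.map π = o) ∧ (Equiv.Perm.sign π = -1 → o.map π = -o) := by
  obtain ⟨k, ⟨e⟩⟩ := Finite.exists_equiv_fin X
  constructor
  · intro h
    refine eq_of_sgn e.symm ?_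
    rw [map_sgn, sgn_trans_perm, Equiv.Perm.sign_symm, h, one_mul]
  · intro h
    refine eq_of_sgn e.symm ?_
    rw [map_sgn, sgn_trans_perm, Equiv.Perm.sign_symm, h, sgn_neg, neg_one_mul]

/-! ### Orientations of a set with three additional elements -/

/-- The enumeration of `Fin 3 ⊕ X` which lists first `Fin 3` and then `X`. -/
def sumEnum {k : ℕ} (e : Fin k ≃ X) : Fin (3 + k) ≃ Fin 3 ⊕ X :=
  finSumFinEquiv.symm.trans (Equiv.sumCongr (Equiv.refl _) e)

/-- The orientation of `X` induced by one of `Fin 3 ⊕ X`. -/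
def drop (o : Orn (Fin 3 ⊕ X)) : Orn X where
  sgn e := o.sgn (sumEnum e)
  sgn_perm {k} e π := by
    have : sumEnum (π.trans e) =
        (((finSumFinEquiv (m := 3) (n := k)).symm.trans
          (Equiv.Perm.sumCongr 1 π)).trans finSumFinEquiv).trans (sumEnum e) := by
      ext i
      obtain ⟨j, rfl⟩ := finSumFinEquiv.surjective i
      rcases j with j | j <;> simp [sumEnum]
    rw [this, o.sgn_perm]
    congr 1
    have h2 := Equiv.Perm.sign_symm_trans_trans (Equiv.Perm.sumCongr (1 : Equiv.Perm (Fin 3)) π)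
      (finSumFinEquiv (m := 3) (n := k))
    rw [h2, Equiv.Perm.sign_sumCongr, Equiv.Perm.sign_one, one_mul]

theorem drop_neg (o : Orn (Fin 3 ⊕ X)) : (-o).drop = -o.drop := rfl

theorem drop_injective [Finite X] {o o' : Orn (Fin 3 ⊕ X)} (h : o.drop = o'.drop) : o = o' := by
  obtain ⟨k, ⟨e⟩⟩ := Finite.exists_equiv_fin X
  exact eq_of_sgn (sumEnum e.symm) (congrArg (fun o : Orn X => o.sgn e.symm) h)

theorem drop_map (f : X ≃ Y) (o : Orn (Fin 3 ⊕ X)) :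
    (o.map (Equiv.sumCongr (Equiv.refl _) f)).drop = o.drop.map f := by
  ext k e
  refine congrArg Units.val ?_
  change o.sgn _ = o.sgn _
  congr 1
  ext i
  obtain ⟨j, rfl⟩ := finSumFinEquiv.surjective i
  rcases j with j | j <;> simp [sumEnum]

/-- Exchange of the two copies of `Fin 3`. -/
def exchange (X : Type u) : Equiv.Perm (Fin 3 ⊕ (Fin 3 ⊕ X)) :=
  (Equiv.sumAssoc _ _ _).symm.trans
    ((Equiv.sumCongr (Equiv.sumComm (Fin 3) (Fin 3)) (Equiv.refl X)).trans (Equiv.sumAssoc _ _ _))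

/-- Moving three elements past three others takes nine transpositions, an odd number. This is the
sign behind `d² = 0`. -/
theorem map_exchange [Finite X] (o : Orn (Fin 3 ⊕ (Fin 3 ⊕ X))) : o.map (exchange X) = -o := by
  classical
  obtain ⟨_⟩ := nonempty_fintype X
  refine (map_perm o (exchange X)).2 ?_
  have h := Equiv.Perm.sign_symm_trans_trans
    (Equiv.Perm.sumCongr (Equiv.sumComm (Fin 3) (Fin 3)) (1 : Equiv.Perm X))
    (Equiv.sumAssoc (Fin 3) (Fin 3) X)
  refine Eq.trans h ?_
  rw [Equiv.Perm.sign_sumCongr, Equiv.Perm.sign_one, mul_one]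
  decide

end RibbonGraph.Orn

end FatGraph

namespace FatGraph

open RibbonGraph

/-! ### Vertices, codimension and isomorphisms -/

namespace RibbonGraph

variable {Ω : Type u} {Γ Δ Θ : RibbonGraph Ω}

instance : Finite Γ.V := inferInstanceAs (Finite (Quotient _))

theorem vert_eq_iff {x y : Γ.H} : Γ.vert x = Γ.vert y ↔ Γ.σ.SameCycle x y :=
  Quotient.eq (r := Equiv.Perm.SameCycle.setoid Γ.σ)

@[simp] theorem vert_σ (x : Γ.H) : Γ.vert (Γ.σ x) = Γ.vert x :=
  vert_eq_iff.2 (Equiv.Perm.sameCycle_apply_left.2 (Equiv.Perm.SameCycle.refl _ _))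

theorem vert_surjective (Γ : RibbonGraph Ω) : Function.Surjective Γ.vert :=
  Quotient.mk_surjective

/-- The first three half-edges at every vertex. -/
def firstThree (Γ : RibbonGraph Ω) (p : Γ.V × Fin 3) : Γ.H :=
  (Γ.σ ^ (p.2 : ℕ)) (Function.surjInv Γ.vert_surjective p.1)

theorem vert_pow (x : Γ.H) (n : ℕ) : Γ.vert ((Γ.σ ^ n) x) = Γ.vert x := by
  induction n with
  | zero => rfl
  | succ n ih => rw [pow_succ', Equiv.Perm.mul_apply, vert_σ, ih]

theorem vert_firstThree (p : Γ.V × Fin 3) : Γ.vert (Γ.firstThree p) = p.1 := by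
  rw [firstThree, vert_pow]
  exact Function.surjInv_eq Γ.vert_surjective p.1

/-- Since `σ` and `σ²` have no fixed points, `x`, `σ x`, `σ² x` are distinct, so each vertex
contributes three distinct half-edges. -/
theorem firstThree_injective (Γ : RibbonGraph Ω) : Function.Injective Γ.firstThree := by
  rintro ⟨v, i⟩ ⟨w, j⟩ h
  obtain rfl : v = w := by
    have := congrArg Γ.vert h
    rwa [vert_firstThree, vert_firstThree] at this
  have h1 := fun x => Γ.σ_ne x
  have h2 := fun x => Γ.σ_σ_ne x
  have h3 := fun x => (Γ.σ_ne x).symm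
  have h4 := fun x => (Γ.σ_σ_ne x).symm
  congr 1
  fin_cases i <;> fin_cases j <;> simp_all [firstThree, pow_succ]

theorem card_V_mul_three : Nat.card (Γ.V × Fin 3) = 3 * Nat.card Γ.V := by
  rw [Nat.card_prod, Nat.card_eq_fintype_card (α := Fin 3), Fintype.card_fin, mul_comm]

/-- There are at least three half-edges per vertex, so the truncated subtraction in `codim` is a
true one. -/
theorem card_H_eq (Γ : RibbonGraph Ω) : Γ.H.card = Γ.codim + 3 * Nat.card Γ.V := by
  have h := Nat.card_le_card_of_injective _ Γ.firstThree_injective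
  rw [card_V_mul_three, Nat.card_eq_fintype_card (α := Γ.H), Fintype.card_coe] at h
  rw [codim]; omega

/-- In codimension zero the count makes `firstThree` a bijection. Hence `σ³ x` is one of `x`, `σ x`,
`σ² x`, and the last two are excluded because `σ` and `σ²` have no fixed points. -/
theorem σ_pow_three (h : Γ.codim = 0) (x : Γ.H) : Γ.σ (Γ.σ (Γ.σ x)) = x := by
  have hs : Function.Surjective Γ.firstThree := by
    have hc := Γ.card_H_eq
    rw [h, zero_add] at hc
    refine ((Nat.bijective_iff_injective_and_card _).2 ⟨Γ.firstThree_injective, ?_⟩).2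
    rw [card_V_mul_three, Nat.card_eq_fintype_card (α := Γ.H), Fintype.card_coe, hc]
  have h1 := fun x => Γ.σ_ne x
  have h2 := fun x => Γ.σ_σ_ne x
  have key : ∀ v, Γ.σ (Γ.σ (Γ.σ (Γ.firstThree (v, 0)))) = Γ.firstThree (v, 0) := by
    intro v
    obtain ⟨⟨w, j⟩, hw⟩ := hs (Γ.σ (Γ.σ (Γ.σ (Γ.firstThree (v, 0)))))
    obtain rfl : w = v := by
      have := congrArg Γ.vert hw
      rwa [vert_firstThree, vert_σ, vert_σ, vert_σ, vert_firstThree] at this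
    rw [← hw]
    fin_cases j
    · rfl
    · simp only [firstThree] at hw
      simp only [pow_one, Fin.val_zero, pow_zero,
        Equiv.Perm.one_apply] at hw
      exact absurd (Γ.σ.injective hw).symm (h2 _)
    · simp only [firstThree] at hw
      simp only [pow_succ, Fin.val_zero, pow_zero,
        Equiv.Perm.one_apply, Equiv.Perm.mul_apply] at hw
      exact absurd (Γ.σ.injective (Γ.σ.injective hw)).symm (h1 _)
  obtain ⟨⟨v, i⟩, rfl⟩ := hs x
  have : Γ.firstThree (v, i) = (Γ.σ ^ (i : ℕ)) (Γ.firstThree (v, 0)) := rfl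
  have h3 : (Γ.σ ^ 3) ((Γ.σ ^ (i : ℕ)) (Γ.firstThree (v, 0)))
      = (Γ.σ ^ (i : ℕ)) ((Γ.σ ^ 3) (Γ.firstThree (v, 0))) := by
    rw [← Equiv.Perm.mul_apply, ← Equiv.Perm.mul_apply, ← pow_add, ← pow_add, add_comm]
  rw [this]
  exact h3.trans (congrArg _ (key v))

/-- If `σ³` were the identity, the first three half-edges would exhaust every vertex and the count
would give codimension zero. This finds a vertex that can be split. -/
theorem exists_σ_pow_three_ne (h : Γ.codim ≠ 0) : ∃ x, Γ.σ (Γ.σ (Γ.σ x)) ≠ x := by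
  by_contra hn
  push Not at hn
  have hs : Function.Surjective Γ.firstThree := by
    intro x
    have hx : Γ.σ.SameCycle (Γ.firstThree (Γ.vert x, 0)) x :=
      vert_eq_iff.1 (vert_firstThree _)
    obtain ⟨n, hxn⟩ := hx.exists_nat_pow_eq
    have h3 : Γ.σ ^ 3 = 1 := Equiv.ext fun y => hn y
    have : Γ.σ ^ n = Γ.σ ^ (n % 3) := by
      conv_lhs => rw [← Nat.div_add_mod n 3, pow_add, pow_mul, h3, one_pow, one_mul]
    refine ⟨(Γ.vert x, ⟨n % 3, Nat.mod_lt _ (by norm_num)⟩), ?_⟩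
    refine Eq.trans ?_ hxn
    rw [this]
    rfl
  have hc := Nat.card_le_card_of_surjective _ hs
  rw [card_V_mul_three, Nat.card_eq_fintype_card (α := Γ.H), Fintype.card_coe] at hc
  have := Γ.card_H_eq
  omega

theorem Hom.card_le (f : Γ ⟶ Δ) : Δ.H.card ≤ Γ.H.card := by
  have := Fintype.card_le_of_injective _ f.pre_injective
  simpa using this

theorem Hom.codim_le (f : Γ ⟶ Δ) : Γ.codim ≤ Δ.codim := by
  have := Hom.card_le f; have := f.forest; have := Γ.card_H_eq; have := Δ.card_H_eq
  omega

/-- A collapsed edge removes two half-edges and one vertex, hence raises the codimension by one;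
`|H| + 2 codim` is invariant. -/
theorem Hom.card_eq (f : Γ ⟶ Δ) : Γ.H.card + 2 * Γ.codim = Δ.H.card + 2 * Δ.codim := by
  have := Hom.card_le f; have := f.forest; have := Γ.card_H_eq; have := Δ.card_H_eq
  omega

theorem sameCycle_equiv (e : Γ.H ≃ Δ.H) (hσ : ∀ x, e (Γ.σ x) = Δ.σ (e x)) {x y : Γ.H} :
    Δ.σ.SameCycle (e x) (e y) ↔ Γ.σ.SameCycle x y := by
  have h : Δ.σ = e.permCongrHom Γ.σ := by
    ext z
    obtain ⟨z, rfl⟩ := e.surjective z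
    simp [hσ]
  refine exists_congr fun i => ?_
  rw [h, ← map_zpow]
  simp

/-! ### Isomorphisms as bijections of half-edges, and their rigidity -/

/-- The morphism given by a bijection of the half-edges. -/
def Hom.ofEquiv (e : Γ.H ≃ Δ.H) (hσ : ∀ x, e (Γ.σ x) = Δ.σ (e x))
    (hτ : ∀ x, e (Γ.τ x) = Δ.τ (e x)) : Γ ⟶ Δ where
  pre := e.symm
  pre_injective := e.symm.injective
  pre_τ h := by
    obtain ⟨x, rfl⟩ := e.surjective h
    rw [← hτ, e.symm_apply_apply, e.symm_apply_apply]
  sameVertex h h' := by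
    rw [Set.range_eq_univ.2 e.symm.surjective, conn_univ, ← sameCycle_equiv e hσ]
    simp
  exists_leaf x := ⟨e x, by rw [e.symm_apply_apply]; exact conn_refl _ _ _⟩
  cyclic h := by
    obtain ⟨x, rfl⟩ := e.surjective h
    rw [← hσ, e.symm_apply_apply, e.symm_apply_apply]
    exact First.here _ (e.symm.surjective _)
  forest := by
    have h1 : Γ.H.card = Δ.H.card := Finset.card_eq_of_equiv e
    have h2 : Nat.card Γ.V = Nat.card Δ.V :=
      Nat.card_congr (Quotient.congr e fun x y => (sameCycle_equiv e hσ).symm)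
    omega

@[ext] theorem hom_ext' {f g : Γ ⟶ Δ} (h : ∀ x, f.pre x = g.pre x) : f = g :=
  Hom.ext (funext h)

/-- The isomorphism given by a bijection of the half-edges. -/
def isoOfEquiv (e : Γ.H ≃ Δ.H) (hσ : ∀ x, e (Γ.σ x) = Δ.σ (e x))
    (hτ : ∀ x, e (Γ.τ x) = Δ.τ (e x)) : Γ ≅ Δ where
  hom := Hom.ofEquiv e hσ hτ
  inv := Hom.ofEquiv e.symm
    (fun x => by rw [e.symm_apply_eq, hσ, e.apply_symm_apply])
    (fun x => by rw [e.symm_apply_eq, hτ, e.apply_symm_apply])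
  hom_inv_id := hom_ext' fun x => e.symm_apply_apply x
  inv_hom_id := hom_ext' fun x => e.apply_symm_apply x

theorem isoOfEquiv_hom_pre (e : Γ.H ≃ Δ.H) (hσ : ∀ x, e (Γ.σ x) = Δ.σ (e x))
    (hτ : ∀ x, e (Γ.τ x) = Δ.τ (e x)) (x : Δ.H) :
    (isoOfEquiv e hσ hτ).hom.pre x = e.symm x := rfl

theorem Hom.isIso_of_surjective (f : Γ ⟶ Δ) (h : Function.Surjective f.pre) : IsIso f := by
  have hσ : ∀ x, f.pre (Δ.σ x) = Γ.σ (f.pre x) := fun x =>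
    ((f.cyclic x).eq_of_mem (h _)).symm
  let e := Equiv.ofBijective f.pre ⟨f.pre_injective, h⟩
  have : f = (isoOfEquiv e hσ f.pre_τ).inv := hom_ext' fun x => rfl
  rw [this]
  infer_instance

theorem Hom.isIso_of_codim (f : Γ ⟶ Δ) (h : Γ.codim = Δ.codim) : IsIso f := by
  refine isIso_of_surjective f
    ((Fintype.bijective_iff_injective_and_card _).2 ⟨f.pre_injective, ?_⟩).2
  have := Hom.card_eq f
  simp only [Fintype.card_coe]
  omega

theorem iso_pre_σ (k : Γ ≅ Δ) (x : Δ.H) : k.hom.pre (Δ.σ x) = Γ.σ (k.hom.pre x) :=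
  isoH_σ k.symm x

/-- Agreement at one half-edge propagates along `σ` and `τ`, and the graph is connected. -/
theorem iso_eq_of_pre_eq (k l : Γ ≅ Δ) (x : Δ.H) (h : k.hom.pre x = l.hom.pre x) : k = l := by
  refine Iso.ext (hom_ext' fun y => ?_)
  have key : ∀ x y, Relation.EqvGen (fun a b => b = Δ.σ a ∨ b = Δ.τ a) x y →
      (k.hom.pre x = l.hom.pre x ↔ k.hom.pre y = l.hom.pre y) := by
    intro x y hxy
    induction hxy with
    | rel a b hab =>
      rcases hab with rfl | rfl
      · rw [iso_pre_σ, iso_pre_σ, Γ.σ.injective.eq_iff]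
      · rw [k.hom.pre_τ, l.hom.pre_τ, Γ.τ.injective.eq_iff]
    | refl => rfl
    | symm _ _ _ ih => exact ih.symm
    | trans _ _ _ _ _ ih1 ih2 => exact ih1.trans ih2
  exact (key x y (Δ.connected x y)).1 h

/-- A graph has no nontrivial automorphism over another one: such an automorphism fixes the
half-edges coming from the base, and there is at least one. This is why classes of expansions and
dual simplices are counted without multiplicities. -/
theorem iso_comp_cancel {k l : Γ ≅ Δ} {f : Δ ⟶ Θ} (h : k.hom ≫ f = l.hom ≫ f) : k = l := by
  obtain ⟨x, hx⟩ := Θ.nonempty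
  exact iso_eq_of_pre_eq k l (f.pre ⟨x, hx⟩) (congrArg (fun g : Γ ⟶ Θ => g.pre ⟨x, hx⟩) h)

instance (f : Γ ⟶ Δ) : Epi f where
  left_cancellation _ _ hgh := hom_ext' fun x =>
    f.pre_injective (congrArg (fun g : Γ ⟶ _ => g.pre x) hgh)

instance : Finite (Γ ⟶ Δ) :=
  Finite.of_injective (fun f : Γ ⟶ Δ => f.pre) fun _ _ h => Hom.ext h

instance : Finite (Γ ≅ Δ) :=
  Finite.of_injective (fun f : Γ ≅ Δ => f.hom) fun _ _ h => Iso.ext h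

instance : Finite (Aut Γ) := inferInstanceAs (Finite (Γ ≅ Γ))

theorem iso_codim (k : Γ ≅ Δ) : Γ.codim = Δ.codim :=
  le_antisymm (Hom.codim_le k.hom) (Hom.codim_le k.inv)

/-! ### Factorizations -/

/-- A walk in `Γ` passes through half-edges of collapsed edges and through preimages of half-edges
of `Δ`; only the latter are recorded, and they form the walk in `Δ`. -/
theorem Hom.first_of_pre (f : Γ ⟶ Δ) (T : Set Δ.H) {x y : Γ.H}
    (h : Γ.First (f.pre '' T) x y) : ∀ a b, y = f.pre b →
      Γ.First (Set.range f.pre) x (f.pre a) → Δ.First T a b := by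
  induction h with
  | here x hx =>
    rintro a b rfl hf
    obtain ⟨c, hc, hcb⟩ := hx
    obtain rfl := f.pre_injective hcb
    obtain rfl := f.pre_injective (hf.eq_of_mem ⟨c, rfl⟩)
    exact First.here _ hc
  | step x y hx _ ih =>
    intro a b hy hf
    cases hf with
    | here _ _ =>
      refine First.step _ _ (fun ha => hx ⟨a, ha, rfl⟩) (ih _ _ hy ?_)
      rw [← f.pre_τ]
      exact f.cyclic _
    | step _ _ _ hf => exact ih a b hy hf

/-- If `h` collapses all edges collapsed by `c`, one may collapse those of `c` first. The remaining
map is the lift `p` of the half-edges, and each axiom is the one for `h` pulled back through `c`. -/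
theorem Hom.exists_factor (c : Γ ⟶ Θ) (h : Γ ⟶ Δ) (hr : Set.range h.pre ⊆ Set.range c.pre) :
    ∃ g : Θ ⟶ Δ, c ≫ g = h := by
  choose p hp using fun x => hr ⟨x, rfl⟩
  have hrange : Set.range h.pre = c.pre '' Set.range p := by
    rw [← Set.range_comp]
    exact congrArg Set.range (funext fun x => (hp x).symm)
  refine ⟨⟨p, fun x y hxy => h.pre_injective (by rw [← hp, ← hp, hxy]), fun x =>
    c.pre_injective (by rw [hp, h.pre_τ, c.pre_τ, hp]), fun x y => ?_, fun u => ?_, fun x => ?_,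
    ?_⟩, hom_ext' hp⟩
  · rw [h.sameVertex, hrange, ← hp, ← hp]
    exact ⟨fun hc => c.conn_of_pre _ hc _ _ (conn_refl _ _ _) (conn_refl _ _ _), c.conn_pre _⟩
  · obtain ⟨x, hx⟩ := h.exists_leaf (c.pre u)
    rw [hrange, ← hp] at hx
    exact ⟨x, c.conn_of_pre _ hx _ _ (conn_refl _ _ _) (conn_refl _ _ _)⟩
  · have h1 := h.cyclic x
    rw [hrange, ← hp] at h1
    exact Hom.first_of_pre c _ h1 _ _ (hp _).symm (c.cyclic _)
  · have := c.forest; have := h.forest; omega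

/-- The set of surviving half-edges determines the quotient up to isomorphism under the source. It
serves as the invariant of a collapse. -/
theorem Hom.exists_iso_of_range_eq (c : Γ ⟶ Θ) (h : Γ ⟶ Δ)
    (hr : Set.range h.pre = Set.range c.pre) : ∃ k : Θ ≅ Δ, c ≫ k.hom = h := by
  obtain ⟨g, hg⟩ := Hom.exists_factor c h hr.le
  obtain ⟨g', hg'⟩ := Hom.exists_factor h c hr.ge
  refine ⟨⟨g, g', ?_, ?_⟩, hg⟩
  · rw [← cancel_epi c, ← Category.assoc, hg, hg', Category.comp_id]
  · rw [← cancel_epi h, ← Category.assoc, hg', hg, Category.comp_id]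

/-! ### The map of vertices -/

/-- The map of vertices induced by a morphism. -/
def Hom.vmap (f : Γ ⟶ Δ) : Γ.V → Δ.V :=
  Quotient.lift (fun x => Δ.vert (f.exists_leaf x).choose) fun x y hxy =>
    vert_eq_iff.2 ((f.sameVertex _ _).2 (Relation.EqvGen.trans _ _ _
      (Relation.EqvGen.symm _ _ (f.exists_leaf x).choose_spec)
      (Relation.EqvGen.trans _ _ _ (Relation.EqvGen.rel _ _ (Or.inl hxy))
        (f.exists_leaf y).choose_spec)))

theorem Hom.vmap_vert_eq_iff (f : Γ ⟶ Δ) {x : Γ.H} {h : Δ.H} :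
    Hom.vmap f (Γ.vert x) = Δ.vert h ↔ Γ.Conn (Set.range f.pre) x (f.pre h) := by
  have hx := (f.exists_leaf x).choose_spec
  change Δ.vert (f.exists_leaf x).choose = _ ↔ _
  rw [vert_eq_iff, f.sameVertex]
  exact ⟨fun hc => Relation.EqvGen.trans _ _ _ hx hc,
    fun hc => Relation.EqvGen.trans _ _ _ (Relation.EqvGen.symm _ _ hx) hc⟩

theorem Hom.vmap_vert_pre (f : Γ ⟶ Δ) (h : Δ.H) : Hom.vmap f (Γ.vert (f.pre h)) = Δ.vert h :=
  (Hom.vmap_vert_eq_iff f).2 (conn_refl _ _ _)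

theorem Hom.vmap_eq_iff (f : Γ ⟶ Δ) {x y : Γ.H} :
    Hom.vmap f (Γ.vert x) = Hom.vmap f (Γ.vert y) ↔ Γ.Conn (Set.range f.pre) x y := by
  obtain ⟨h, hh⟩ := f.exists_leaf y
  rw [(Hom.vmap_vert_eq_iff f).2 hh, Hom.vmap_vert_eq_iff]
  exact ⟨fun hc => Relation.EqvGen.trans _ _ _ hc (Relation.EqvGen.symm _ _ hh),
    fun hc => Relation.EqvGen.trans _ _ _ hc hh⟩

theorem Hom.maps_inl_iff (f : Γ ⟶ Δ) {v : Γ.V} {w : Δ.V} :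
    Hom.Maps f (Sum.inl v) (Sum.inl w) ↔ Hom.vmap f v = w := by
  constructor
  · rintro ⟨x, h, rfl, rfl, hc⟩
    exact (Hom.vmap_vert_eq_iff f).2 hc
  · rintro rfl
    obtain ⟨x, rfl⟩ := Γ.vert_surjective v
    obtain ⟨h, hh⟩ := f.exists_leaf x
    exact ⟨x, h, rfl, ((Hom.vmap_vert_eq_iff f).2 hh).symm, hh⟩

theorem Hom.vmap_surjective (f : Γ ⟶ Δ) : Function.Surjective (Hom.vmap f) := by
  intro w
  obtain ⟨h, rfl⟩ := Δ.vert_surjective w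
  exact ⟨_, Hom.vmap_vert_pre f h⟩

theorem Hom.vmap_comp (f : Γ ⟶ Δ) (g : Δ ⟶ Θ) (v : Γ.V) :
    Hom.vmap (f ≫ g) v = Hom.vmap g (Hom.vmap f v) := by
  obtain ⟨x, rfl⟩ := Γ.vert_surjective v
  obtain ⟨h, hh⟩ := f.exists_leaf x
  obtain ⟨z, hz⟩ := g.exists_leaf h
  rw [(Hom.vmap_vert_eq_iff f).2 hh, (Hom.vmap_vert_eq_iff g).2 hz, Hom.vmap_vert_eq_iff]
  have hr : Set.range (Hom.pre (f ≫ g)) = f.pre '' Set.range g.pre := Set.range_comp f.pre g.pre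
  rw [hr]
  exact Relation.EqvGen.trans _ _ _ (conn_mono _ (Set.image_subset_range _ _) hh) (f.conn_pre _ hz)

end RibbonGraph

end FatGraph

namespace FatGraph

open RibbonGraph

namespace RibbonGraph

variable {Ω : Type u} {Γ Δ Θ : RibbonGraph Ω}

/-! ### Morphisms which collapse a single edge -/

/-- A four-cycle written with three transpositions, so that it is visibly odd. It is used for a
vertex that moves past three cells, and for the rotation of the half-edges at a vertex of valence
four. -/
theorem swap_mul_swap_mul_swap {α : Type*} [DecidableEq α] {p q r s : α} (hpq : p ≠ q)
    (hpr : p ≠ r) (hps : p ≠ s) (hqr : q ≠ r) (hqs : q ≠ s) (hrs : r ≠ s) :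
    (Equiv.swap p q * Equiv.swap q r * Equiv.swap r s) p = q ∧
    (Equiv.swap p q * Equiv.swap q r * Equiv.swap r s) q = r ∧
    (Equiv.swap p q * Equiv.swap q r * Equiv.swap r s) r = s ∧
    (Equiv.swap p q * Equiv.swap q r * Equiv.swap r s) s = p ∧
    ∀ x, x ≠ p → x ≠ q → x ≠ r → x ≠ s →
      (Equiv.swap p q * Equiv.swap q r * Equiv.swap r s) x = x := by
  refine ⟨?_, ?_, ?_, ?_, fun x h1 h2 h3 h4 => ?_⟩ <;>
    simp only [Equiv.Perm.mul_apply, Equiv.swap_apply_def] <;> grind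

/-- With a single edge available, the only new connection between vertices is the one between its
two ends. -/
theorem conn_edge {a x y : Γ.H} (h : Γ.Conn {a, Γ.τ a}ᶜ x y) :
    Γ.vert x = Γ.vert y ∨
      (Γ.vert x = Γ.vert a ∨ Γ.vert x = Γ.vert (Γ.τ a)) ∧
        (Γ.vert y = Γ.vert a ∨ Γ.vert y = Γ.vert (Γ.τ a)) := by
  induction h with
  | rel x y h =>
    rcases h with h | ⟨h, rfl⟩
    · exact Or.inl (vert_eq_iff.2 h)
    · simp only [Set.mem_compl_iff, not_not, Set.mem_insert_iff, Set.mem_singleton_iff] at h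
      rcases h with rfl | rfl
      · exact Or.inr ⟨Or.inl rfl, Or.inr rfl⟩
      · rw [Γ.τ_τ]
        exact Or.inr ⟨Or.inr rfl, Or.inl rfl⟩
  | refl => exact Or.inl rfl
  | symm _ _ _ ih => exact ih.imp Eq.symm And.symm
  | trans x y z _ _ ih1 ih2 =>
    rcases ih1 with ih1 | ih1 <;> rcases ih2 with ih2 | ih2
    · exact Or.inl (ih1.trans ih2)
    · rw [ih1]; exact Or.inr ih2
    · rw [← ih2]; exact Or.inr ih1
    · exact Or.inr ⟨ih1.1, ih2.2⟩

theorem conn_edge_self (a : Γ.H) : Γ.Conn {a, Γ.τ a}ᶜ a (Γ.τ a) :=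
  Relation.EqvGen.rel _ _ (Or.inr ⟨by simp, rfl⟩)

/-- The morphism `f` collapses precisely the edge of `a`. -/
def Hom.Collapses (f : Γ ⟶ Δ) (a : Γ.H) : Prop := Set.range f.pre = {a, Γ.τ a}ᶜ

theorem Hom.pre_τ_mem {f : Γ ⟶ Δ} {a : Γ.H} (h : Γ.τ a ∈ Set.range f.pre) :
    a ∈ Set.range f.pre := by
  obtain ⟨x, hx⟩ := h
  exact ⟨Δ.τ x, by rw [f.pre_τ, hx, Γ.τ_τ]⟩

/-- The range is stable under `τ`, so it misses both halves of the edge; by the count of half-edges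
it misses nothing else. -/
theorem Hom.collapses_of_notMem {f : Γ ⟶ Δ} (hc : Δ.codim = Γ.codim + 1) {a : Γ.H}
    (ha : a ∉ Set.range f.pre) : Hom.Collapses f a := by
  classical
  have hsub : Set.range f.pre ⊆ {a, Γ.τ a}ᶜ := by
    rintro _ ⟨x, rfl⟩ hx
    simp only [Set.mem_insert_iff, Set.mem_singleton_iff] at hx
    rcases hx with hx | hx
    · exact ha ⟨x, hx⟩
    · exact ha (Hom.pre_τ_mem ⟨x, hx⟩)
  refine Set.eq_of_subset_of_ncard_le hsub ?_
  have h1 := Set.ncard_add_ncard_compl ({a, Γ.τ a} : Set Γ.H)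
  rw [Set.ncard_pair (Γ.τ_ne a).symm, Nat.card_eq_fintype_card, Fintype.card_coe] at h1
  have h2 : (Set.range f.pre).ncard = Δ.H.card := by
    rw [← Set.image_univ, Set.ncard_image_of_injective _ f.pre_injective, Set.ncard_univ,
      Nat.card_eq_fintype_card, Fintype.card_coe]
  have := Hom.card_eq f
  omega

theorem Hom.exists_collapses (f : Γ ⟶ Δ) (hc : Δ.codim = Γ.codim + 1) :
    ∃ a, Hom.Collapses f a := by
  by_contra! h
  have hs : Function.Surjective f.pre := by
    intro a
    by_contra ha
    exact h a (Hom.collapses_of_notMem hc ha)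
  have := Hom.isIso_of_surjective f hs
  have := iso_codim (asIso f)
  omega

namespace Hom.Collapses

variable {f : Γ ⟶ Δ} {a : Γ.H}

theorem symm (h : Hom.Collapses f a) : Hom.Collapses f (Γ.τ a) := by
  rw [Hom.Collapses, Γ.τ_τ, Set.pair_comm]; exact h

theorem notMem (h : Hom.Collapses f a) : a ∉ Set.range f.pre := by
  rw [h]; simp

theorem notMem_τ (h : Hom.Collapses f a) : Γ.τ a ∉ Set.range f.pre := by
  rw [h]; simp

theorem pre_ne (h : Hom.Collapses f a) (x : Δ.H) : f.pre x ≠ a :=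
  fun hx => h.notMem ⟨x, hx⟩

theorem pre_ne_τ (h : Hom.Collapses f a) (x : Δ.H) : f.pre x ≠ Γ.τ a :=
  fun hx => h.notMem_τ ⟨x, hx⟩

theorem exists_pre (h : Hom.Collapses f a) {x : Γ.H} (h1 : x ≠ a) (h2 : x ≠ Γ.τ a) :
    ∃ y, f.pre y = x := by
  have : x ∈ Set.range f.pre := by rw [h]; simp [h1, h2]
  exact this

theorem eq_or_eq (h : Hom.Collapses f a) {b : Γ.H} (hb : b ∉ Set.range f.pre) :
    b = a ∨ b = Γ.τ a := by
  rw [h] at hb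
  simpa [or_iff_not_imp_left] using hb

theorem card_H (h : Hom.Collapses f a) : Γ.H.card = Δ.H.card + 2 := by
  have h1 := Set.ncard_add_ncard_compl ({a, Γ.τ a} : Set Γ.H)
  rw [Set.ncard_pair (Γ.τ_ne a).symm, Nat.card_eq_fintype_card, Fintype.card_coe, ← h,
    ← Set.image_univ, Set.ncard_image_of_injective _ f.pre_injective, Set.ncard_univ,
      Nat.card_eq_fintype_card, Fintype.card_coe] at h1
  omega

theorem codim (h : Hom.Collapses f a) : Δ.codim = Γ.codim + 1 := by
  have := h.card_H; have := Hom.card_eq f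
  omega

theorem vmap_eq_iff (h : Hom.Collapses f a) {v w : Γ.V} :
    Hom.vmap f v = Hom.vmap f w ↔ v = w ∨
      (v = Γ.vert a ∨ v = Γ.vert (Γ.τ a)) ∧ (w = Γ.vert a ∨ w = Γ.vert (Γ.τ a)) := by
  obtain ⟨x, rfl⟩ := Γ.vert_surjective v
  obtain ⟨y, rfl⟩ := Γ.vert_surjective w
  have hs := conn_edge_self a
  constructor
  · intro hv
    rw [Hom.vmap_eq_iff, h] at hv
    exact conn_edge hv
  · have hs' : Hom.vmap f (Γ.vert a) = Hom.vmap f (Γ.vert (Γ.τ a)) := by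
      rw [Hom.vmap_eq_iff, h]; exact hs
    rintro (h1 | ⟨h1 | h1, h2 | h2⟩)
    · rw [h1]
    all_goals rw [h1, h2]
    · exact hs'
    · exact hs'.symm

theorem vmap_vert_τ (h : Hom.Collapses f a) :
    Hom.vmap f (Γ.vert (Γ.τ a)) = Hom.vmap f (Γ.vert a) :=
  h.vmap_eq_iff.2 (Or.inr ⟨Or.inr rfl, Or.inl rfl⟩)

/-- If the edge were a loop, no vertices would be identified, contrary to the vertex count in
`forest`. -/
theorem vert_ne (h : Hom.Collapses f a) : Γ.vert a ≠ Γ.vert (Γ.τ a) := by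
  intro hv
  have hi : Function.Injective (Hom.vmap f) := by
    intro v w hvw
    rcases h.vmap_eq_iff.1 hvw with h1 | ⟨h1, h2⟩
    · exact h1
    · rw [← hv, or_self] at h1 h2
      rw [h1, h2]
  have := Nat.card_le_card_of_injective _ hi
  have := h.card_H
  have := f.forest
  omega

theorem exists_lift (h : Hom.Collapses f a) (w : Δ.V) :
    ∃ v, v ≠ Γ.vert (Γ.τ a) ∧ Hom.vmap f v = w := by
  obtain ⟨v, rfl⟩ := Hom.vmap_surjective f w
  by_cases hv : v = Γ.vert (Γ.τ a)
  · exact ⟨_, h.vert_ne, by rw [hv, h.vmap_vert_τ]⟩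
  · exact ⟨v, hv, rfl⟩

/-- The vertex over `w` which is not the target of the collapsed edge. -/
def lift (h : Hom.Collapses f a) (w : Δ.V) : Γ.V := (h.exists_lift w).choose

theorem lift_ne (h : Hom.Collapses f a) (w : Δ.V) : h.lift w ≠ Γ.vert (Γ.τ a) :=
  (h.exists_lift w).choose_spec.1

theorem vmap_lift (h : Hom.Collapses f a) (w : Δ.V) : Hom.vmap f (h.lift w) = w :=
  (h.exists_lift w).choose_spec.2

theorem lift_eq (h : Hom.Collapses f a) {v : Γ.V} (hv : v ≠ Γ.vert (Γ.τ a)) :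
    h.lift (Hom.vmap f v) = v := by
  rcases h.vmap_eq_iff.1 (h.vmap_lift (Hom.vmap f v)) with h1 | ⟨h1, h2⟩
  · exact h1
  · rw [h1.resolve_right (h.lift_ne _), h2.resolve_right hv]

/-- The cells of the source: the target of the collapsed edge, its two half-edges, and the lifts of
the cells of the target. -/
def cellFun (h : Hom.Collapses f a) : Fin 3 ⊕ Δ.Cell → Γ.Cell
  | Sum.inl i => ![Sum.inl (Γ.vert (Γ.τ a)), Sum.inr a, Sum.inr (Γ.τ a)] i
  | Sum.inr (Sum.inl w) => Sum.inl (h.lift w)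
  | Sum.inr (Sum.inr x) => Sum.inr (f.pre x)

theorem cellFun_bijective (h : Hom.Collapses f a) : Function.Bijective h.cellFun := by
  constructor
  · have h1 := h.pre_ne
    have h2 := h.pre_ne_τ
    have h3 := h.lift_ne
    have h1' := fun x => (h.pre_ne x).symm
    have h2' := fun x => (h.pre_ne_τ x).symm
    have h3' := fun x => (h.lift_ne x).symm
    have h4 := Γ.τ_ne a
    have h4' := (Γ.τ_ne a).symm
    rintro (i | w | x) (j | w' | x') hij
    · congr 1
      fin_cases i <;> fin_cases j <;> simp_all [cellFun]
    · fin_cases i <;> simp_all [cellFun]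
    · fin_cases i <;> simp_all [cellFun]
    · fin_cases j <;> simp_all [cellFun]
    · have := congrArg (Hom.vmap f) (Sum.inl.inj hij)
      rw [h.vmap_lift, h.vmap_lift] at this
      rw [this]
    · simp [cellFun] at hij
    · fin_cases j <;> simp_all [cellFun]
    · simp [cellFun] at hij
    · rw [f.pre_injective (Sum.inr.inj hij)]
  · rintro (v | x)
    · by_cases hv : v = Γ.vert (Γ.τ a)
      · exact ⟨Sum.inl 0, by rw [hv]; rfl⟩
      · exact ⟨Sum.inr (Sum.inl (Hom.vmap f v)), congrArg Sum.inl (h.lift_eq hv)⟩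
    · by_cases h1 : x = a
      · exact ⟨Sum.inl 1, by rw [h1]; rfl⟩
      by_cases h2 : x = Γ.τ a
      · exact ⟨Sum.inl 2, by rw [h2]; rfl⟩
      obtain ⟨y, rfl⟩ := h.exists_pre h1 h2
      exact ⟨Sum.inr (Sum.inr y), rfl⟩

/-- The cells of the source as a disjoint union. -/
def cellEquiv (h : Hom.Collapses f a) : Fin 3 ⊕ Δ.Cell ≃ Γ.Cell :=
  Equiv.ofBijective _ h.cellFun_bijective

theorem cellEquiv_inl (h : Hom.Collapses f a) (i : Fin 3) : h.cellEquiv (Sum.inl i) =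
    (![Sum.inl (Γ.vert (Γ.τ a)), Sum.inr a, Sum.inr (Γ.τ a)] : Fin 3 → Γ.Cell) i := rfl

theorem cellEquiv_vert (h : Hom.Collapses f a) (w : Δ.V) :
    h.cellEquiv (Sum.inr (Sum.inl w)) = Sum.inl (h.lift w) := rfl

theorem cellEquiv_eq_of_maps (h : Hom.Collapses f a) {x : Γ.Cell} {y : Δ.Cell}
    (hx : x ≠ Sum.inl (Γ.vert (Γ.τ a))) (hm : Hom.Maps f x y) :
    h.cellEquiv (Sum.inr y) = x := by
  rcases x with v | x <;> rcases y with w | y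
  · have := (Hom.maps_inl_iff f).1 hm
    subst this
    rw [cellEquiv_vert, h.lift_eq fun h => hx (congrArg _ h)]
  · exact hm.elim
  · exact hm.elim
  · exact congrArg Sum.inr hm.symm

theorem maps_cellEquiv (h : Hom.Collapses f a) (y : Δ.Cell) :
    Hom.Maps f (h.cellEquiv (Sum.inr y)) y := by
  rcases y with w | y
  · exact (Hom.maps_inl_iff f).2 (h.vmap_lift w)
  · exact rfl

/-- The orientation of the target which is induced by an orientation of the source. -/
def orn (h : Hom.Collapses f a) (o : Γ.Orientn) : Δ.Orientn := -(o.map h.cellEquiv.symm).drop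

theorem orn_neg (h : Hom.Collapses f a) (o : Γ.Orientn) : h.orn (-o) = -h.orn o := rfl

theorem orn_injective (h : Hom.Collapses f a) {o o' : Γ.Orientn} (ho : h.orn o = h.orn o') :
    o = o' := by
  have h1 := Orn.drop_injective (Orn.neg_inj' ho)
  rw [← Orn.map_symm_map h.cellEquiv o, h1, Orn.map_symm_map]

/-- The permutation of the cells that moves the source of the collapsed edge behind the target and
the half-edges. -/
def rotate (Γ : RibbonGraph Ω) [DecidableEq Γ.Cell] (a : Γ.H) : Equiv.Perm Γ.Cell :=
  Equiv.swap (Sum.inl (Γ.vert a)) (Sum.inl (Γ.vert (Γ.τ a))) *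
    Equiv.swap (Sum.inl (Γ.vert (Γ.τ a))) (Sum.inr a) * Equiv.swap (Sum.inr a) (Sum.inr (Γ.τ a))

theorem rotate_spec [DecidableEq Γ.Cell] (h : Hom.Collapses f a) :
    rotate Γ a (Sum.inl (Γ.vert a)) = Sum.inl (Γ.vert (Γ.τ a)) ∧
    rotate Γ a (Sum.inl (Γ.vert (Γ.τ a))) = Sum.inr a ∧
    rotate Γ a (Sum.inr a) = Sum.inr (Γ.τ a) ∧
    rotate Γ a (Sum.inr (Γ.τ a)) = Sum.inl (Γ.vert a) ∧
    ∀ x, x ≠ Sum.inl (Γ.vert a) → x ≠ Sum.inl (Γ.vert (Γ.τ a)) → x ≠ Sum.inr a →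
      x ≠ Sum.inr (Γ.τ a) → rotate Γ a x = x := by
  exact swap_mul_swap_mul_swap (by simpa using h.vert_ne) (by simp) (by simp) (by simp) (by simp)
    (by simpa using (Γ.τ_ne a).symm)

/-- `Induces` lists the source of the edge before its target and two half-edges, whereas `cellEquiv`
lists it after them, in the place of the merged vertex. One cell passes three others, which is the
minus sign in `orn`. -/
theorem sign_rotate [Fintype Γ.Cell] [DecidableEq Γ.Cell] (h : Hom.Collapses f a) :
    Equiv.Perm.sign (rotate Γ a) = -1 := by
  have h1 : (Sum.inl (Γ.vert a) : Γ.Cell) ≠ Sum.inl (Γ.vert (Γ.τ a)) := by simpa using h.vert_ne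
  have h2 : (Sum.inr a : Γ.Cell) ≠ Sum.inr (Γ.τ a) := by simpa using (Γ.τ_ne a).symm
  rw [rotate, Equiv.Perm.sign_mul, Equiv.Perm.sign_mul, Equiv.Perm.sign_swap h1,
    Equiv.Perm.sign_swap h2, Equiv.Perm.sign_swap (by simp)]
  decide

/-- The relation between the enumerations in the definition of `Induces` and `cellEquiv`. -/
theorem enum_eq [DecidableEq Γ.Cell] (h : Hom.Collapses f a) {m : ℕ} (e : Fin (m + 4) ≃ Γ.Cell)
    (e' : Fin (m + 1) ≃ Δ.Cell)
    (h0 : e 0 = Sum.inl (Γ.vert a)) (h1 : e 1 = Sum.inl (Γ.vert (Γ.τ a)))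
    (h2 : e 2 = Sum.inr a) (h3 : e 3 = Sum.inr (Γ.τ a))
    (h4 : Hom.Maps f (e 0) (e' 0)) (h5 : ∀ i : Fin m, Hom.Maps f (e (i.addNat 4)) (e' i.succ)) :
    (Orn.sumEnum e').trans h.cellEquiv =
      ((finCongr (by omega : 3 + (m + 1) = m + 4)).trans e).trans (rotate Γ a) := by
  obtain ⟨r0, r1, r2, r3, r4⟩ := h.rotate_spec
  have hne : ∀ (i : Fin m) (j : Fin 4), e (i.addNat 4) ≠ e ⟨j, by omega⟩ := by
    intro i j hij
    have := congrArg Fin.val (e.injective hij)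
    simp at this
    omega
  ext i
  obtain ⟨j, rfl⟩ := finSumFinEquiv.surjective i
  rcases j with j | j
  · have hl : ((Orn.sumEnum e').trans h.cellEquiv) (finSumFinEquiv (Sum.inl j)) =
        h.cellEquiv (Sum.inl j) := by simp [Orn.sumEnum]
    rw [hl, cellEquiv_inl]
    fin_cases j
    · exact (r0 ▸ congrArg (rotate Γ a) h0).symm
    · exact (r1 ▸ congrArg (rotate Γ a) h1).symm
    · exact (r2 ▸ congrArg (rotate Γ a) h2).symm
  · have hl : ((Orn.sumEnum e').trans h.cellEquiv) (finSumFinEquiv (Sum.inr j)) =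
        h.cellEquiv (Sum.inr (e' j)) := by simp [Orn.sumEnum]
    rw [hl]
    refine Fin.cases ?_ (fun j => ?_) j
    · rw [h.cellEquiv_eq_of_maps ?_ h4, h0]
      · exact (r3 ▸ congrArg (rotate Γ a) h3).symm
      · rw [h0]; simpa using h.vert_ne
    · have e1 : ((finCongr (by omega : 3 + (m + 1) = m + 4)).trans e)
          (finSumFinEquiv (Sum.inr j.succ)) = e (j.addNat 4) := by
        refine congrArg e (Fin.ext ?_)
        simp
      rw [h.cellEquiv_eq_of_maps (h1 ▸ hne j 1) (h5 j), Equiv.trans_apply, e1, r4]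
      · exact h0 ▸ hne j 0
      · exact h1 ▸ hne j 1
      · exact h2 ▸ hne j 2
      · exact h3 ▸ hne j 3

/-- Reversing the edge exchanges its two half-edges and also its two end vertices: two
transpositions. -/
theorem orn_τ (h : Hom.Collapses f a) (o : Γ.Orientn) : h.symm.orn o = h.orn o := by
  classical
  have _ : Fintype Γ.H := inferInstance
  obtain ⟨_⟩ := nonempty_fintype Δ.V
  rw [orn, orn]
  congr 2
  let w := Hom.vmap f (Γ.vert a)
  -- The merged vertex `w` stands for the end of the edge that is not among the three removed cells,
  -- so exchanging the ends exchanges `Sum.inl 0` with `w`.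
  let π : Equiv.Perm (Fin 3 ⊕ Δ.Cell) :=
    Equiv.swap (Sum.inl 1) (Sum.inl 2) * Equiv.swap (Sum.inl 0) (Sum.inr (Sum.inl w))
  have hπ : Equiv.Perm.sign π = 1 := by
    rw [Equiv.Perm.sign_mul, Equiv.Perm.sign_swap (by simp), Equiv.Perm.sign_swap (by simp)]
    decide
  have key : h.symm.cellEquiv = Equiv.trans π h.cellEquiv := by
    ext x
    rw [Equiv.trans_apply]
    rcases x with i | v | y
    · fin_cases i
      · have : π (Sum.inl 0) = Sum.inr (Sum.inl w) := by
          simp only [π, Equiv.Perm.mul_apply, Equiv.swap_apply_left]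
          rw [Equiv.swap_apply_of_ne_of_ne (by simp) (by simp)]
        refine Eq.trans ?_ (congrArg h.cellEquiv this).symm
        rw [cellEquiv_vert, h.lift_eq h.vert_ne]
        exact congrArg (fun z => Sum.inl (Γ.vert z)) (Γ.τ_τ a)
      · have : π (Sum.inl 1) = Sum.inl 2 := by
          simp [π, Equiv.swap_apply_def]
        exact (congrArg h.cellEquiv this).symm
      · have : π (Sum.inl 2) = Sum.inl 1 := by
          simp [π, Equiv.swap_apply_def]
        refine Eq.trans ?_ (congrArg h.cellEquiv this).symm
        exact congrArg Sum.inr (Γ.τ_τ a)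
    · rw [cellEquiv_vert]
      by_cases hv : v = w
      · have : π (Sum.inr (Sum.inl v)) = Sum.inl 0 := by
          rw [hv]
          simp only [π, Equiv.Perm.mul_apply, Equiv.swap_apply_right]
          rw [Equiv.swap_apply_of_ne_of_ne (by simp) (by simp)]
        rw [this, hv]
        refine congrArg Sum.inl ?_
        refine Eq.trans ?_ (h.symm.lift_eq (v := Γ.vert (Γ.τ a)) ?_)
        · rw [h.vmap_vert_τ]
        · rw [Γ.τ_τ]; exact h.vert_ne.symm
      · have : π (Sum.inr (Sum.inl v)) = Sum.inr (Sum.inl v) := by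
          simp [π, Equiv.swap_apply_def, hv]
        rw [this, cellEquiv_vert]
        refine congrArg Sum.inl ?_
        have hl : h.lift v ≠ Γ.vert (Γ.τ (Γ.τ a)) := by
          intro hl
          refine hv ?_
          rw [← h.vmap_lift v, hl, Γ.τ_τ]
        have := h.symm.lift_eq hl
        rwa [h.vmap_lift] at this
    · have : π (Sum.inr (Sum.inr y)) = Sum.inr (Sum.inr y) := by
        simp [π, Equiv.swap_apply_def]
      rw [this]
      rfl
  have h2 : (o.map h.symm.cellEquiv.symm).map π = o.map h.cellEquiv.symm := by
    rw [Orn.map_map]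
    congr 1
    rw [key]
    ext x
    simp
  rw [← h2, (Orn.map_perm _ π).1 hπ]

/-- `Induces` leaves the enumerations and the direction of the edge open. The enumerations are
compared by `enum_eq`, and the direction is irrelevant by `orn_τ`. -/
theorem induces_orn (h : Hom.Collapses f a) {o : Γ.Orientn} {o' : Δ.Orientn}
    (hi : Induces f o o') : o' = h.orn o := by
  classical
  obtain ⟨_⟩ := nonempty_fintype Γ.V
  obtain ⟨m, e, e', b, hb, h0, h1, h2, h3, h4, h5, h6⟩ := hi
  have hb' : Hom.Collapses f b := by
    rcases h.eq_or_eq hb with rfl | rfl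
    exacts [h, h.symm]
  have : o' = hb'.orn o := by
    refine Orn.eq_of_sgn e' ?_
    change _ = -o.sgn ((Orn.sumEnum e').trans hb'.cellEquiv)
    rw [hb'.enum_eq e e' h0 h1 h2 h3 h4 h5, Orn.sgn_trans_perm, hb'.sign_rotate,
      Orn.sgn_finCongr, neg_one_mul, neg_neg, h6]
  rw [this]
  rcases h.eq_or_eq hb with rfl | rfl
  · rfl
  · exact h.orn_τ o

theorem orn_induces (h : Hom.Collapses f a) (o : Γ.Orientn) : Induces f o (h.orn o) := by
  classical
  obtain ⟨_⟩ := nonempty_fintype Γ.V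
  obtain ⟨k, ⟨d⟩⟩ := Finite.exists_equiv_fin Δ.Cell
  obtain ⟨m, rfl⟩ : ∃ m, k = m + 1 := by
    refine Nat.exists_eq_succ_of_ne_zero ?_
    rintro rfl
    exact (d (Sum.inl (Hom.vmap f (Γ.vert a)))).elim0
  let y : Δ.Cell := Sum.inl (Hom.vmap f (Γ.vert a))
  -- An arbitrary enumeration is corrected by a transposition so that the merged vertex comes first,
  -- as `Induces` demands.
  let e' : Fin (m + 1) ≃ Δ.Cell := d.symm.trans (Equiv.swap (d.symm 0) y)
  have he' : e' 0 = y := by simp [e']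
  let E := (Orn.sumEnum e').trans h.cellEquiv
  let e : Fin (m + 4) ≃ Γ.Cell :=
    ((finCongr (by omega : m + 4 = 3 + (m + 1))).trans E).trans (rotate Γ a).symm
  obtain ⟨r0, r1, r2, r3, r4⟩ := h.rotate_spec
  have hl : ∀ j, E (finSumFinEquiv (Sum.inl j)) = h.cellEquiv (Sum.inl j) := by
    simp [E, Orn.sumEnum]
  have hr : ∀ j, E (finSumFinEquiv (Sum.inr j)) = h.cellEquiv (Sum.inr (e' j)) := by
    simp [E, Orn.sumEnum]
  have h0 : e 0 = Sum.inl (Γ.vert a) := by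
    refine (Equiv.symm_apply_eq _).2 (Eq.trans ?_ r0.symm)
    exact hl 0
  have h1 : e 1 = Sum.inl (Γ.vert (Γ.τ a)) := by
    refine (Equiv.symm_apply_eq _).2 (Eq.trans ?_ r1.symm)
    refine Eq.trans ?_ (hl 1)
    rw [Equiv.trans_apply]
    refine congrArg E (Fin.ext ?_)
    simp
  have h2 : e 2 = Sum.inr a := by
    refine (Equiv.symm_apply_eq _).2 (Eq.trans ?_ r2.symm)
    refine Eq.trans ?_ (hl 2)
    rw [Equiv.trans_apply]
    refine congrArg E (Fin.ext ?_)
    simp [Nat.mod_eq_of_lt]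
  have h3 : e 3 = Sum.inr (Γ.τ a) := by
    refine (Equiv.symm_apply_eq _).2 (Eq.trans ?_ r3.symm)
    have h0' := hr 0
    rw [he'] at h0'
    refine Eq.trans (congrArg E (?_ : finCongr _ 3 = _)) (h0'.trans ?_)
    · refine Fin.ext ?_
      simp [Nat.mod_eq_of_lt]
    · exact congrArg Sum.inl (h.lift_eq h.vert_ne)
  have hne : ∀ (i : Fin m) (j : Fin 4), e (i.addNat 4) ≠ e ⟨j, by omega⟩ := by
    intro i j hij
    have := congrArg Fin.val (e.injective hij)
    simp at this
    omega
  have h5 : ∀ i : Fin m, e (i.addNat 4) = h.cellEquiv (Sum.inr (e' i.succ)) := by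
    intro i
    rw [← r4 (e (i.addNat 4)) (h0 ▸ hne i 0) (h1 ▸ hne i 1) (h2 ▸ hne i 2) (h3 ▸ hne i 3), ← hr]
    refine ((rotate Γ a).apply_symm_apply _).trans (congrArg E (Fin.ext ?_))
    simp
    omega
  have h4 : Hom.Maps f (e 0) (e' 0) := by
    rw [h0, he']
    exact (Hom.maps_inl_iff f).2 rfl
  have h5' : ∀ i : Fin m, Hom.Maps f (e (i.addNat 4)) (e' i.succ) := by
    intro i
    rw [h5]
    exact h.maps_cellEquiv _
  refine ⟨m, e, e', a, h.notMem, h0, h1, h2, h3, h4, h5', ?_⟩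
  change _ = -o.sgn ((Orn.sumEnum e').trans h.cellEquiv)
  rw [h.enum_eq e e' h0 h1 h2 h3 h4 h5', Orn.sgn_trans_perm (π := rotate Γ a), h.sign_rotate,
    Orn.sgn_finCongr, neg_one_mul, neg_neg]

theorem induces_iff (h : Hom.Collapses f a) {o : Γ.Orientn} {o' : Δ.Orientn} :
    Induces f o o' ↔ o' = h.orn o :=
  ⟨h.induces_orn, fun ho => ho ▸ h.orn_induces o⟩

end Hom.Collapses

theorem Induces.unique {f : Γ ⟶ Δ} (hc : Δ.codim = Γ.codim + 1) {o : Γ.Orientn}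
    {o₁ o₂ : Δ.Orientn} (h1 : Induces f o o₁) (h2 : Induces f o o₂) : o₁ = o₂ := by
  obtain ⟨a, ha⟩ := Hom.exists_collapses f hc
  rw [ha.induces_orn h1, ha.induces_orn h2]

theorem Induces.source_unique {f : Γ ⟶ Δ} (hc : Δ.codim = Γ.codim + 1) {o₁ o₂ : Γ.Orientn}
    {o : Δ.Orientn} (h1 : Induces f o₁ o) (h2 : Induces f o₂ o) : o₁ = o₂ := by
  obtain ⟨a, ha⟩ := Hom.exists_collapses f hc
  exact ha.orn_injective ((ha.induces_orn h1).symm.trans (ha.induces_orn h2))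

theorem Induces.exists_target (f : Γ ⟶ Δ) (hc : Δ.codim = Γ.codim + 1) (o : Γ.Orientn) :
    ∃ o', Induces f o o' := by
  obtain ⟨a, ha⟩ := Hom.exists_collapses f hc
  exact ⟨_, ha.orn_induces o⟩

/-- There are only two orientations, and reversal on the source reverses the target. -/
theorem Induces.exists_source (f : Γ ⟶ Δ) (hc : Δ.codim = Γ.codim + 1) (o' : Δ.Orientn) :
    ∃ o, Induces f o o' := by
  obtain ⟨o⟩ : Nonempty Γ.Orientn := inferInstance
  obtain ⟨o₁, h⟩ := Induces.exists_target f hc o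
  rcases Orn.eq_or_neg o₁ o' with rfl | rfl
  · exact ⟨o, h⟩
  · exact ⟨-o, h.neg⟩

end RibbonGraph

end FatGraph

namespace FatGraph

open RibbonGraph

namespace RibbonGraph

variable {Ω : Type u} {Γ Δ Θ : RibbonGraph Ω}

/-! ### Construction of ribbon graphs and of morphisms collapsing an edge -/

/-- A ribbon graph may be given on any finite set which embeds into `Ω`. -/
theorem exists_ofType {T : Type*} [Finite T] (i : T → Ω) (hi : Function.Injective i)
    (τ σ : Equiv.Perm T) (h1 : ∀ x, τ x ≠ x) (h2 : ∀ x, τ (τ x) = x) (h3 : ∀ x, σ x ≠ x)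
    (h4 : ∀ x, σ (σ x) ≠ x) [Nonempty T]
    (h5 : ∀ x y, Relation.EqvGen (fun a b => b = σ a ∨ b = τ a) x y) :
    ∃ (Γ : RibbonGraph Ω) (e : Γ.H ≃ T), (∀ x, e (Γ.σ x) = σ (e x)) ∧
      ∀ x, e (Γ.τ x) = τ (e x) := by
  classical
  obtain ⟨_⟩ := nonempty_fintype T
  let e : ↥(Finset.univ.image i) ≃ T :=
    (Equiv.ofBijective (fun t : T => (⟨i t, Finset.mem_image_of_mem i (Finset.mem_univ t)⟩ :
      ↥(Finset.univ.image i))) ⟨fun s t h => hi (congrArg Subtype.val h), by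
        rintro ⟨x, hx⟩
        obtain ⟨t, _, rfl⟩ := Finset.mem_image.1 hx
        exact ⟨t, rfl⟩⟩).symm
  refine ⟨⟨Finset.univ.image i, e.permCongr.symm τ, e.permCongr.symm σ, fun x h => ?_, fun x => ?_,
    fun x h => ?_, fun x h => ?_, ?_, fun x y => ?_⟩, e, fun x => ?_, fun x => ?_⟩
  · exact h1 (e x) (by simpa [Equiv.symm_apply_eq] using h)
  · simp [h2]
  · exact h3 (e x) (by simpa [Equiv.symm_apply_eq] using h)
  · exact h4 (e x) (by simpa [Equiv.symm_apply_eq] using h)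
  · exact Finset.univ_nonempty.image i
  · have key : ∀ s t, Relation.EqvGen (fun a b => b = σ a ∨ b = τ a) s t →
        Relation.EqvGen (fun a b => b = e.permCongr.symm σ a ∨ b = e.permCongr.symm τ a)
          (e.symm s) (e.symm t) := by
      intro s t hst
      induction hst with
      | rel s t h =>
        refine Relation.EqvGen.rel _ _ ?_
        rcases h with rfl | rfl
        · exact Or.inl (by simp)
        · exact Or.inr (by simp)
      | refl => exact Relation.EqvGen.refl _
      | symm _ _ _ ih => exact Relation.EqvGen.symm _ _ ih
      | trans _ _ _ _ _ ih1 ih2 => exact Relation.EqvGen.trans _ _ _ ih1 ih2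
    simpa using key (e x) (e y) (h5 _ _)
  · simp
  · simp

/-- Walking around a vertex from `σ a` to `σ⁻¹ a`. -/
theorem walk {a : Γ.H} (hv : Γ.vert a ≠ Γ.vert (Γ.τ a)) (Q : Γ.H → Γ.H → Prop)
    (hrefl : ∀ x, Q x x) (htrans : ∀ x y z, Q x y → Q y z → Q x z)
    (hQ : ∀ x, x ≠ a → x ≠ Γ.τ a → Γ.σ x ≠ a → Γ.σ x ≠ Γ.τ a → Q x (Γ.σ x)) :
    Q (Γ.σ a) (Γ.σ.symm a) := by
  classical
  have hex : ∃ n : ℕ, (Γ.σ ^ n) (Γ.σ a) = a :=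
    (Equiv.Perm.sameCycle_apply_left.2 (Equiv.Perm.SameCycle.refl _ _)).exists_nat_pow_eq
  have hτ : ∀ n : ℕ, (Γ.σ ^ n) (Γ.σ a) ≠ Γ.τ a := fun n h => hv (by rw [← h, vert_pow, vert_σ])
  have key : ∀ n < Nat.find hex, Q (Γ.σ a) ((Γ.σ ^ n) (Γ.σ a)) := by
    intro n
    induction n with
    | zero => exact fun _ => hrefl _
    | succ n ih =>
      intro hn
      have h1 := ih (by omega)
      have h2 : (Γ.σ ^ (n + 1)) (Γ.σ a) ≠ a := Nat.find_min hex hn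
      have h3 : (Γ.σ ^ n) (Γ.σ a) ≠ a := Nat.find_min hex (by omega)
      have h4 := hτ (n + 1)
      rw [pow_succ', Equiv.Perm.mul_apply] at h2 h4 ⊢
      exact htrans _ _ _ h1 (hQ _ h3 (hτ n) h2 h4)
  have hpos : 0 < Nat.find hex := by
    rw [Nat.find_pos]
    exact Γ.σ_ne a
  obtain ⟨n, hn⟩ := Nat.exists_eq_succ_of_ne_zero hpos.ne'
  have h := key n (by omega)
  have h2 := Nat.find_spec hex
  rw [hn, Nat.succ_eq_add_one, pow_succ', Equiv.Perm.mul_apply] at h2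
  rwa [(Equiv.eq_symm_apply _).2 h2] at h

section OfEdge

variable {a : Γ.H}

theorem σ_ne_τ (hv : Γ.vert a ≠ Γ.vert (Γ.τ a)) (x : Γ.H) (hx : Γ.vert x = Γ.vert a) : Γ.σ x ≠ Γ.τ a :=
  fun h => hv (by rw [← h, vert_σ, hx])

theorem σ_τ_ne (hv : Γ.vert a ≠ Γ.vert (Γ.τ a)) (x : Γ.H) (hx : Γ.vert x = Γ.vert (Γ.τ a)) : Γ.σ x ≠ a :=
  fun h => hv (by rw [← hx, ← vert_σ x, h])

open Classical in
/-- Skip the half-edges of the edge of `a` when walking around. -/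
def skip (a x : Γ.H) : Γ.H :=
  if x = a then Γ.σ (Γ.τ a) else if x = Γ.τ a then Γ.σ a else x

theorem skip_self (a : Γ.H) : skip a a = Γ.σ (Γ.τ a) := if_pos rfl

theorem skip_τ (a : Γ.H) : skip a (Γ.τ a) = Γ.σ a := by
  rw [skip, if_neg (Γ.τ_ne a), if_pos rfl]

theorem skip_of_ne {a x : Γ.H} (h1 : x ≠ a) (h2 : x ≠ Γ.τ a) : skip a x = x := by
  rw [skip, if_neg h1, if_neg h2]

/-- A map of half-edges which is compatible with `τ` and with the contraction of an edge gives a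
morphism. -/
theorem Hom.exists_ofEdge (p : Δ.H → Γ.H) (hp : Function.Injective p)
    (hτ : ∀ h, p (Δ.τ h) = Γ.τ (p h)) (hr : Set.range p = {a, Γ.τ a}ᶜ)
    (hv : Γ.vert a ≠ Γ.vert (Γ.τ a)) (hσ : ∀ h, p (Δ.σ h) = skip a (Γ.σ (p h))) :
    ∃ f : Γ ⟶ Δ, f.pre = p := by
  classical
  have hex : ∀ x, x ≠ a → x ≠ Γ.τ a → ∃ h, p h = x := by
    intro x h1 h2
    have : x ∈ Set.range p := by rw [hr]; simp [h1, h2]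
    exact this
  have hpa : ∀ h, p h ≠ a := by
    intro h ha
    have : a ∈ Set.range p := ⟨h, ha⟩
    rw [hr] at this
    simp at this
  have hpτ : ∀ h, p h ≠ Γ.τ a := by
    intro h ha
    have : Γ.τ a ∈ Set.range p := ⟨h, ha⟩
    rw [hr] at this
    simp at this
  have hσa1 : Γ.σ a ≠ a := Γ.σ_ne a
  have hσa2 : Γ.σ a ≠ Γ.τ a := σ_ne_τ hv a rfl
  have hστ1 : Γ.σ (Γ.τ a) ≠ a := σ_τ_ne hv _ rfl
  have hστ2 : Γ.σ (Γ.τ a) ≠ Γ.τ a := Γ.σ_ne _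
  have hS : a ∉ Set.range p := fun ⟨h, hh⟩ => hpa h hh
  have hSτ : Γ.τ a ∉ Set.range p := fun ⟨h, hh⟩ => hpτ h hh
  have cyc : ∀ h, Γ.First (Set.range p) (Γ.σ (p h)) (p (Δ.σ h)) := by
    intro h
    rw [hσ]
    by_cases h1 : Γ.σ (p h) = a
    · rw [h1, skip_self]
      exact First.step _ _ hS (First.here _ (hex _ hστ1 hστ2))
    by_cases h2 : Γ.σ (p h) = Γ.τ a
    · rw [h2, skip_τ]
      refine First.step _ _ hSτ ?_
      rw [Γ.τ_τ]
      exact First.here _ (hex _ hσa1 hσa2)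
    rw [skip_of_ne h1 h2]
    exact First.here _ (hex _ h1 h2)
  -- The two half-edges of the edge are moved one step around their vertices. They then lie in the
  -- range of `p`, so every half-edge of `Γ` acquires a vertex `w` of `Δ`.
  let nx : Γ.H → Γ.H := fun x => if x = a ∨ x = Γ.τ a then Γ.σ x else x
  have hnx : ∀ x, ∃ h, p h = nx x := by
    intro x
    by_cases hx : x = a ∨ x = Γ.τ a
    · simp only [nx, if_pos hx]
      rcases hx with rfl | rfl
      exacts [hex _ hσa1 hσa2, hex _ hστ1 hστ2]
    · simp only [nx, if_neg hx]
      exact hex _ (fun h => hx (Or.inl h)) (fun h => hx (Or.inr h))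
  choose l hl using hnx
  let w : Γ.H → Δ.V := fun x => Δ.vert (l x)
  have hwp : ∀ h, w (p h) = Δ.vert h := by
    intro h
    refine congrArg Δ.vert (hp ?_)
    rw [hl]
    simp [nx, hpa, hpτ]
  have hwa : w a = w (Γ.σ a) := by
    refine congrArg Δ.vert (hp ?_)
    rw [hl, hl]
    simp [nx, hσa1, hσa2]
  have hwτ : w (Γ.τ a) = w (Γ.σ (Γ.τ a)) := by
    refine congrArg Δ.vert (hp ?_)
    rw [hl, hl]
    simp [nx, hστ1, hστ2]
  have hws : ∀ h, w (skip a (Γ.σ (p h))) = w (p h) := by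
    intro h
    rw [← hσ, hwp, hwp, vert_σ]
  -- The heart of the proof: walking around the vertex of `a` from `σ a` to `σ⁻¹ a` does not change
  -- `w`, and the next step in `Δ` skips `a` and arrives at `σ (τ a)`.
  have hwaτ : w a = w (Γ.τ a) := by
    have h1 := walk hv (fun x y => w x = w y) (fun _ => rfl) (fun _ _ _ => Eq.trans) (by
      intro x h1 h2 h3 h4
      obtain ⟨h, rfl⟩ := hex x h1 h2
      rw [← hws h, skip_of_ne h3 h4])
    obtain ⟨h, hh⟩ := hex (Γ.σ.symm a) (fun h => by
        rw [Equiv.symm_apply_eq] at h; exact Γ.σ_ne a h.symm) (fun h => by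
        rw [Equiv.symm_apply_eq] at h; exact hστ1 h.symm)
    have h2 := hws h
    rw [hh, Equiv.apply_symm_apply, skip_self] at h2
    exact hwa.trans (h1.trans (h2.symm.trans hwτ.symm))
  have hwσ : ∀ x, w (Γ.σ x) = w x := by
    intro x
    by_cases h1 : x = a
    · rw [h1, hwa]
    by_cases h2 : x = Γ.τ a
    · rw [h2, hwτ]
    obtain ⟨h, rfl⟩ := hex x h1 h2
    have h5 := hws h
    by_cases h3 : Γ.σ (p h) = a
    · rw [h3, skip_self] at h5
      rw [h3, hwaτ, hwτ, h5]
    by_cases h4 : Γ.σ (p h) = Γ.τ a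
    · rw [h4, skip_τ] at h5
      rw [h4, ← hwaτ, hwa, h5]
    rwa [skip_of_ne h3 h4] at h5
  have hwv : ∀ x y, Γ.σ.SameCycle x y → w x = w y := by
    intro x y h
    obtain ⟨n, rfl⟩ := h.exists_nat_pow_eq
    clear h
    induction n with
    | zero => rfl
    | succ n ih => rw [pow_succ', Equiv.Perm.mul_apply, hwσ, ← ih]
  have hwc : ∀ x y, Γ.Conn (Set.range p) x y → w x = w y := by
    intro x y h
    induction h with
    | rel x y h =>
      rcases h with h | ⟨h, rfl⟩
      · exact hwv _ _ h
      · rw [hr] at h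
        simp only [Set.mem_compl_iff, not_not, Set.mem_insert_iff, Set.mem_singleton_iff] at h
        rcases h with rfl | rfl
        · exact hwaτ
        · rw [Γ.τ_τ]; exact hwaτ.symm
    | refl => rfl
    | symm _ _ _ ih => exact ih.symm
    | trans _ _ _ _ _ ih1 ih2 => exact ih1.trans ih2
  have hcσ : ∀ x, Γ.Conn (Set.range p) x (Γ.σ x) := fun x =>
    Relation.EqvGen.rel _ _ (Or.inl (vert_eq_iff.1 (vert_σ x).symm))
  have hca : Γ.Conn (Set.range p) a (Γ.τ a) := Relation.EqvGen.rel _ _ (Or.inr ⟨hS, rfl⟩)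
  have hcp : ∀ h, Γ.Conn (Set.range p) (p h) (p (Δ.σ h)) := by
    intro h
    rw [hσ]
    have h0 := hcσ (p h)
    by_cases h1 : Γ.σ (p h) = a
    · rw [h1] at h0
      rw [h1, skip_self]
      exact Relation.EqvGen.trans _ _ _ h0 (Relation.EqvGen.trans _ _ _ hca (hcσ _))
    by_cases h2 : Γ.σ (p h) = Γ.τ a
    · rw [h2] at h0
      rw [h2, skip_τ]
      exact Relation.EqvGen.trans _ _ _ h0 (Relation.EqvGen.trans _ _ _
        (Relation.EqvGen.symm _ _ hca) (hcσ _))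
    rwa [skip_of_ne h1 h2]
  have same : ∀ h h', Δ.σ.SameCycle h h' ↔ Γ.Conn (Set.range p) (p h) (p h') := by
    intro h h'
    constructor
    · intro hh
      obtain ⟨n, rfl⟩ := hh.exists_nat_pow_eq
      clear hh
      induction n with
      | zero => exact conn_refl _ _ _
      | succ n ih =>
        rw [pow_succ', Equiv.Perm.mul_apply]
        exact Relation.EqvGen.trans _ _ _ ih (hcp _)
    · intro hh
      have := hwc _ _ hh
      rw [hwp, hwp] at this
      exact vert_eq_iff.1 this
  refine ⟨⟨p, hp, hτ, same, fun x => ?_, cyc, ?_⟩, rfl⟩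
  · by_cases h1 : x = a
    · obtain ⟨h, hh⟩ := hex _ hσa1 hσa2
      exact ⟨h, by rw [hh, h1]; exact hcσ _⟩
    by_cases h2 : x = Γ.τ a
    · obtain ⟨h, hh⟩ := hex _ hστ1 hστ2
      exact ⟨h, by rw [hh, h2]; exact hcσ _⟩
    obtain ⟨h, rfl⟩ := hex x h1 h2
    exact ⟨h, conn_refl _ _ _⟩
  · have hH : Γ.H.card = Δ.H.card + 2 := by
      have h1 := Set.ncard_add_ncard_compl ({a, Γ.τ a} : Set Γ.H)
      rw [Set.ncard_pair (Γ.τ_ne a).symm, Nat.card_eq_fintype_card, Fintype.card_coe, ← hr,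
        ← Set.image_univ, Set.ncard_image_of_injective _ hp, Set.ncard_univ,
        Nat.card_eq_fintype_card, Fintype.card_coe] at h1
      omega
    let W : Γ.V → Δ.V := Quotient.lift w hwv
    have hW : ∀ x, W (Γ.vert x) = w x := fun _ => rfl
    have hWc : ∀ x y, w x = w y → Γ.Conn (Set.range p) x y := by
      have hlx : ∀ x, Γ.Conn (Set.range p) x (p (l x)) := by
        intro x
        rw [hl]
        by_cases hx : x = a ∨ x = Γ.τ a
        · simp only [nx, if_pos hx]; exact hcσ x
        · simp only [nx, if_neg hx]; exact conn_refl _ _ _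
      intro x y hxy
      exact Relation.EqvGen.trans _ _ _ (hlx x) (Relation.EqvGen.trans _ _ _
        ((same _ _).1 (vert_eq_iff.1 hxy)) (Relation.EqvGen.symm _ _ (hlx y)))
    -- The vertices of `Δ` correspond to those of `Γ` other than the target of the edge, since only
    -- its two ends are merged.
    have hV : Nat.card Δ.V = ({Γ.vert (Γ.τ a)}ᶜ : Set Γ.V).ncard := by
      rw [← Nat.card_coe_set_eq]
      refine (Nat.card_congr (Equiv.ofBijective (fun v : ({Γ.vert (Γ.τ a)}ᶜ : Set Γ.V) => W v)
        ⟨?_, ?_⟩)).symm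
      · rintro ⟨v, hv1⟩ ⟨v', hv2⟩ hh
        obtain ⟨x, rfl⟩ := Γ.vert_surjective v
        obtain ⟨y, rfl⟩ := Γ.vert_surjective v'
        have hc := hWc x y hh
        rw [hr] at hc
        refine Subtype.ext ?_
        rcases conn_edge hc with h1 | ⟨h1, h2⟩
        · exact h1
        · exact (h1.resolve_right hv1).trans (h2.resolve_right hv2).symm
      · intro u
        obtain ⟨h, rfl⟩ := Δ.vert_surjective u
        by_cases hh : Γ.vert (p h) = Γ.vert (Γ.τ a)
        · refine ⟨⟨Γ.vert a, hv⟩, ?_⟩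
          change w a = _
          rw [hwaτ, ← hwp h]
          exact hwv _ _ (vert_eq_iff.1 hh.symm)
        · exact ⟨⟨Γ.vert (p h), hh⟩, hwp h⟩
    have h1 := Set.ncard_add_ncard_compl ({Γ.vert (Γ.τ a)} : Set Γ.V)
    rw [Set.ncard_singleton] at h1
    omega

end OfEdge

/-- The contraction of an edge which is not a loop. -/
theorem exists_contraction {a : Γ.H} (hv : Γ.vert a ≠ Γ.vert (Γ.τ a)) :
    ∃ (Δ : RibbonGraph Ω) (f : Γ ⟶ Δ), Hom.Collapses f a := by
  classical
  let T : Type u := {x : Γ.H // x ≠ a ∧ x ≠ Γ.τ a}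
  have hσa1 : Γ.σ a ≠ a := Γ.σ_ne a
  have hσa2 : Γ.σ a ≠ Γ.τ a := σ_ne_τ hv a rfl
  have hστ1 : Γ.σ (Γ.τ a) ≠ a := σ_τ_ne hv _ rfl
  have hστ2 : Γ.σ (Γ.τ a) ≠ Γ.τ a := Γ.σ_ne _
  have hskip : ∀ x, skip a x ≠ a ∧ skip a x ≠ Γ.τ a := by
    intro x
    rw [skip]
    split_ifs with h1 h2
    exacts [⟨hστ1, hστ2⟩, ⟨hσa1, hσa2⟩, ⟨h1, h2⟩]
  have hτT : ∀ x : T, Γ.τ x ≠ a ∧ Γ.τ x ≠ Γ.τ a := fun x =>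
    ⟨fun h => x.2.2 ((Γ.τ_τ x).symm.trans (congrArg Γ.τ h)), fun h => x.2.1 (Γ.τ.injective h)⟩
  let τ : Equiv.Perm T := ⟨fun x => ⟨Γ.τ x, hτT x⟩, fun x => ⟨Γ.τ x, hτT x⟩,
    fun x => Subtype.ext (Γ.τ_τ _), fun x => Subtype.ext (Γ.τ_τ _)⟩
  let s : T → T := fun x => ⟨skip a (Γ.σ x), hskip _⟩
  have hs : Function.Injective s := by
    rintro ⟨x, hx1, hx2⟩ ⟨y, hy1, hy2⟩ hxy
    have h : skip a (Γ.σ x) = skip a (Γ.σ y) := congrArg Subtype.val hxy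
    refine Subtype.ext (Γ.σ.injective ?_)
    have i1 := Γ.σ.injective.ne hx1
    have i2 := Γ.σ.injective.ne hx2
    have i3 := Γ.σ.injective.ne hy1
    have i4 := Γ.σ.injective.ne hy2
    have i5 := Γ.σ.injective.ne (Γ.τ_ne a)
    simp only [skip] at h
    split_ifs at h <;> grind
  let σ : Equiv.Perm T := Equiv.ofBijective s (Finite.injective_iff_bijective.1 hs)
  have hσ : ∀ x : T, (σ x : Γ.H) = skip a (Γ.σ x) := fun _ => rfl
  have hvs : ∀ x : Γ.H, Γ.σ x = a → Γ.vert x = Γ.vert a := fun x h => by rw [← h, vert_σ]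
  have hvs' : ∀ x : Γ.H, Γ.σ x = Γ.τ a → Γ.vert x = Γ.vert (Γ.τ a) :=
    fun x h => by rw [← h, vert_σ]
  let nx : Γ.H → T := fun x => if h : x ≠ a ∧ x ≠ Γ.τ a then ⟨x, h⟩ else
    if x = a then ⟨Γ.σ a, hσa1, hσa2⟩ else ⟨Γ.σ (Γ.τ a), hστ1, hστ2⟩
  have nxT : ∀ x : T, nx x = x := fun x => dif_pos x.2
  have nxT' : ∀ x (h : x ≠ a ∧ x ≠ Γ.τ a), nx x = ⟨x, h⟩ := fun x h => dif_pos h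
  have nxa : nx a = ⟨Γ.σ a, hσa1, hσa2⟩ := by simp [nx]
  have nxτ : nx (Γ.τ a) = ⟨Γ.σ (Γ.τ a), hστ1, hστ2⟩ := by simp [nx, Γ.τ_ne a]
  -- The contracted graph stays connected because the substitutes for `a` and `τ a` are joined: walk
  -- around the vertex of `a`, and skip over `a` at the end.
  have hedge : Relation.EqvGen (fun s t : T => t = σ s ∨ t = τ s) (nx a) (nx (Γ.τ a)) := by
    have h1 := walk hv (fun x y => Relation.EqvGen (fun s t : T => t = σ s ∨ t = τ s) (nx x) (nx y))
      (fun _ => Relation.EqvGen.refl _) (fun _ _ _ => Relation.EqvGen.trans _ _ _) (by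
      intro x h1 h2 h3 h4
      rw [nxT' x ⟨h1, h2⟩, nxT' (Γ.σ x) ⟨h3, h4⟩]
      refine Relation.EqvGen.rel _ _ (Or.inl (Subtype.ext ?_))
      rw [hσ, skip_of_ne h3 h4])
    have hm : Γ.σ.symm a ≠ a ∧ Γ.σ.symm a ≠ Γ.τ a := by
      constructor <;> intro h <;> rw [Equiv.symm_apply_eq] at h
      · exact hσa1 h.symm
      · exact hστ1 h.symm
    rw [nxa]
    rw [nxT' _ ⟨hσa1, hσa2⟩, nxT' _ hm] at h1
    refine Relation.EqvGen.trans _ _ _ h1 (Relation.EqvGen.rel _ _ (Or.inl ?_))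
    rw [nxτ]
    refine Subtype.ext ?_
    rw [hσ, Equiv.apply_symm_apply, skip_self]
  have hconn : ∀ x y, Relation.EqvGen (fun s t => t = Γ.σ s ∨ t = Γ.τ s) x y →
      Relation.EqvGen (fun s t : T => t = σ s ∨ t = τ s) (nx x) (nx y) := by
    intro x y h
    induction h with
    | rel x y h =>
      by_cases h1 : x = a
      · subst h1
        rcases h with rfl | rfl
        · rw [nxa, nxT' _ ⟨hσa1, hσa2⟩]; exact Relation.EqvGen.refl _
        · exact hedge
      by_cases h2 : x = Γ.τ a
      · subst h2
        rcases h with rfl | rfl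
        · rw [nxτ, nxT' _ ⟨hστ1, hστ2⟩]; exact Relation.EqvGen.refl _
        · rw [Γ.τ_τ]; exact Relation.EqvGen.symm _ _ hedge
      rw [nxT' x ⟨h1, h2⟩]
      rcases h with rfl | rfl
      · by_cases h3 : Γ.σ x = a
        · rw [h3]
          refine Relation.EqvGen.trans _ _ _ (Relation.EqvGen.rel _ _ (Or.inl ?_))
            (Relation.EqvGen.symm _ _ hedge)
          rw [nxτ]
          refine Subtype.ext ?_
          rw [hσ, h3, skip_self]
        by_cases h4 : Γ.σ x = Γ.τ a
        · rw [h4]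
          refine Relation.EqvGen.trans _ _ _ (Relation.EqvGen.rel _ _ (Or.inl ?_)) hedge
          rw [nxa]
          refine Subtype.ext ?_
          rw [hσ, h4, skip_τ]
        rw [nxT' _ ⟨h3, h4⟩]
        refine Relation.EqvGen.rel _ _ (Or.inl (Subtype.ext ?_))
        rw [hσ, skip_of_ne h3 h4]
      · rw [nxT' (Γ.τ x) (τ ⟨x, h1, h2⟩).2]
        exact Relation.EqvGen.rel _ _ (Or.inr rfl)
    | refl => exact Relation.EqvGen.refl _
    | symm _ _ _ ih => exact Relation.EqvGen.symm _ _ ih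
    | trans _ _ _ _ _ ih1 ih2 => exact Relation.EqvGen.trans _ _ _ ih1 ih2
  have : Nonempty T := ⟨⟨Γ.σ a, hσa1, hσa2⟩⟩
  -- The valence conditions: a cycle of length at most two for the new permutation either avoids `a`
  -- and `τ a`, hence is one for `σ`, or it forces the two ends of the edge to coincide.
  obtain ⟨Δ, e, heσ, heτ⟩ := exists_ofType (fun x : T => (x.1 : Ω))
    (fun x y h => Subtype.ext (Subtype.ext h)) τ σ
    (fun x h => Γ.τ_ne x (congrArg Subtype.val h)) (fun x => Subtype.ext (Γ.τ_τ _))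
    (by
      intro x h
      have h' : skip a (Γ.σ x) = x := congrArg Subtype.val h
      by_cases h3 : Γ.σ x = a
      · rw [h3, skip_self] at h'
        exact hv (by rw [← hvs x h3, ← h', vert_σ])
      by_cases h4 : Γ.σ x = Γ.τ a
      · rw [h4, skip_τ] at h'
        exact hv (by rw [← hvs' x h4, ← h', vert_σ])
      rw [skip_of_ne h3 h4] at h'
      exact Γ.σ_ne _ h')
    (by
      intro x h
      have h' : skip a (Γ.σ (skip a (Γ.σ x))) = x := congrArg Subtype.val h
      by_cases h3 : Γ.σ x = a
      · rw [h3, skip_self, skip_of_ne (σ_τ_ne hv _ (vert_σ _)) (Γ.σ_σ_ne _)] at h'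
        exact hv (by rw [← hvs x h3, ← h', vert_σ, vert_σ])
      by_cases h4 : Γ.σ x = Γ.τ a
      · rw [h4, skip_τ, skip_of_ne (Γ.σ_σ_ne _) (σ_ne_τ hv _ (vert_σ _))] at h'
        exact hv (by rw [← hvs' x h4, ← h', vert_σ, vert_σ])
      rw [skip_of_ne h3 h4] at h'
      by_cases h5 : Γ.σ (Γ.σ x) = a
      · rw [h5, skip_self] at h'
        exact hv (by rw [← hvs _ h5, vert_σ, ← h', vert_σ])
      by_cases h6 : Γ.σ (Γ.σ x) = Γ.τ a
      · rw [h6, skip_τ] at h'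
        exact hv (by rw [← hvs' _ h6, vert_σ, ← h', vert_σ])
      rw [skip_of_ne h5 h6] at h'
      exact Γ.σ_σ_ne _ h')
    (fun x y => by simpa only [nxT] using hconn x y (Γ.connected _ _))
  obtain ⟨f, hf⟩ := Hom.exists_ofEdge (Γ := Γ) (Δ := Δ) (a := a) (fun h => (e h : Γ.H))
    (fun x y h => e.injective (Subtype.ext h)) (fun h => congrArg Subtype.val (heτ h)) (by
      ext x
      constructor
      · rintro ⟨h, rfl⟩
        simpa using (e h).2
      · intro hx
        exact ⟨e.symm ⟨x, by simpa using hx⟩, by simp⟩) hv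
      (fun h => congrArg Subtype.val (heσ h))
  refine ⟨Δ, f, ?_⟩
  rw [Hom.Collapses, hf]
  ext x
  constructor
  · rintro ⟨h, rfl⟩
    simpa using (e h).2
  · intro hx
    exact ⟨e.symm ⟨x, by simpa using hx⟩, by simp⟩

end RibbonGraph

end FatGraph

namespace FatGraph

open RibbonGraph

namespace RibbonGraph

variable {Ω : Type u} {Γ Γ' Δ Θ : RibbonGraph Ω}

/-! ### Expansions of a ribbon graph -/

theorem First.of_notMem {S : Set Γ.H} {a b : Γ.H} (h : Γ.First S a b) (ha : a ∉ S) :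
    Γ.First S (Γ.σ (Γ.τ a)) b := by
  cases h with
  | here _ h => exact absurd h ha
  | step _ _ _ h => exact h

namespace Hom.Collapses

variable {f : Γ ⟶ Δ} {a : Γ.H}

theorem σ_ne_τ (h : Hom.Collapses f a) : Γ.σ a ≠ Γ.τ a := RibbonGraph.σ_ne_τ h.vert_ne a rfl

theorem σ_τ_ne (h : Hom.Collapses f a) : Γ.σ (Γ.τ a) ≠ a := RibbonGraph.σ_τ_ne h.vert_ne _ rfl

theorem exists_pre_σ (h : Hom.Collapses f a) : ∃ x, f.pre x = Γ.σ a :=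
  h.exists_pre (Γ.σ_ne a) h.σ_ne_τ

theorem exists_pre_σ_τ (h : Hom.Collapses f a) : ∃ y, f.pre y = Γ.σ (Γ.τ a) :=
  h.exists_pre h.σ_τ_ne (Γ.σ_ne _)

/-- The walk in `cyclic` needs at most one step, since after crossing the edge the next half-edge is
already in the range. -/
theorem pre_σ (h : Hom.Collapses f a) (z : Δ.H) : f.pre (Δ.σ z) = skip a (Γ.σ (f.pre z)) := by
  have hc := f.cyclic z
  by_cases h1 : Γ.σ (f.pre z) = a
  · rw [h1] at hc ⊢
    rw [skip_self]
    exact ((hc.of_notMem h.notMem).eq_of_mem h.exists_pre_σ_τ).symm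
  by_cases h2 : Γ.σ (f.pre z) = Γ.τ a
  · rw [h2] at hc ⊢
    rw [skip_τ]
    have hs := hc.of_notMem h.notMem_τ
    rw [Γ.τ_τ] at hs
    exact (hs.eq_of_mem h.exists_pre_σ).symm
  rw [skip_of_ne h1 h2]
  exact (hc.eq_of_mem (h.exists_pre h1 h2)).symm

theorem σ_pre_of_eq (h : Hom.Collapses f a) {y z : Δ.H} (hy : f.pre y = Γ.σ (Γ.τ a))
    (hz : Δ.σ z = y) : Γ.σ (f.pre z) = a := by
  have hs := h.pre_σ z
  rw [hz, hy] at hs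
  by_contra h1
  by_cases h2 : Γ.σ (f.pre z) = Γ.τ a
  · rw [h2, skip_τ] at hs
    exact Γ.τ_ne a (Γ.σ.injective hs)
  · rw [skip_of_ne h1 h2] at hs
    exact h.pre_ne_τ z (Γ.σ.injective hs).symm

/-- The new half-edges are inserted just before `x` and just before `y`; everywhere else the cyclic
order of the source is that of the target. -/
theorem σ_pre_of_ne (h : Hom.Collapses f a) {x y z : Δ.H} (hx : f.pre x = Γ.σ a)
    (hy : f.pre y = Γ.σ (Γ.τ a)) (h1 : Δ.σ z ≠ x) (h2 : Δ.σ z ≠ y) :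
    Γ.σ (f.pre z) = f.pre (Δ.σ z) := by
  have hs := h.pre_σ z
  by_cases h3 : Γ.σ (f.pre z) = a
  · rw [h3, skip_self, ← hy] at hs
    exact absurd (f.pre_injective hs) h2
  by_cases h4 : Γ.σ (f.pre z) = Γ.τ a
  · rw [h4, skip_τ, ← hx] at hs
    exact absurd (f.pre_injective hs) h1
  rw [hs, skip_of_ne h3 h4]

/-- The half-edges of the source. -/
def halfEquiv (h : Hom.Collapses f a) : Δ.H ⊕ Bool ≃ Γ.H :=
  Equiv.ofBijective (Sum.elim f.pre fun b => cond b a (Γ.τ a)) <| by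
    constructor
    · rintro (x | b) (y | c) hxy
      · rw [f.pre_injective hxy]
      · cases c
        · exact absurd hxy (h.pre_ne_τ x)
        · exact absurd hxy (h.pre_ne x)
      · cases b
        · exact absurd hxy.symm (h.pre_ne_τ y)
        · exact absurd hxy.symm (h.pre_ne y)
      · cases b <;> cases c
        · rfl
        · exact absurd hxy (Γ.τ_ne a)
        · exact absurd hxy (Γ.τ_ne a).symm
        · rfl
    · intro x
      by_cases h1 : x = a
      · exact ⟨Sum.inr true, h1.symm⟩
      by_cases h2 : x = Γ.τ a
      · exact ⟨Sum.inr false, h2.symm⟩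
      obtain ⟨y, rfl⟩ := h.exists_pre h1 h2
      exact ⟨Sum.inl y, rfl⟩

/-- An expansion is determined by the half-edges which follow the new edge. -/
theorem exists_iso {f' : Γ' ⟶ Δ} {a' : Γ'.H} (h : Hom.Collapses f a) (h' : Hom.Collapses f' a')
    {x y : Δ.H} (hx : f.pre x = Γ.σ a) (hy : f.pre y = Γ.σ (Γ.τ a)) (hx' : f'.pre x = Γ'.σ a')
    (hy' : f'.pre y = Γ'.σ (Γ'.τ a')) : ∃ k : Γ ≅ Γ', k.hom ≫ f' = f := by
  let e := h.halfEquiv.symm.trans h'.halfEquiv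
  have e1 : ∀ z, e (f.pre z) = f'.pre z := fun z =>
    congrArg h'.halfEquiv (h.halfEquiv.symm_apply_apply (Sum.inl z))
  have e2 : e a = a' := congrArg h'.halfEquiv (h.halfEquiv.symm_apply_apply (Sum.inr true))
  have e3 : e (Γ.τ a) = Γ'.τ a' :=
    congrArg h'.halfEquiv (h.halfEquiv.symm_apply_apply (Sum.inr false))
  have hxτ : f.pre x = Γ.σ (Γ.τ (Γ.τ a)) := by rw [Γ.τ_τ, hx]
  have hxτ' : f'.pre x = Γ'.σ (Γ'.τ (Γ'.τ a')) := by rw [Γ'.τ_τ, hx']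
  refine ⟨isoOfEquiv e (fun z => ?_) (fun z => ?_), hom_ext' fun z => ?_⟩
  · by_cases h1 : z = a
    · rw [h1, e2, ← hx, ← hx', e1]
    by_cases h2 : z = Γ.τ a
    · rw [h2, e3, ← hy, ← hy', e1]
    obtain ⟨z, rfl⟩ := h.exists_pre h1 h2
    rw [e1]
    by_cases h3 : Δ.σ z = y
    · rw [h.σ_pre_of_eq hy h3, h'.σ_pre_of_eq hy' h3, e2]
    by_cases h4 : Δ.σ z = x
    · rw [h.symm.σ_pre_of_eq hxτ h4, h'.symm.σ_pre_of_eq hxτ' h4, e3]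
    rw [h.σ_pre_of_ne hx hy h4 h3, h'.σ_pre_of_ne hx' hy' h4 h3, e1]
  · by_cases h1 : z = a
    · rw [h1, e2, e3]
    by_cases h2 : z = Γ.τ a
    · rw [h2, e3, Γ.τ_τ, Γ'.τ_τ, e2]
    obtain ⟨z, rfl⟩ := h.exists_pre h1 h2
    rw [e1, ← f.pre_τ, ← f'.pre_τ, e1]
  · rw [comp_pre, isoOfEquiv_hom_pre, Equiv.symm_apply_eq, e1]

end Hom.Collapses

/-- A vertex of valence at least four may be split. -/
theorem exists_expansion [Infinite Ω] {x : Δ.H} (hx : Δ.σ (Δ.σ (Δ.σ x)) ≠ x) :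
    ∃ (Γ : RibbonGraph Ω) (f : Γ ⟶ Δ) (a : Γ.H), Hom.Collapses f a ∧ f.pre x = Γ.σ a ∧
      f.pre (Δ.σ (Δ.σ x)) = Γ.σ (Γ.τ a) := by
  classical
  -- One new vertex carries `a`, `x`, `σ x`; the other carries `τ a` and the remaining half-edges,
  -- starting with `y`. The hypothesis says that at least two remain. The values `true` and `false`
  -- stand for `a` and `τ a`.
  let y := Δ.σ (Δ.σ x)
  have hxy : x ≠ y := (Δ.σ_σ_ne x).symm
  let τ : Equiv.Perm (Δ.H ⊕ Bool) := Equiv.sumCongr Δ.τ Equiv.boolNot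
  let s : Δ.H ⊕ Bool → Δ.H ⊕ Bool
    | Sum.inl h => if Δ.σ h = y then Sum.inr true else
        if Δ.σ h = x then Sum.inr false else Sum.inl (Δ.σ h)
    | Sum.inr true => Sum.inl x
    | Sum.inr false => Sum.inl y
  have hs : Function.Injective s := by
    have hi := Δ.σ.injective
    rintro (h | _ | _) (h' | _ | _) hh <;> simp only [s] at hh <;>
      (try split_ifs at hh) <;> grind
  let σ : Equiv.Perm (Δ.H ⊕ Bool) := Equiv.ofBijective s (Finite.injective_iff_bijective.1 hs)
  have sa : σ (Sum.inr true) = Sum.inl x := rfl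
  have sb : σ (Sum.inr false) = Sum.inl y := rfl
  have sl : ∀ h, σ (Sum.inl h) = if Δ.σ h = y then Sum.inr true else
        if Δ.σ h = x then Sum.inr false else Sum.inl (Δ.σ h) := fun _ => rfl
  -- Two labels that do not occur in `Δ` are not singled out: the whole set of half-edges is
  -- embedded into `Ω` afresh.
  obtain ⟨i⟩ : Nonempty ((Δ.H ⊕ Bool) ↪ Ω) := by
    obtain ⟨n, ⟨e⟩⟩ := Finite.exists_equiv_fin (Δ.H ⊕ Bool)
    exact ⟨e.toEmbedding.trans (Fin.valEmbedding.trans (Infinite.natEmbedding Ω))⟩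
  have hedge : Relation.EqvGen (fun s t => t = σ s ∨ t = τ s)
      (Sum.inl x : Δ.H ⊕ Bool) (Sum.inl y) :=
    Relation.EqvGen.trans _ (Sum.inr true) _
      (Relation.EqvGen.symm _ _ (Relation.EqvGen.rel _ _ (Or.inl sa.symm)))
      (Relation.EqvGen.trans _ (Sum.inr false) _ (Relation.EqvGen.rel _ _ (Or.inr rfl))
        (Relation.EqvGen.rel _ _ (Or.inl sb.symm)))
  have hconn : ∀ h h', Relation.EqvGen (fun s t => t = Δ.σ s ∨ t = Δ.τ s) h h' →
      Relation.EqvGen (fun s t => t = σ s ∨ t = τ s)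
        (Sum.inl h : Δ.H ⊕ Bool) (Sum.inl h') := by
    intro h h' hh
    induction hh with
    | rel h h' hh =>
      rcases hh with rfl | rfl
      · have h0 := sl h
        by_cases h1 : Δ.σ h = y
        · rw [if_pos h1] at h0
          rw [h1]
          exact Relation.EqvGen.trans _ (Sum.inr true) _
            (Relation.EqvGen.rel _ _ (Or.inl h0.symm)) (Relation.EqvGen.trans _ (Sum.inl x) _
              (Relation.EqvGen.rel _ _ (Or.inl rfl)) hedge)
        by_cases h2 : Δ.σ h = x
        · rw [if_neg h1, if_pos h2] at h0
          rw [h2]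
          exact Relation.EqvGen.trans _ (Sum.inr false) _
            (Relation.EqvGen.rel _ _ (Or.inl h0.symm)) (Relation.EqvGen.trans _ (Sum.inl y) _
              (Relation.EqvGen.rel _ _ (Or.inl rfl)) (Relation.EqvGen.symm _ _ hedge))
        rw [if_neg h1, if_neg h2] at h0
        exact Relation.EqvGen.rel _ _ (Or.inl h0.symm)
      · exact Relation.EqvGen.rel _ _ (Or.inr rfl)
    | refl => exact Relation.EqvGen.refl _
    | symm _ _ _ ih => exact Relation.EqvGen.symm _ _ ih
    | trans _ _ _ _ _ ih1 ih2 => exact Relation.EqvGen.trans _ _ _ ih1 ih2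
  have hall : ∀ t, Relation.EqvGen (fun s t => t = σ s ∨ t = τ s)
        (Sum.inl x : Δ.H ⊕ Bool) t := by
    rintro (h | _ | _)
    · exact hconn _ _ (Δ.connected _ _)
    · exact Relation.EqvGen.trans _ _ _ hedge
        (Relation.EqvGen.symm _ _ (Relation.EqvGen.rel _ _ (Or.inl sb.symm)))
    · exact Relation.EqvGen.symm _ _ (Relation.EqvGen.rel _ _ (Or.inl sa.symm))
  have hσ1 := Δ.σ_ne
  have hσ2 := Δ.σ_σ_ne
  have hi := Δ.σ.injective
  have hyx : Δ.σ y ≠ x := hx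
  have hσx : Δ.σ x ≠ y := fun h => Δ.σ_ne x (hi h).symm
  have sx : σ (Sum.inl x) = Sum.inl (Δ.σ x) := by
    rw [sl, if_neg hσx, if_neg (hσ1 x)]
  have sx' : σ (Sum.inl (Δ.σ x)) = Sum.inr true := by
    rw [sl, if_pos rfl]
  have : Nonempty (Δ.H ⊕ Bool) := ⟨Sum.inr true⟩
  obtain ⟨Γ, e, heσ, heτ⟩ := exists_ofType i i.injective τ σ
    (by
      rintro (h | _ | _) hh
      · exact Δ.τ_ne h (Sum.inl.inj hh)
      · exact absurd (Sum.inr.inj hh) (by decide)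
      · exact absurd (Sum.inr.inj hh) (by decide))
    (by
      rintro (h | _ | _)
      · exact congrArg Sum.inl (Δ.τ_τ h)
      · rfl
      · rfl)
    (by
      rintro (h | _ | _) hh
      · rw [sl] at hh
        have := hσ1 h
        split_ifs at hh
        grind
      · rw [sb] at hh; simp at hh
      · rw [sa] at hh; simp at hh)
    (by
      rintro (h | _ | _) hh
      · have h0 := sl h
        by_cases h1 : Δ.σ h = y
        · rw [if_pos h1] at h0
          rw [h0, sa] at hh
          exact hσx (by rw [Sum.inl.inj hh, h1])
        by_cases h2 : Δ.σ h = x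
        · rw [if_neg h1, if_pos h2] at h0
          rw [h0, sb] at hh
          exact hyx (by rw [Sum.inl.inj hh, h2])
        rw [if_neg h1, if_neg h2] at h0
        rw [h0, sl] at hh
        have := hσ2 h
        split_ifs at hh
        grind
      · rw [sb, sl, if_neg (hσ1 y), if_neg hyx] at hh; simp at hh
      · rw [sa, sx] at hh; simp at hh)
    (fun s t => Relation.EqvGen.trans _ _ _ (Relation.EqvGen.symm _ _ (hall s)) (hall t))
  have heσ' : ∀ t, e.symm (σ t) = Γ.σ (e.symm t) := fun t => by
    rw [Equiv.symm_apply_eq, heσ, Equiv.apply_symm_apply]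
  have heτ' : ∀ t, e.symm (τ t) = Γ.τ (e.symm t) := fun t => by
    rw [Equiv.symm_apply_eq, heτ, Equiv.apply_symm_apply]
  let a := e.symm (Sum.inr true)
  have hτa : Γ.τ a = e.symm (Sum.inr false) := (heτ' _).symm
  have hv : Γ.vert a ≠ Γ.vert (Γ.τ a) := by
    intro hv
    obtain ⟨n, hn⟩ := (vert_eq_iff.1 hv).exists_nat_pow_eq
    -- The cycle of `a` is `{a, x, σ x}`, which does not contain `τ a`; so the new edge is not a
    -- loop.
    have key : ∀ n : ℕ, (Γ.σ ^ n) a = a ∨ (Γ.σ ^ n) a = e.symm (Sum.inl x) ∨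
        (Γ.σ ^ n) a = e.symm (Sum.inl (Δ.σ x)) := by
      intro n
      induction n with
      | zero => exact Or.inl rfl
      | succ n ih =>
        rw [pow_succ', Equiv.Perm.mul_apply]
        rcases ih with ih | ih | ih <;> rw [ih, ← heσ']
        · exact Or.inr (Or.inl rfl)
        · rw [sx]; exact Or.inr (Or.inr rfl)
        · rw [sx']; exact Or.inl rfl
    rw [hτa] at hn
    rcases key n with h | h | h <;> rw [h] at hn <;> simpa using e.symm.injective hn
  have hr : Set.range (fun h => e.symm (Sum.inl h)) = ({a, Γ.τ a}ᶜ : Set Γ.H) := by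
    ext z
    obtain ⟨t, rfl⟩ := e.symm.surjective z
    rw [hτa]
    rcases t with h | _ | _ <;> simp [a]
  obtain ⟨f, hf⟩ := Hom.exists_ofEdge (Γ := Γ) (Δ := Δ) (a := a) (fun h => e.symm (Sum.inl h))
    (fun h h' hh => Sum.inl.inj (e.symm.injective hh)) (fun h => heτ' (Sum.inl h)) hr hv (by
      intro h
      rw [← heσ', sl]
      split_ifs with h1 h2
      · rw [skip_self, hτa, ← heσ', sb, h1]
      · rw [← hτa, skip_τ, ← heσ', sa, h2]
      · rw [skip_of_ne]
        · simp [a]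
        · rw [hτa]; simp)
  refine ⟨Γ, f, a, by rw [Hom.Collapses, hf, hr], ?_, ?_⟩
  · rw [hf]; exact heσ' (Sum.inr true)
  · rw [hf, hτa]; exact heσ' (Sum.inr false)

/-! ### Collapsing two edges in either order -/

/-- If the targets of the two edges are different vertices, the cells of `Γ` are two disjoint blocks
of three and the lifted cells of `Δ`. The order of collapse only decides which block comes first. -/
theorem orn_exchange_of_ne {Γ₁ Γ₂ : RibbonGraph Ω} {r : Γ ⟶ Γ₁} {q : Γ₁ ⟶ Δ} {r' : Γ ⟶ Γ₂}
    {q' : Γ₂ ⟶ Δ} {a : Γ.H} {b : Γ₁.H} {c : Γ₂.H} (hr : Hom.Collapses r a)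
    (hq : Hom.Collapses q b) (hr' : Hom.Collapses r' (r.pre b)) (hq' : Hom.Collapses q' c)
    (hc : r'.pre c = a) (hrq : r ≫ q = r' ≫ q')
    (hne : Γ.vert (Γ.τ a) ≠ Γ.vert (Γ.τ (r.pre b))) (o : Γ.Orientn) :
    hq'.orn (hr'.orn o) = -hq.orn (hr.orn o) := by
  let M : Fin 3 ⊕ (Fin 3 ⊕ Δ.Cell) ≃ Γ.Cell :=
    (Equiv.sumCongr (Equiv.refl _) hq.cellEquiv).trans hr.cellEquiv
  let M' : Fin 3 ⊕ (Fin 3 ⊕ Δ.Cell) ≃ Γ.Cell :=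
    (Equiv.sumCongr (Equiv.refl _) hq'.cellEquiv).trans hr'.cellEquiv
  have h1 : hq.orn (hr.orn o) = (o.map M.symm).drop.drop := by
    rw [Hom.Collapses.orn, Hom.Collapses.orn, Orn.map_neg, Orn.drop_neg, Orn.neg_neg',
      ← Orn.drop_map]
    rfl
  have h2 : hq'.orn (hr'.orn o) = (o.map M'.symm).drop.drop := by
    rw [Hom.Collapses.orn, Hom.Collapses.orn, Orn.map_neg, Orn.drop_neg, Orn.neg_neg',
      ← Orn.drop_map]
    rfl
  have hb1 : r.pre (Γ₁.τ b) = Γ.τ (r.pre b) := r.pre_τ b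
  have hc1 : r'.pre (Γ₂.τ c) = Γ.τ a := by rw [r'.pre_τ, hc]
  have hvb : Hom.vmap r (Γ.vert (Γ.τ (r.pre b))) = Γ₁.vert (Γ₁.τ b) := by
    rw [← hb1, Hom.vmap_vert_pre]
  have hvc : Hom.vmap r' (Γ.vert (Γ.τ a)) = Γ₂.vert (Γ₂.τ c) := by
    rw [← hc1, Hom.vmap_vert_pre]
  have key : ∀ z, M (Orn.exchange _ z) = M' z := by
    rintro (i | i | w | y)
    · change hr.cellEquiv (Sum.inr (hq.cellEquiv (Sum.inl i))) = hr'.cellEquiv (Sum.inl i)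
      rw [Hom.Collapses.cellEquiv_inl, Hom.Collapses.cellEquiv_inl]
      fin_cases i
      · refine congrArg Sum.inl ?_
        rw [← hvb, hr.lift_eq hne.symm]
      · rfl
      · exact congrArg Sum.inr hb1
    · change hr.cellEquiv (Sum.inl i) = hr'.cellEquiv (Sum.inr (hq'.cellEquiv (Sum.inl i)))
      rw [Hom.Collapses.cellEquiv_inl, Hom.Collapses.cellEquiv_inl]
      fin_cases i
      · refine congrArg Sum.inl ?_
        rw [← hvc, hr'.lift_eq hne]
      · exact congrArg Sum.inr hc.symm
      · exact congrArg Sum.inr hc1.symm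
    · change (Sum.inl (hr.lift (hq.lift w)) : Γ.Cell) = Sum.inl (hr'.lift (hq'.lift w))
      refine congrArg Sum.inl ?_
      set v := hr.lift (hq.lift w) with hv
      have hv1 : v ≠ Γ.vert (Γ.τ a) := hr.lift_ne _
      have hv2 : v ≠ Γ.vert (Γ.τ (r.pre b)) := by
        intro h
        have := congrArg (Hom.vmap r) h
        rw [hv, hr.vmap_lift, hvb] at this
        exact hq.lift_ne _ this
      have hv3 : Hom.vmap q' (Hom.vmap r' v) = w := by
        rw [← Hom.vmap_comp, ← hrq, Hom.vmap_comp, hv, hr.vmap_lift, hq.vmap_lift]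
      have hv4 : Hom.vmap r' v ≠ Γ₂.vert (Γ₂.τ c) := by
        rw [← hvc]
        intro h
        rcases hr'.vmap_eq_iff.1 h with h | ⟨h, h'⟩
        · exact hv1 h
        · exact hv1 ((h.resolve_right hv2).trans (h'.resolve_right hne).symm)
      rw [← hv3, hq'.lift_eq hv4, hr'.lift_eq hv2]
    · exact congrArg Sum.inr (congrArg (fun g : Γ ⟶ Δ => g.pre y) hrq)
  have h3 : M'.symm = M.symm.trans (Orn.exchange _).symm := by
    rw [← Equiv.symm_trans]
    congr 1
    ext z
    exact (key z).symm
  have h4 : ((o.map M'.symm).map (Orn.exchange _)) = o.map M.symm := by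
    rw [Orn.map_map, h3]
    congr 1
    ext z
    simp
  rw [Orn.map_exchange] at h4
  rw [h1, h2, ← h4, Orn.drop_neg, Orn.drop_neg, Orn.neg_neg']

/-- The two targets can always be made different by reversing one of the edges, which does not
affect the induced orientation. -/
theorem orn_exchange {Γ₁ Γ₂ : RibbonGraph Ω} {r : Γ ⟶ Γ₁} {q : Γ₁ ⟶ Δ} {r' : Γ ⟶ Γ₂}
    {q' : Γ₂ ⟶ Δ} {a : Γ.H} {b : Γ₁.H} {c : Γ₂.H} (hr : Hom.Collapses r a)
    (hq : Hom.Collapses q b) (hr' : Hom.Collapses r' (r.pre b)) (hq' : Hom.Collapses q' c)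
    (hc : r'.pre c = a) (hrq : r ≫ q = r' ≫ q') (o : Γ.Orientn) :
    hq'.orn (hr'.orn o) = -hq.orn (hr.orn o) := by
  by_cases hne : Γ.vert (Γ.τ a) = Γ.vert (Γ.τ (r.pre b))
  · have h := orn_exchange_of_ne hr.symm hq hr' hq'.symm (by rw [r'.pre_τ, hc]) hrq
      (by rw [Γ.τ_τ, ← hne]; exact hr.vert_ne) o
    rwa [hr.orn_τ, hq'.orn_τ] at h
  · exact orn_exchange_of_ne hr hq hr' hq' hc hrq hne o

end RibbonGraph

end FatGraph

namespace FatGraph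

open RibbonGraph

namespace RibbonGraph

variable {Ω : Type u} {Γ Γ' Δ Θ : RibbonGraph Ω}

/-! ### The natural orientation of a trivalent graph -/

/-- The orientation of `Fin m × Fin 4` given by the lexicographic order. -/
def blockOrn (m : ℕ) : Orn (Fin m × Fin 4) :=
  (Orn.exists_sgn_eq_one (finProdFinEquiv (m := m) (n := 4)).symm).choose

theorem blockOrn_sgn (m : ℕ) : (blockOrn m).sgn finProdFinEquiv.symm = 1 :=
  (Orn.exists_sgn_eq_one (finProdFinEquiv (m := m) (n := 4)).symm).choose_spec

/-- The cyclic permutation of the last three elements of `Fin 4`. -/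
def turn : Equiv.Perm (Fin 4) := Equiv.swap 1 2 * Equiv.swap 2 3

/-- The vertex of a half-edge `x`, followed by `x`, `σ x`, `σ (σ x)`. -/
def block (x : Γ.H) : Fin 4 → Γ.Cell :=
  ![Sum.inl (Γ.vert x), Sum.inr x, Sum.inr (Γ.σ x), Sum.inr (Γ.σ (Γ.σ x))]

theorem block_σ (h : Γ.codim = 0) (x : Γ.H) (j : Fin 4) : block (Γ.σ x) j = block x (turn j) := by
  have h3 := σ_pow_three h x
  fin_cases j
  · exact congrArg Sum.inl (vert_σ x)
  · rfl
  · rfl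
  · exact congrArg Sum.inr h3

theorem block_σ_pow (h : Γ.codim = 0) (x : Γ.H) (n : ℕ) (j : Fin 4) :
    block ((Γ.σ ^ n) x) j = block x ((turn ^ n) j) := by
  induction n generalizing j with
  | zero => rfl
  | succ n ih =>
    rw [pow_succ', Equiv.Perm.mul_apply, block_σ h, ih, pow_succ, Equiv.Perm.mul_apply]

theorem block_bijective (h : Γ.codim = 0) {I : Type*} (r : I → Γ.H)
    (hr : Function.Bijective fun i => Γ.vert (r i)) :
    Function.Bijective fun p : I × Fin 4 => block (r p.1) p.2 := by
  have h1 := Γ.σ_ne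
  have h2 := Γ.σ_σ_ne
  have h1' := fun x => (Γ.σ_ne x).symm
  have h2' := fun x => (Γ.σ_σ_ne x).symm
  have hi := Γ.σ.injective
  constructor
  · rintro ⟨i, j⟩ ⟨i', j'⟩ hij
    have hI : i = i' := by
      refine hr.1 ?_
      have key : ∀ (x : Γ.H) (j : Fin 4), Sum.elim id Γ.vert (block x j) = Γ.vert x := by
        intro x j
        fin_cases j <;> simp [block]
      have := congrArg (Sum.elim id Γ.vert) hij
      rwa [key, key] at this
    subst hI
    congr 1
    fin_cases j <;> fin_cases j' <;> simp_all [block]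
  · rintro (v | x)
    · obtain ⟨i, rfl⟩ := hr.2 v
      exact ⟨(i, 0), rfl⟩
    · obtain ⟨i, hi⟩ := hr.2 (Γ.vert x)
      obtain ⟨n, rfl⟩ := (vert_eq_iff.1 hi).exists_nat_pow_eq
      exact ⟨(i, (turn ^ n) 1), (block_σ_pow h _ n 1).symm⟩

/-- The cells of a trivalent graph. -/
def blockEquiv (h : Γ.codim = 0) {I : Type*} (r : I → Γ.H)
    (hr : Function.Bijective fun i => Γ.vert (r i)) : I × Fin 4 ≃ Γ.Cell :=
  Equiv.ofBijective _ (block_bijective h r hr)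

/-- Independence of choices: reordering the vertices permutes blocks of four, which contributes a
fourth power of a sign, and changing the first half-edge of a block is a cyclic rotation of three.
-/
theorem map_blockEquiv (h : Γ.codim = 0) {m m' : ℕ} (r : Fin m → Γ.H) (r' : Fin m' → Γ.H)
    (hr : Function.Bijective fun i => Γ.vert (r i))
    (hr' : Function.Bijective fun i => Γ.vert (r' i)) :
    (blockOrn m').map (blockEquiv h r' hr') = (blockOrn m).map (blockEquiv h r hr) := by
  obtain rfl : m' = m := Fin.equiv_iff_eq.1
    ⟨(Equiv.ofBijective _ hr').trans (Equiv.ofBijective _ hr).symm⟩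
  let π : Equiv.Perm (Fin m') := (Equiv.ofBijective _ hr').trans (Equiv.ofBijective _ hr).symm
  have hπ : ∀ i, Γ.vert (r (π i)) = Γ.vert (r' i) := fun i =>
    (Equiv.ofBijective _ hr).apply_symm_apply (Γ.vert (r' i))
  choose n hn using fun i => (vert_eq_iff.1 (hπ i)).exists_nat_pow_eq
  let P : Equiv.Perm (Fin m' × Fin 4) :=
    (Equiv.prodCongrRight fun i => turn ^ n i).trans (Equiv.prodCongrLeft fun _ => π)
  have hP : blockEquiv h r' hr' = Equiv.trans P (blockEquiv h r hr) := by
    ext ⟨i, j⟩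
    change block (r' i) j = block (r (π i)) ((turn ^ n i) j)
    rw [← hn i, block_σ_pow h]
  have hturn : Equiv.Perm.sign turn = 1 := by decide
  have hs : Equiv.Perm.sign P = 1 := by
    change Equiv.Perm.sign ((Equiv.prodCongrLeft fun _ => π) *
      (Equiv.prodCongrRight fun i => turn ^ n i)) = 1
    rw [Equiv.Perm.sign_mul, Equiv.Perm.sign_prodCongrLeft, Equiv.Perm.sign_prodCongrRight]
    simp only [map_pow, hturn, one_pow, Finset.prod_const_one, mul_one,
      Finset.prod_const, Finset.card_univ, Fintype.card_fin]
    rcases Int.units_eq_one_or (Equiv.Perm.sign π) with h | h <;> rw [h] <;> decide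
  rw [hP, ← Orn.map_map, (Orn.map_perm _ P).1 hs]

theorem exists_vert_bijective (Γ : RibbonGraph Ω) :
    ∃ (m : ℕ) (r : Fin m → Γ.H), Function.Bijective fun i => Γ.vert (r i) := by
  obtain ⟨m, ⟨e⟩⟩ := Finite.exists_equiv_fin Γ.V
  refine ⟨m, fun i => Function.surjInv Γ.vert_surjective (e.symm i), ?_⟩
  have : (fun i => Γ.vert (Function.surjInv Γ.vert_surjective (e.symm i))) = e.symm :=
    funext fun i => Function.surjInv_eq Γ.vert_surjective _
  rw [this]
  exact e.symm.bijective

/-- The natural orientation of a trivalent graph. -/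
def natOrn (h : Γ.codim = 0) : Γ.Orientn :=
  (blockOrn _).map (blockEquiv h _ Γ.exists_vert_bijective.choose_spec.choose_spec)

/-- The vertices may be indexed by any finite set. For an expansion this will be `Option Δ.V`, with
`none` for the additional vertex. -/
theorem map_blockEquiv_eq_natOrn (h : Γ.codim = 0) {m : ℕ} {I : Type*} (g : Fin m ≃ I)
    (r : I → Γ.H) (hr : Function.Bijective fun i => Γ.vert (r i)) :
    ((blockOrn m).map (Equiv.prodCongr g (Equiv.refl _))).map (blockEquiv h r hr) = natOrn h := by
  have hg : (Equiv.prodCongr g (Equiv.refl _)).trans (blockEquiv h r hr) =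
      blockEquiv h (r ∘ g) (hr.comp g.bijective) := Equiv.ext fun _ => rfl
  rw [natOrn, Orn.map_map, hg]
  exact map_blockEquiv h _ (r ∘ g) _ (hr.comp g.bijective)

/-- Exactly one orientation of a trivalent graph is natural, so the failure of `IsNatural` means
that the orientation is the opposite one. -/
theorem isNatural_iff (h : Γ.codim = 0) {o : Γ.Orientn} : IsNatural o ↔ o = natOrn h := by
  constructor
  · rintro ⟨m, e, h1, h2⟩
    choose r hr using h1
    have he : ∀ i j, e (i, j) = block (r i) j := by
      intro i j
      obtain ⟨h0, h1, h2, h3⟩ := hr i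
      fin_cases j
      exacts [h0, h1, h2, h3]
    have hb : Function.Bijective fun i => Γ.vert (r i) := by
      constructor
      · intro i i' hi
        have : e (i, 0) = e (i', 0) := by
          rw [he, he]
          exact congrArg Sum.inl hi
        exact (Prod.ext_iff.1 (e.injective this)).1
      · intro v
        obtain ⟨⟨i, j⟩, hi⟩ := e.surjective (Sum.inl v)
        rw [he] at hi
        refine ⟨i, ?_⟩
        fin_cases j <;> simp [block] at hi
        exact hi
    have : e = blockEquiv h r hb := Equiv.ext fun ⟨i, j⟩ => he i j
    rw [natOrn, map_blockEquiv h r _ hb, ← this]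
    refine Orn.eq_of_sgn (finProdFinEquiv.symm.trans e) ?_
    rw [h2, Orn.map_sgn, Equiv.trans_assoc, Equiv.self_trans_symm, Equiv.trans_refl, blockOrn_sgn]
  · rintro rfl
    obtain ⟨m, r, hr⟩ := Γ.exists_vert_bijective
    refine ⟨m, blockEquiv h r hr, fun i => ⟨r i, rfl, rfl, rfl, rfl⟩, ?_⟩
    rw [natOrn, map_blockEquiv h r _ hr, Orn.map_sgn, Equiv.trans_assoc, Equiv.self_trans_symm,
      Equiv.trans_refl, blockOrn_sgn]

/-! ### The two expansions of a vertex of valence four -/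

namespace Hom.Collapses

variable {f : Γ ⟶ Δ} {a : Γ.H}

theorem pre_σ_of_vert_ne (h : Hom.Collapses f a) {z : Δ.H} (h1 : Γ.vert (f.pre z) ≠ Γ.vert a)
    (h2 : Γ.vert (f.pre z) ≠ Γ.vert (Γ.τ a)) : f.pre (Δ.σ z) = Γ.σ (f.pre z) := by
  rw [h.pre_σ, skip_of_ne]
  · exact fun hz => h1 (by rw [← hz, vert_σ])
  · exact fun hz => h2 (by rw [← hz, vert_σ])

/-- Around the merged vertex one reads `σ a`, `σ² a`, `σ (τ a)`, `σ² (τ a)`. So the two half-edges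
that follow the ends of the new edge are opposite to each other. -/
theorem pre_σ_of_trivalent (h : Hom.Collapses f a) (h0 : Γ.codim = 0) {x : Δ.H}
    (hx : f.pre x = Γ.σ a) : f.pre (Δ.σ x) = Γ.σ (Γ.σ a) ∧
      f.pre (Δ.σ (Δ.σ x)) = Γ.σ (Γ.τ a) := by
  have h1 : f.pre (Δ.σ x) = Γ.σ (Γ.σ a) := by
    rw [h.pre_σ, hx, skip_of_ne (Γ.σ_σ_ne a)]
    exact RibbonGraph.σ_ne_τ h.vert_ne _ (vert_σ a)
  refine ⟨h1, ?_⟩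
  rw [h.pre_σ, h1, σ_pow_three h0, skip_self]

theorem σ_pow_four (h : Hom.Collapses f a) (h0 : Γ.codim = 0) {x : Δ.H}
    (hx : f.pre x = Γ.σ a) : Δ.σ (Δ.σ (Δ.σ (Δ.σ x))) = x := by
  have h1 := (h.pre_σ_of_trivalent h0 hx).2
  have h2 := (h.symm.pre_σ_of_trivalent h0 h1).2
  rw [Γ.τ_τ, ← hx] at h2
  exact f.pre_injective h2

theorem vert_pre_ne (h : Hom.Collapses f a) {x z : Δ.H} (hx : f.pre x = Γ.σ a)
    (hz : Δ.vert z ≠ Δ.vert x) :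
    Γ.vert (f.pre z) ≠ Γ.vert a ∧ Γ.vert (f.pre z) ≠ Γ.vert (Γ.τ a) := by
  have h1 : Hom.vmap f (Γ.vert a) = Δ.vert x := by
    rw [← vert_σ a, ← hx, Hom.vmap_vert_pre]
  constructor
  · intro h2
    exact hz (by rw [← Hom.vmap_vert_pre f z, h2, h1])
  · intro h2
    exact hz (by rw [← Hom.vmap_vert_pre f z, h2, h.vmap_vert_τ, h1])

open Classical in
/-- Representatives of the vertices of an expansion. -/
def rep (_ : Hom.Collapses f a) (ρ : Δ.V → Δ.H) (x : Δ.H) : Option Δ.V → Γ.H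
  | none => Γ.τ a
  | some w => if w = Δ.vert x then a else f.pre (ρ w)

theorem vert_rep_some (h : Hom.Collapses f a) {ρ : Δ.V → Δ.H} (hρ : ∀ w, Δ.vert (ρ w) = w)
    {x : Δ.H} (hx : f.pre x = Γ.σ a) (w : Δ.V) : Γ.vert (h.rep ρ x (some w)) = h.lift w := by
  by_cases hw : w = Δ.vert x
  · rw [rep, if_pos hw]
    have h1 : w = Hom.vmap f (Γ.vert a) := by
      rw [hw, ← vert_σ a, ← hx, Hom.vmap_vert_pre]
    rw [h1, h.lift_eq h.vert_ne]
  · rw [rep, if_neg hw]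
    have h1 := (h.vert_pre_ne hx (z := ρ w) (by rwa [hρ])).2
    rw [← h.lift_eq h1, Hom.vmap_vert_pre, hρ]

theorem vert_rep_bijective (h : Hom.Collapses f a) {ρ : Δ.V → Δ.H} (hρ : ∀ w, Δ.vert (ρ w) = w)
    {x : Δ.H} (hx : f.pre x = Γ.σ a) : Function.Bijective fun i => Γ.vert (h.rep ρ x i) := by
  have hs := h.vert_rep_some hρ hx
  constructor
  · rintro (_ | w) (_ | w') hw
    · rfl
    · exact absurd ((hs w').symm.trans hw.symm) (h.lift_ne w')
    · exact absurd ((hs w).symm.trans hw) (h.lift_ne w)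
    · have := congrArg (Hom.vmap f) ((hs w).symm.trans (hw.trans (hs w')))
      rw [h.vmap_lift, h.vmap_lift] at this
      rw [this]
  · intro v
    by_cases hv : v = Γ.vert (Γ.τ a)
    · exact ⟨none, hv.symm⟩
    · exact ⟨some (Hom.vmap f v), (hs _).trans (h.lift_eq hv)⟩

open Classical in
/-- The cells of an expansion of a vertex of valence four. -/
def stdFun (ρ : Δ.V → Δ.H) (x : Δ.H) : Option Δ.V × Fin 4 → Fin 3 ⊕ Δ.Cell
  | (none, j) => ![Sum.inl 0, Sum.inl 2, Sum.inr (Sum.inr (Δ.σ (Δ.σ x))),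
      Sum.inr (Sum.inr (Δ.σ (Δ.σ (Δ.σ x))))] j
  | (some w, j) => if w = Δ.vert x then
      ![Sum.inr (Sum.inl w), Sum.inl 1, Sum.inr (Sum.inr x), Sum.inr (Sum.inr (Δ.σ x))] j else
      ![Sum.inr (Sum.inl w), Sum.inr (Sum.inr (ρ w)), Sum.inr (Sum.inr (Δ.σ (ρ w))),
        Sum.inr (Sum.inr (Δ.σ (Δ.σ (ρ w))))] j

/-- The table `stdFun` of the natural order involves `ρ` and `x` alone and not the expansion. It
therefore makes the two expansions of the vertex comparable. -/
theorem cellEquiv_stdFun (h : Hom.Collapses f a) (h0 : Γ.codim = 0) {ρ : Δ.V → Δ.H}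
    (hρ : ∀ w, Δ.vert (ρ w) = w) {x : Δ.H} (hx : f.pre x = Γ.σ a) (i : Option Δ.V) (j : Fin 4) :
    h.cellEquiv (stdFun ρ x (i, j)) = block (h.rep ρ x i) j := by
  obtain ⟨h1, h2⟩ := h.pre_σ_of_trivalent h0 hx
  have h3 := (h.symm.pre_σ_of_trivalent h0 h2).1
  rcases i with _ | w
  · fin_cases j
    · rfl
    · rfl
    · exact congrArg Sum.inr h2
    · exact congrArg Sum.inr h3
  · have hv : h.cellEquiv (Sum.inr (Sum.inl w)) = Sum.inl (Γ.vert (h.rep ρ x (some w))) := by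
      rw [h.vert_rep_some hρ hx, cellEquiv_vert]
    by_cases hw : w = Δ.vert x
    · have hr : h.rep ρ x (some w) = a := if_pos hw
      simp only [stdFun, if_pos hw]
      rw [hr] at hv ⊢
      fin_cases j
      · exact hv
      · rfl
      · exact congrArg Sum.inr hx
      · exact congrArg Sum.inr h1
    · have hr : h.rep ρ x (some w) = f.pre (ρ w) := if_neg hw
      simp only [stdFun, if_neg hw]
      rw [hr] at hv ⊢
      have hn := h.vert_pre_ne hx (z := ρ w) (by rwa [hρ])
      have hn' := h.vert_pre_ne hx (z := Δ.σ (ρ w)) (by rwa [vert_σ, hρ])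
      have e1 := h.pre_σ_of_vert_ne hn.1 hn.2
      have e2 := h.pre_σ_of_vert_ne hn'.1 hn'.2
      rw [e1] at e2
      fin_cases j
      · exact hv
      · rfl
      · exact congrArg Sum.inr e1
      · exact congrArg Sum.inr e2

/-- The natural orientations of the two expansions of a vertex of valence four induce opposite
orientations. -/
theorem orn_natOrn_neg {f' : Γ' ⟶ Δ} {a' : Γ'.H} (h : Hom.Collapses f a)
    (h' : Hom.Collapses f' a') (h0 : Γ.codim = 0) (h0' : Γ'.codim = 0) {x : Δ.H}
    (hx : f.pre x = Γ.σ a) (hx' : f'.pre (Δ.σ x) = Γ'.σ a') :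
    h'.orn (natOrn h0') = -h.orn (natOrn h0) := by
  classical
  obtain ⟨_⟩ := nonempty_fintype Δ.V
  obtain ⟨m, ⟨g⟩⟩ := Finite.exists_equiv_fin (Option Δ.V)
  let ρ : Δ.V → Δ.H := Function.surjInv Δ.vert_surjective
  have hρ : ∀ w, Δ.vert (ρ w) = w := Function.surjInv_eq _
  have h4 := h.σ_pow_four h0 hx
  have n1 : x ≠ Δ.σ x := (Δ.σ_ne x).symm
  have n2 : x ≠ Δ.σ (Δ.σ x) := (Δ.σ_σ_ne x).symm
  have n3 : x ≠ Δ.σ (Δ.σ (Δ.σ x)) := by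
    intro h3
    have h5 := congrArg Δ.σ h3
    rw [h4] at h5
    exact Δ.σ_ne x h5
  obtain ⟨p1, p2, p3, p4, p5⟩ := swap_mul_swap_mul_swap (α := Δ.Cell) (p := Sum.inr x)
    (q := Sum.inr (Δ.σ x)) (r := Sum.inr (Δ.σ (Δ.σ x))) (s := Sum.inr (Δ.σ (Δ.σ (Δ.σ x))))
    (by simpa using n1) (by simpa using n2) (by simpa using n3) (by simpa using n1)
    (by simpa using n2) (by simpa using n1)
  -- Passing to the other expansion replaces `x` by `σ x` in `stdFun`, that is, it rotates the four
  -- half-edges at the vertex; a four-cycle is odd.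
  set π : Equiv.Perm Δ.Cell := Equiv.swap (Sum.inr x) (Sum.inr (Δ.σ x)) *
    Equiv.swap (Sum.inr (Δ.σ x)) (Sum.inr (Δ.σ (Δ.σ x))) *
    Equiv.swap (Sum.inr (Δ.σ (Δ.σ x))) (Sum.inr (Δ.σ (Δ.σ (Δ.σ x)))) with hπ
  have hs : Equiv.Perm.sign π = -1 := by
    rw [hπ, Equiv.Perm.sign_mul, Equiv.Perm.sign_mul, Equiv.Perm.sign_swap (by simpa using n1),
      Equiv.Perm.sign_swap (by simpa using n1), Equiv.Perm.sign_swap (by simpa using n1)]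
    decide
  have pv : ∀ w, π (Sum.inl w) = Sum.inl w := fun w =>
    p5 _ (by simp) (by simp) (by simp) (by simp)
  have ph : ∀ z : Δ.H, Δ.vert z ≠ Δ.vert x → π (Sum.inr z) = Sum.inr z := by
    intro z hz
    refine p5 _ ?_ ?_ ?_ ?_ <;> rw [Ne, Sum.inr.injEq] <;> rintro rfl <;> simp at hz
  have key : ∀ z, stdFun ρ (Δ.σ x) z =
      Equiv.sumCongr (Equiv.refl (Fin 3)) π (stdFun ρ x z) := by
    rintro ⟨_ | w, j⟩
    · fin_cases j
      · rfl
      · rfl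
      · exact congrArg Sum.inr p3.symm
      · exact congrArg Sum.inr ((congrArg Sum.inr h4).trans p4.symm)
    · by_cases hw : w = Δ.vert x
      · have hw' : w = Δ.vert (Δ.σ x) := by rw [hw, vert_σ]
        simp only [stdFun, if_pos hw, if_pos hw']
        fin_cases j
        · exact congrArg Sum.inr (pv w).symm
        · rfl
        · exact congrArg Sum.inr p1.symm
        · exact congrArg Sum.inr p2.symm
      · have hw' : w ≠ Δ.vert (Δ.σ x) := by rwa [vert_σ]
        simp only [stdFun, if_neg hw, if_neg hw']
        fin_cases j
        · exact congrArg Sum.inr (pv w).symm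
        · exact congrArg Sum.inr (ph _ (by rwa [hρ])).symm
        · exact congrArg Sum.inr (ph _ (by rwa [vert_σ, hρ])).symm
        · exact congrArg Sum.inr (ph _ (by rwa [vert_σ, vert_σ, hρ])).symm
  let N := (blockEquiv h0 _ (h.vert_rep_bijective hρ hx)).trans h.cellEquiv.symm
  let N' := (blockEquiv h0' _ (h'.vert_rep_bijective hρ hx')).trans h'.cellEquiv.symm
  have hN : ∀ z, N z = stdFun ρ x z := fun ⟨i, j⟩ =>
    (Equiv.symm_apply_eq _).2 (h.cellEquiv_stdFun h0 hρ hx i j).symm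
  have hN' : ∀ z, N' z = stdFun ρ (Δ.σ x) z := fun ⟨i, j⟩ =>
    (Equiv.symm_apply_eq _).2 (h'.cellEquiv_stdFun h0' hρ hx' i j).symm
  have hNN : N' = N.trans (Equiv.sumCongr (Equiv.refl (Fin 3)) π) := by
    refine Equiv.ext fun z => (hN' z).trans ?_
    rw [Equiv.trans_apply, hN, key]
  have e1 : (natOrn h0).map h.cellEquiv.symm =
      ((blockOrn m).map (Equiv.prodCongr g.symm (Equiv.refl _))).map N := by
    rw [← map_blockEquiv_eq_natOrn h0 g.symm _ (h.vert_rep_bijective hρ hx), Orn.map_map]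
  have e2 : (natOrn h0').map h'.cellEquiv.symm =
      ((blockOrn m).map (Equiv.prodCongr g.symm (Equiv.refl _))).map N' := by
    rw [← map_blockEquiv_eq_natOrn h0' g.symm _ (h'.vert_rep_bijective hρ hx'), Orn.map_map]
  rw [orn, orn, e1, e2, hNN, ← Orn.map_map, Orn.drop_map, (Orn.map_perm _ π).2 hs]

end Hom.Collapses

end RibbonGraph

end FatGraph

namespace FatGraph

open RibbonGraph

variable {Ω : Type u}

/-! ### Classes of expansions and collapses -/

theorem RibbonGraph.preservesOr_iff {Γ Δ : RibbonGraph Ω} {k : Γ ≅ Δ} {o : Γ.Orientn}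
    {o' : Δ.Orientn} : PreservesOr k o o' ↔ o' = o.map (isoCell k) := by
  constructor
  · intro h
    obtain ⟨m, ⟨e⟩⟩ := Finite.exists_equiv_fin Γ.Cell
    refine Orn.eq_of_sgn (e.symm.trans (isoCell k)) ?_
    rw [h, Orn.map_sgn, Equiv.trans_assoc, Equiv.self_trans_symm, Equiv.trans_refl]
  · rintro rfl m e
    rw [Orn.map_sgn, Equiv.trans_assoc, Equiv.self_trans_symm, Equiv.trans_refl]

theorem RibbonGraph.preservesOr_or_neg {Γ Δ : RibbonGraph Ω} (k : Γ ≅ Δ) (o : Γ.Orientn)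
    (o' : Δ.Orientn) : PreservesOr k o o' ∨ PreservesOr k o (-o') := by
  simp only [preservesOr_iff]
  rcases Orn.eq_or_neg o' (o.map (isoCell k)) with h | h
  · exact Or.inl h.symm
  · exact Or.inr h.symm

theorem RibbonGraph.not_preservesOr_neg {Γ Δ : RibbonGraph Ω} {k : Γ ≅ Δ} {o : Γ.Orientn}
    {o' : Δ.Orientn} (h : PreservesOr k o o') : ¬PreservesOr k o (-o') := by
  rw [preservesOr_iff] at h ⊢
  rw [← h]
  exact fun h => Orn.ne_neg _ h.symm

namespace OddFree

variable {X : Type u} {r : X → X → Prop} {neg : X → X}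

theorem hom_ext {M : Type*} [AddCommGroup M] {f g : OddFree X r neg →ₗ[ℤ] M}
    (h : ∀ x, f (mk x) = g (mk x)) : f = g :=
  Submodule.linearMap_qext _ (Finsupp.lhom_ext' fun z => LinearMap.ext_ring (h z))

end OddFree

namespace OGraph

theorem codim_succ {n : ℕ} (x : OGraph Ω n) (y : OGraph Ω (n + 1)) :
    y.graph.codim = x.graph.codim + 1 := by
  rw [x.codim_eq, y.codim_eq]

namespace Expansion

variable {n : ℕ} {y : OGraph Ω (n + 1)}

/-- The orientation of the source is determined by that of `y`, so every isomorphism over `y`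
preserves orientations. -/
theorem rel_of_iso {c c' : y.Expansion} (k : c.source.graph ≅ c'.source.graph)
    (hk : k.hom ≫ c'.map = c.map) : c.Rel c' := by
  refine ⟨k, ?_, hk⟩
  have h1 : PreservesOr k (c'.source.or.map (isoCell k.symm)) c'.source.or :=
    (preservesOr_iff (k := k.symm).2 rfl).symm
  have h2 := Induces.iso_comp h1 c'.induces
  rw [hk] at h2
  rwa [Induces.source_unique (codim_succ c.source y) c.induces h2]

theorem Rel.refl (c : y.Expansion) : c.Rel c := rel_of_iso (Iso.refl _) (Category.id_comp _)

theorem Rel.symm {c c' : y.Expansion} : c.Rel c' → c'.Rel c := by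
  rintro ⟨k, _, hk⟩
  exact rel_of_iso k.symm (by simp [← hk])

theorem Rel.trans {c c' c'' : y.Expansion} : c.Rel c' → c'.Rel c'' → c.Rel c'' := by
  rintro ⟨k, _, hk⟩ ⟨l, _, hl⟩
  exact rel_of_iso (k ≪≫ l) (by simp [← hk, ← hl])

/-- The classes of expansions. -/
def Cls (y : OGraph Ω (n + 1)) : Type u := Quot (Rel (x := y))

/-- The class of an expansion. -/
def cls (c : y.Expansion) : Cls y := Quot.mk _ c

/-- A representative. -/
def rep (q : Cls y) : y.Expansion := Quot.out q

theorem cls_rep (q : Cls y) : cls (rep q) = q := Quot.out_eq q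

theorem cls_eq_iff {c c' : y.Expansion} : cls c = cls c' ↔ c.Rel c' := by
  constructor
  · intro h
    exact (Equivalence.eqvGen_iff ⟨Rel.refl, Rel.symm, Rel.trans⟩).1 (Quot.eqvGen_exact h)
  · exact Quot.sound

theorem rep_cls (c : y.Expansion) : (rep (cls c)).Rel c := cls_eq_iff.1 (cls_rep _)

theorem eq_of_rel {q q' : Cls y} (h : (rep q).Rel (rep q')) : q = q' := by
  rw [← cls_rep q, ← cls_rep q', cls_eq_iff]
  exact h

theorem exists_collapses (c : y.Expansion) : ∃ a, Hom.Collapses c.map a :=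
  Hom.exists_collapses c.map (codim_succ c.source y)

/-- The class is determined by the two half-edges of `y` which follow the ends of the new edge. -/
instance : Finite (Cls y) := by
  choose a ha using fun q : Cls y => (rep q).exists_collapses
  choose x hx using fun q => (ha q).exists_pre_σ
  choose z hz using fun q => (ha q).exists_pre_σ_τ
  refine Finite.of_injective (fun q => (x q, z q)) fun q q' h => ?_
  obtain ⟨h1, h2⟩ := Prod.ext_iff.1 h
  simp only at h1 h2
  have hx' := hx q'
  have hz' := hz q'
  rw [← h1] at hx'
  rw [← h2] at hz'
  obtain ⟨k, hk⟩ := (ha q).exists_iso (ha q') (hx q) (hz q) hx' hz'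
  exact eq_of_rel (rel_of_iso k hk)

instance : Fintype (Cls y) := Fintype.ofFinite _

theorem exists_of_hom {x : RibbonGraph Ω} (hx : x.codim = n) (f : x ⟶ y.graph) :
    ∃ o : x.Orientn, Induces f o y.or :=
  Induces.exists_source f (by rw [hx, y.codim_eq]) y.or

/-- Positive codimension gives a vertex of valence at least four, which can be split. -/
theorem nonempty [Infinite Ω] (y : OGraph Ω (n + 1)) : Nonempty y.Expansion := by
  obtain ⟨x, hx⟩ := exists_σ_pow_three_ne (Γ := y.graph) (by rw [y.codim_eq]; omega)
  obtain ⟨Γ, f, a, ha, _⟩ := exists_expansion hx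
  have hc : Γ.codim = n := by
    have := ha.codim
    rw [y.codim_eq] at this
    omega
  obtain ⟨o, ho⟩ := exists_of_hom hc f
  exact ⟨⟨⟨Γ, hc, o⟩, f, ho⟩⟩

end Expansion

namespace Collapse

variable {n : ℕ} {x : OGraph Ω n}

theorem rel_of_iso {c c' : x.Collapse} (k : c.target.graph ≅ c'.target.graph)
    (hk : c.map ≫ k.hom = c'.map) : c.Rel c' := by
  refine ⟨k, ?_, hk⟩
  have h2 := c.induces.comp_iso (l := k) (preservesOr_iff.2 rfl)
  rw [hk] at h2
  exact preservesOr_iff.2 (Induces.unique (codim_succ x c'.target) c'.induces h2)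

theorem Rel.refl (c : x.Collapse) : c.Rel c := rel_of_iso (Iso.refl _) (Category.comp_id _)

theorem Rel.symm {c c' : x.Collapse} : c.Rel c' → c'.Rel c := by
  rintro ⟨k, _, hk⟩
  exact rel_of_iso k.symm (by simp [← hk])

theorem Rel.trans {c c' c'' : x.Collapse} : c.Rel c' → c'.Rel c'' → c.Rel c'' := by
  rintro ⟨k, _, hk⟩ ⟨l, _, hl⟩
  exact rel_of_iso (k ≪≫ l) (by simp [← hk, ← hl])

/-- The classes of collapses. -/
def Cls (x : OGraph Ω n) : Type u := Quot (Rel (x := x))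

/-- The class of a collapse. -/
def cls (c : x.Collapse) : Cls x := Quot.mk _ c

/-- A representative. -/
def rep (q : Cls x) : x.Collapse := Quot.out q

theorem cls_rep (q : Cls x) : cls (rep q) = q := Quot.out_eq q

theorem cls_eq_iff {c c' : x.Collapse} : cls c = cls c' ↔ c.Rel c' := by
  constructor
  · intro h
    exact (Equivalence.eqvGen_iff ⟨Rel.refl, Rel.symm, Rel.trans⟩).1 (Quot.eqvGen_exact h)
  · exact Quot.sound

theorem rep_cls (c : x.Collapse) : (rep (cls c)).Rel c := cls_eq_iff.1 (cls_rep _)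

theorem eq_of_rel {q q' : Cls x} (h : (rep q).Rel (rep q')) : q = q' := by
  rw [← cls_rep q, ← cls_rep q', cls_eq_iff]
  exact h

/-- A collapse is determined, up to isomorphism under `x`, by the set of surviving half-edges. -/
instance : Finite (Cls x) := by
  refine Finite.of_injective (fun q : Cls x => Set.range (rep q).map.pre) fun q q' h => ?_
  obtain ⟨k, hk⟩ := Hom.exists_iso_of_range_eq (rep q).map (rep q').map h.symm
  exact eq_of_rel (rel_of_iso k hk)

instance : Fintype (Cls x) := Fintype.ofFinite _

end Collapse

end OGraph

open OGraph

theorem collapseSum_eq {n : ℕ} (x : OGraph Ω n) :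
    collapseSum x = ∑ q : Collapse.Cls x, OddFree.mk (Collapse.rep q).target := by
  rw [collapseSum]
  refine (finsum_eq_sum_of_fintype (α := Collapse.Cls x) _).trans
    (Finset.sum_congr rfl fun q _ => ?_)
  conv_lhs => rw [← Collapse.cls_rep q]
  rfl

namespace Forest

variable {Γ₀ Γ₁ : RibbonGraph Ω}

/-- The composite of a representative of a class of expansions with a morphism. -/
def expand {k : ℕ} (x : OOver Γ₀ (k + 1)) (q : Expansion.Cls x.top) : OOver Γ₀ k :=
  ⟨(Expansion.rep q).source, (Expansion.rep q).map ≫ x.map⟩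

theorem bdry_mk {k : ℕ} (x : OOver Γ₀ (k + 1)) :
    bdry Γ₀ k (OddFree.mk x) = ∑ q : Expansion.Cls x.top, OddFree.mk (expand x q) := by
  rw [bdry, OddFree.lift_mk, expandSum]
  refine (finsum_eq_sum_of_fintype (α := Expansion.Cls x.top) _).trans
    (Finset.sum_congr rfl fun q _ => ?_)
  conv_lhs => rw [← Expansion.cls_rep q]
  rfl

theorem push_mk (g : Γ₀ ⟶ Γ₁) {k : ℕ} (x : OOver Γ₀ k) :
    push g k (OddFree.mk x) = OddFree.mk (x.push g) := OddFree.lift_mk _ _ _ _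

theorem proj_mk {k : ℕ} (x : OOver Γ₀ k) : proj Γ₀ k (OddFree.mk x) = gen x.top :=
  OddFree.lift_mk _ _ _ _

theorem aug_mk (x : OOver Γ₀ 0) : aug Γ₀ (OddFree.mk x) =
    ind (IsNatural x.top.or) - ind (IsNatural (-x.top.or)) := OddFree.lift_mk _ _ _ _

/-! ### The forest complex is an augmented chain complex -/

/-- A morphism which collapses two edges, together with the set of half-edges outside of the edge
which is collapsed first. -/
structure TwoStep {n : ℕ} (y : OGraph Ω (n + 2)) where
  top : OOver y.graph n
  R : Set top.top.graph.H
  prop : ∃ (z : OGraph Ω (n + 1)) (r : top.top.graph ⟶ z.graph) (q : z.graph ⟶ y.graph),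
    r ≫ q = top.map ∧ Set.range r.pre = R ∧ Induces r top.top.or z.or ∧ Induces q z.or y.or

namespace TwoStep

variable {n : ℕ} {y : OGraph Ω (n + 2)}

/-- Isomorphism over `y`. -/
def Rel (t t' : TwoStep y) : Prop :=
  ∃ l : t.top.top.graph ≅ t'.top.top.graph, PreservesOr l t.top.top.or t'.top.top.or ∧
    l.hom ≫ t'.top.map = t.top.map ∧ l.hom.pre '' t'.R = t.R

theorem Rel.symm {t t' : TwoStep y} : t.Rel t' → t'.Rel t := by
  rintro ⟨l, h1, h2, h3⟩
  refine ⟨l.symm, h1.symm, by simp [← h2], ?_⟩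
  rw [← h3, ← Set.image_comp]
  convert Set.image_id _
  ext z : 1
  exact (isoH l).right_inv z

theorem Rel.trans {t t' t'' : TwoStep y} : t.Rel t' → t'.Rel t'' → t.Rel t'' := by
  rintro ⟨l, h1, h2, h3⟩ ⟨k, k1, k2, k3⟩
  refine ⟨l ≪≫ k, h1.trans k1, by simp [← h2, ← k2], ?_⟩
  rw [← h3, ← k3, ← Set.image_comp]
  rfl

/-- Exchange of the order in which the two edges are collapsed. -/
def swap (t : TwoStep y) : TwoStep y where
  -- The two orders of collapse induce opposite orientations, so the source has to be reversed to
  -- induce the same orientation of `y`.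
  top := t.top.neg
  -- The half-edges of `y` survive both collapses, and those outside `t.R` belong to the edge that
  -- is now collapsed second.
  R := Set.range t.top.map.pre ∪ t.Rᶜ
  prop := by
    obtain ⟨z, r, q, hrq, hR, hr, hq⟩ := t.prop
    obtain ⟨a, ha⟩ := Hom.exists_collapses r (codim_succ t.top.top z)
    obtain ⟨b, hb⟩ := Hom.exists_collapses q (codim_succ z y)
    have hv : t.top.top.graph.vert (r.pre b) ≠
        t.top.top.graph.vert (t.top.top.graph.τ (r.pre b)) := by
      intro h
      have := congrArg (Hom.vmap r) h
      rw [← r.pre_τ, Hom.vmap_vert_pre, Hom.vmap_vert_pre] at this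
      exact hb.vert_ne this
    -- The second edge, seen in the top graph, is collapsed first; it is not a loop there because
    -- its ends are different even after the first collapse.
    obtain ⟨Γ₂, r', hr'⟩ := exists_contraction hv
    have hτ : t.top.top.graph.τ (r.pre b) = r.pre (z.graph.τ b) := (r.pre_τ b).symm
    have hmap : ∀ u, t.top.map.pre u = r.pre (q.pre u) := fun u => by rw [← hrq]; rfl
    have hrange : Set.range r'.pre = Set.range t.top.map.pre ∪ t.Rᶜ := by
      rw [hr', ← hR]
      ext u
      simp only [Set.mem_compl_iff, Set.mem_insert_iff, Set.mem_singleton_iff, Set.mem_union, hτ]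
      by_cases hu : u ∈ Set.range r.pre
      · obtain ⟨w, rfl⟩ := hu
        rw [r.pre_injective.eq_iff, r.pre_injective.eq_iff]
        constructor
        · intro hw
          obtain ⟨s, rfl⟩ := hb.exists_pre (fun h => hw (Or.inl h)) (fun h => hw (Or.inr h))
          exact Or.inl ⟨s, hmap s⟩
        · rintro (⟨s, hs⟩ | hs)
          · rw [hmap, r.pre_injective.eq_iff] at hs
            rw [← hs]
            rintro (h | h)
            exacts [hb.pre_ne _ h, hb.pre_ne_τ _ h]
          · exact absurd ⟨w, rfl⟩ hs
      · refine iff_of_true ?_ (Or.inr hu)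
        rintro (rfl | rfl) <;> exact hu ⟨_, rfl⟩
    obtain ⟨q', hq'⟩ := Hom.exists_factor r' t.top.map (by
      rw [hrange]; exact Set.subset_union_left)
    obtain ⟨c, hc⟩ := hr'.exists_pre (x := a) (fun h => ha.pre_ne b h.symm)
      (fun h => ha.pre_ne _ (hτ ▸ h.symm))
    have hcodim : Γ₂.codim = n + 1 := by rw [hr'.codim, t.top.top.codim_eq]
    have hc' : Hom.Collapses q' c := by
      refine Hom.collapses_of_notMem (by rw [y.codim_eq, hcodim]) ?_
      rintro ⟨u, rfl⟩
      rw [← comp_pre, hq', hmap] at hc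
      exact ha.pre_ne _ hc
    have hex := orn_exchange ha hb hr' hc' hc (hrq.trans hq'.symm) t.top.top.or
    refine ⟨⟨Γ₂, hcodim, hr'.orn (-t.top.top.or)⟩, r', q', hq', hrange, hr'.orn_induces _, ?_⟩
    rw [hc'.induces_iff, hr'.orn_neg, hc'.orn_neg, hex, Orn.neg_neg', ← ha.induces_orn hr]
    exact hb.induces_orn hq

theorem swap_rel {t t' : TwoStep y} : t.Rel t' → t.swap.Rel t'.swap := by
  rintro ⟨l, h1, h2, h3⟩
  refine ⟨l, h1.neg, h2, ?_⟩
  have hl : Function.Bijective l.hom.pre := (isoH l.symm).bijective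
  change l.hom.pre '' (Set.range t'.top.map.pre ∪ t'.Rᶜ) = Set.range t.top.map.pre ∪ t.Rᶜ
  rw [Set.image_union, Set.image_compl_eq hl, h3, ← h2]
  congr 1
  exact (Set.range_comp l.hom.pre t'.top.map.pre).symm

theorem swap_swap_rel (t : TwoStep y) : t.swap.swap.Rel t := by
  have hsub : Set.range t.top.map.pre ⊆ t.R := by
    obtain ⟨z, r, q, hrq, hR, -, -⟩ := t.prop
    rw [← hR, ← hrq]
    rintro _ ⟨u, rfl⟩
    exact ⟨_, rfl⟩
  refine ⟨Iso.refl _, ?_, Category.id_comp _, ?_⟩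
  · change PreservesOr _ (- -t.top.top.or) _
    rw [Orn.neg_neg']
    exact PreservesOr.refl _
  · refine (Set.image_id _).trans ?_
    change t.R = Set.range t.top.map.pre ∪ (Set.range t.top.map.pre ∪ t.Rᶜ)ᶜ
    ext u
    have := @hsub u
    simp only [Set.mem_union, Set.mem_compl_iff]
    tauto

/-- The pairs of classes of expansions. -/
abbrev Pair (y : OGraph Ω (n + 2)) : Type u :=
  Σ q : Expansion.Cls y, Expansion.Cls (Expansion.rep q).source

/-- Two successive expansions. -/
def ofPair (p : Pair y) : TwoStep y where
  top := ⟨(Expansion.rep p.2).source, (Expansion.rep p.2).map ≫ (Expansion.rep p.1).map⟩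
  R := Set.range (Expansion.rep p.2).map.pre
  prop := ⟨(Expansion.rep p.1).source, (Expansion.rep p.2).map, (Expansion.rep p.1).map, rfl, rfl,
    (Expansion.rep p.2).induces, (Expansion.rep p.1).induces⟩

/-- The set `R` recovers the intermediate graph up to isomorphism, hence the first class. Rigidity
over `y` then makes the comparison isomorphism the identity, and the second class follows. -/
theorem ofPair_injective {p p' : Pair y} (h : (ofPair p).Rel (ofPair p')) : p = p' := by
  obtain ⟨q, s⟩ := p
  obtain ⟨q', s'⟩ := p'
  obtain ⟨l, h1, h2, h3⟩ := h
  replace h2 : l.hom ≫ (Expansion.rep s').map ≫ (Expansion.rep q').map =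
    (Expansion.rep s).map ≫ (Expansion.rep q).map := h2
  have hr : Set.range (Hom.pre (l.hom ≫ (Expansion.rep s').map)) =
      Set.range (Expansion.rep s).map.pre :=
    (Set.range_comp l.hom.pre (Expansion.rep s').map.pre).trans h3
  obtain ⟨k, hk⟩ := Hom.exists_iso_of_range_eq _ _ hr
  have hk' : k.hom ≫ (Expansion.rep q').map = (Expansion.rep q).map := by
    rw [← cancel_epi (Expansion.rep s).map]
    exact (Category.assoc _ _ _).symm.trans ((congrArg (· ≫ (Expansion.rep q').map) hk).trans
      ((Category.assoc _ _ _).trans h2))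
  obtain rfl : q = q' := Expansion.eq_of_rel (Expansion.rel_of_iso k hk')
  obtain rfl : k = Iso.refl _ := iso_comp_cancel (hk'.trans (Category.id_comp _).symm)
  obtain rfl : s = s' := Expansion.eq_of_rel (Expansion.rel_of_iso l
    (hk.symm.trans (Category.comp_id _)))
  rfl

/-- The intermediate graph is replaced by the chosen representative of its class, and then the top
graph by the representative over that one. -/
theorem exists_ofPair (t : TwoStep y) : ∃ p, (ofPair p).Rel t := by
  obtain ⟨z, r, q, hrq, hR, hr, hq⟩ := t.prop
  let c : y.Expansion := ⟨z, q, hq⟩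
  obtain ⟨k, hk, hk'⟩ := Expansion.rep_cls c
  let c' : (Expansion.rep (Expansion.cls c)).source.Expansion :=
    ⟨t.top.top, r ≫ k.inv, hr.comp_iso (l := k.symm) hk.symm⟩
  obtain ⟨l, hl, hl'⟩ := Expansion.rep_cls c'
  replace hl' : l.hom ≫ r ≫ k.inv = (Expansion.rep (Expansion.cls c')).map := hl'
  replace hk' : k.hom ≫ q = (Expansion.rep (Expansion.cls c)).map := hk'
  refine ⟨⟨Expansion.cls c, Expansion.cls c'⟩, l, hl, ?_, ?_⟩
  · change l.hom ≫ t.top.map = (Expansion.rep (Expansion.cls c')).map ≫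
      (Expansion.rep (Expansion.cls c)).map
    rw [← hk', ← hl', ← hrq]
    simp
  · change l.hom.pre '' t.R = Set.range (Expansion.rep (Expansion.cls c')).map.pre
    rw [← hl', ← hR, ← Set.range_comp, ← Category.assoc]
    exact (range_comp_iso (l.hom ≫ r) k.symm).symm

end TwoStep

/-- The exchange of the two edges permutes the pairs of successive expansions and reverses the sign
of their contributions. So the sum equals its negative, and vanishing up to the factor two is all
that is needed later. -/
theorem two_smul_bdry_bdry_mk {n : ℕ} (x : OOver Γ₀ (n + 2)) :
    (2 : ℤ) • bdry Γ₀ n (bdry Γ₀ (n + 1) (OddFree.mk x)) = 0 := by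
  let val : TwoStep x.top → Forest Γ₀ n := fun t => OddFree.mk ⟨t.top.top, t.top.map ≫ x.map⟩
  have hrel : ∀ t t', t.Rel t' → val t = val t' := by
    rintro t t' ⟨l, h1, h2, -⟩
    exact OddFree.mk_eq ⟨l, h1, by simp [← h2]⟩
  have hswap : ∀ t, val t.swap = -val t := fun t =>
    OddFree.mk_neg (⟨t.top.top, t.top.map ≫ x.map⟩ : OOver Γ₀ n)
  have hsum : bdry Γ₀ n (bdry Γ₀ (n + 1) (OddFree.mk x)) =
      ∑ p : TwoStep.Pair x.top, val (TwoStep.ofPair p) := by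
    rw [bdry_mk, map_sum, Fintype.sum_sigma]
    refine Finset.sum_congr rfl fun q _ => ?_
    rw [bdry_mk]
    refine Finset.sum_congr rfl fun s _ => ?_
    refine congrArg OddFree.mk ?_
    simp only [expand, TwoStep.ofPair, Category.assoc]
  choose G hG using TwoStep.exists_ofPair (y := x.top)
  -- The exchange acts on classes only through representatives; it is injective because it is an
  -- involution up to isomorphism.
  have hinj : Function.Injective fun p => G (TwoStep.ofPair p).swap := by
    intro p p' h
    have h1 := hG (TwoStep.ofPair p).swap
    have h2 := hG (TwoStep.ofPair p').swap
    rw [show G (TwoStep.ofPair p).swap = G (TwoStep.ofPair p').swap from h] at h1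
    have h3 := TwoStep.swap_rel (h1.symm.trans h2)
    exact TwoStep.ofPair_injective (((TwoStep.swap_swap_rel _).symm.trans h3).trans
      (TwoStep.swap_swap_rel _))
  have key : ∑ p : TwoStep.Pair x.top, val (TwoStep.ofPair p) =
      -∑ p : TwoStep.Pair x.top, val (TwoStep.ofPair p) := by
    conv_lhs => rw [← (Finite.injective_iff_bijective.1 hinj).sum_comp]
    rw [← Finset.sum_neg_distrib]
    refine Finset.sum_congr rfl fun p _ => ?_
    rw [hrel _ _ (hG _), hswap]
  rw [hsum, two_smul]
  nth_rewrite 1 [key]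
  exact neg_add_cancel _

theorem two_smul_bdry_bdry {n : ℕ} (w : Forest Γ₀ (n + 2)) :
    (2 : ℤ) • bdry Γ₀ n (bdry Γ₀ (n + 1) w) = 0 := by
  have : (2 : ℤ) • (bdry Γ₀ n ∘ₗ bdry Γ₀ (n + 1)) = 0 :=
    OddFree.hom_ext fun x => two_smul_bdry_bdry_mk x
  exact LinearMap.congr_fun this w

end Forest

/-! ### Natural signs and the augmentation -/

/-- The sign of an orientation of a trivalent graph. -/
def natSign {Γ : RibbonGraph Ω} (o : Γ.Orientn) : ℤ := ind (IsNatural o) - ind (IsNatural (-o))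

theorem natSign_neg {Γ : RibbonGraph Ω} (o : Γ.Orientn) : natSign (-o) = -natSign o := by
  rw [natSign, natSign, Orn.neg_neg', neg_sub]

theorem natSign_natOrn {Γ : RibbonGraph Ω} (h : Γ.codim = 0) : natSign (natOrn h) = 1 := by
  rw [natSign, isNatural_iff h, isNatural_iff h, ind, ind, if_pos rfl,
    if_neg fun h' => Orn.ne_neg _ h'.symm, sub_zero]

theorem natSign_eq_neg_one {Γ : RibbonGraph Ω} (h : Γ.codim = 0) {o : Γ.Orientn}
    (ho : ¬IsNatural o) : natSign o = -1 := by
  rw [isNatural_iff h] at ho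
  rw [(Orn.eq_or_neg (natOrn h) o).resolve_left ho, natSign_neg, natSign_natOrn]

theorem natSign_mul_self {Γ : RibbonGraph Ω} (h : Γ.codim = 0) (o : Γ.Orientn) :
    natSign o * natSign o = 1 := by
  rcases Orn.eq_or_neg (natOrn h) o with rfl | rfl
  · rw [natSign_natOrn]; rfl
  · rw [natSign_neg, natSign_natOrn]; rfl

theorem natSign_expansion_neg {y : OGraph Ω 1} {c c' : y.Expansion} {a : c.source.graph.H}
    {a' : c'.source.graph.H} (h : Hom.Collapses c.map a) (h' : Hom.Collapses c'.map a')
    {x : y.graph.H} (hx : c.map.pre x = c.source.graph.σ a)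
    (hx' : c'.map.pre (y.graph.σ x) = c'.source.graph.σ a') :
    natSign c'.source.or = -natSign c.source.or := by
  have h0 := c.source.codim_eq
  have h0' := c'.source.codim_eq
  have hn := h.orn_natOrn_neg h' h0 h0' hx hx'
  have h1 := h.induces_orn c.induces
  have h2 := h'.induces_orn c'.induces
  rw [h1] at h2
  rcases Orn.eq_or_neg (natOrn h0) c.source.or with ho | ho
  · rw [ho] at h2 ⊢
    have h3 : h'.orn (-natOrn h0') = h'.orn c'.source.or := by
      rw [h'.orn_neg, hn, Orn.neg_neg', h2]
    rw [← h'.orn_injective h3, natSign_neg, natSign_natOrn, natSign_natOrn]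
  · rw [ho] at h2 ⊢
    have h3 : h'.orn (natOrn h0') = h'.orn c'.source.or := by
      rw [hn, ← h2, h.orn_neg]
    rw [← h'.orn_injective h3, natSign_neg, natSign_natOrn, natSign_natOrn, neg_neg]

namespace Forest

variable {Γ₀ Γ₁ : RibbonGraph Ω}

/-- The expansion with `x` following an end of the new edge also has `σ² x` following the other end,
while `σ x` belongs to the other expansion, whose sign is opposite. Thus `σ` induces a sign
reversing involution on the classes. -/
theorem sum_natSign_eq_zero [Infinite Ω] (y : OGraph Ω 1) :
    ∑ q : Expansion.Cls y, natSign (Expansion.rep q).source.or = 0 := by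
  -- `T q x`: the half-edge `x` follows one end of the new edge. `T1` to `T6` say that the classes
  -- correspond to the pairs `{x, σ² x}` at the vertex of valence four.
  let T : Expansion.Cls y → y.graph.H → Prop := fun q x =>
    ∃ a, Hom.Collapses (Expansion.rep q).map a ∧
      (Expansion.rep q).map.pre x = (Expansion.rep q).source.graph.σ a
  have h0 : ∀ q : Expansion.Cls y, (Expansion.rep q).source.graph.codim = 0 :=
    fun q => (Expansion.rep q).source.codim_eq
  have T1 : ∀ q, ∃ x, T q x := fun q => by
    obtain ⟨a, ha⟩ := (Expansion.rep q).exists_collapses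
    obtain ⟨x, hx⟩ := ha.exists_pre_σ
    exact ⟨x, a, ha, hx⟩
  have T2 : ∀ q x, T q x → T q (y.graph.σ (y.graph.σ x)) := by
    rintro q x ⟨a, ha, hx⟩
    exact ⟨_, ha.symm, (ha.pre_σ_of_trivalent (h0 q) hx).2⟩
  have T3 : ∀ q x x', T q x → T q x' → x' = x ∨ x' = y.graph.σ (y.graph.σ x) := by
    rintro q x x' ⟨a, ha, hx⟩ ⟨a', ha', hx'⟩
    rcases ha.eq_or_eq ha'.notMem with rfl | rfl
    · exact Or.inl ((Expansion.rep q).map.pre_injective (hx'.trans hx.symm))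
    · exact Or.inr ((Expansion.rep q).map.pre_injective
        (hx'.trans (ha.pre_σ_of_trivalent (h0 q) hx).2.symm))
  have T4 : ∀ q q' x, T q x → T q' x → q = q' := by
    rintro q q' x ⟨a, ha, hx⟩ ⟨a', ha', hx'⟩
    obtain ⟨k, hk⟩ := ha.exists_iso ha' hx (ha.pre_σ_of_trivalent (h0 q) hx).2 hx'
      (ha'.pre_σ_of_trivalent (h0 q') hx').2
    exact Expansion.eq_of_rel (Expansion.rel_of_iso k hk)
  have T5 : ∀ q x, T q x → y.graph.σ (y.graph.σ (y.graph.σ (y.graph.σ x))) = x := by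
    rintro q x ⟨a, ha, hx⟩
    exact ha.σ_pow_four (h0 q) hx
  have T6 : ∀ q x, T q x → ∃ q', T q' (y.graph.σ x) := by
    -- The other expansion exists by splitting the vertex at `σ x`. The cycle has length four, so
    -- `σ³` does not fix `σ x`.
    intro q x hq
    have h4 := T5 q x hq
    obtain ⟨Γ, f, a, ha, hx, -⟩ := exists_expansion (Δ := y.graph) (x := y.graph.σ x)
      (by rw [h4]; exact (y.graph.σ_ne x).symm)
    have hc : Γ.codim = 0 := by
      have := ha.codim
      rw [y.codim_eq] at this
      omega
    obtain ⟨o, ho⟩ := Expansion.exists_of_hom hc f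
    let c : y.Expansion := ⟨⟨Γ, hc, o⟩, f, ho⟩
    obtain ⟨k, -, hk⟩ := Expansion.rep_cls c
    replace hk : k.hom ≫ f = (Expansion.rep (Expansion.cls c)).map := hk
    refine ⟨Expansion.cls c, k.hom.pre a, ?_, ?_⟩
    · rw [Hom.Collapses, ← hk, ← k.hom.pre_τ]
      refine (Set.range_comp k.hom.pre f.pre).trans ?_
      have hb : Function.Bijective k.hom.pre := (isoH k.symm).bijective
      rw [show Set.range f.pre = _ from ha]
      exact (Set.image_compl_eq hb).trans (congrArg _ (Set.image_pair _ _ _))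
    · rw [← hk, comp_pre, hx, iso_pre_σ]
  have T7 : ∀ q q' x, T q x → T q' (y.graph.σ x) →
      natSign (Expansion.rep q').source.or = -natSign (Expansion.rep q).source.or := by
    rintro q q' x ⟨a, ha, hx⟩ ⟨a', ha', hx'⟩
    exact natSign_expansion_neg ha ha' hx hx'
  choose X hX using T1
  choose I hI using fun q => T6 q (X q) (hX q)
  have hinv : Function.Involutive I := by
    intro q
    have h1 := hI (I q)
    rcases T3 _ _ _ (hI q) (hX (I q)) with h | h
    · rw [h] at h1
      exact T4 _ _ _ h1 (T2 _ _ (hX q))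
    · rw [h, T5 q _ (hX q)] at h1
      exact T4 _ _ _ h1 (hX q)
  have key : ∑ q : Expansion.Cls y, natSign (Expansion.rep q).source.or =
      -∑ q : Expansion.Cls y, natSign (Expansion.rep q).source.or := by
    conv_lhs => rw [← hinv.bijective.sum_comp]
    rw [← Finset.sum_neg_distrib]
    exact Finset.sum_congr rfl fun q _ => T7 _ _ _ (hX q) (hI q)
  omega

theorem aug_bdry [Infinite Ω] (w : Forest Γ₀ 1) : aug Γ₀ (bdry Γ₀ 0 w) = 0 := by
  have : aug Γ₀ ∘ₗ bdry Γ₀ 0 = 0 := OddFree.hom_ext fun x => by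
    rw [LinearMap.comp_apply, bdry_mk, map_sum]
    simp only [aug_mk]
    exact sum_natSign_eq_zero x.top
  exact LinearMap.congr_fun this w

theorem bdry_push (g : Γ₀ ⟶ Γ₁) {k : ℕ} (w : Forest Γ₀ (k + 1)) :
    bdry Γ₁ k (push g (k + 1) w) = push g k (bdry Γ₀ k w) := by
  have : bdry Γ₁ k ∘ₗ push g (k + 1) = push g k ∘ₗ bdry Γ₀ k := OddFree.hom_ext fun x => by
    rw [LinearMap.comp_apply, LinearMap.comp_apply, push_mk, bdry_mk, bdry_mk, map_sum]
    refine Finset.sum_congr rfl fun q _ => ?_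
    rw [push_mk]
    exact congrArg OddFree.mk (by simp [expand, OOver.push])
  exact LinearMap.congr_fun this w

theorem aug_push (g : Γ₀ ⟶ Γ₁) (w : Forest Γ₀ 0) : aug Γ₁ (push g 0 w) = aug Γ₀ w := by
  have : aug Γ₁ ∘ₗ push g 0 = aug Γ₀ := OddFree.hom_ext fun x => by
    rw [LinearMap.comp_apply, push_mk, aug_mk, aug_mk]
    rfl
  exact LinearMap.congr_fun this w

theorem proj_push (g : Γ₀ ⟶ Γ₁) {k : ℕ} (w : Forest Γ₀ k) :
    proj Γ₁ k (push g k w) = proj Γ₀ k w := by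
  have : proj Γ₁ k ∘ₗ push g k = proj Γ₀ k := OddFree.hom_ext fun x => by
    rw [LinearMap.comp_apply, push_mk, proj_mk, proj_mk]
    rfl
  exact LinearMap.congr_fun this w

theorem push_push {Γ₂ : RibbonGraph Ω} (g : Γ₀ ⟶ Γ₁) (h : Γ₁ ⟶ Γ₂) {k : ℕ} (w : Forest Γ₀ k) :
    push h k (push g k w) = push (g ≫ h) k w := by
  have : push h k ∘ₗ push g k = push (g ≫ h) k := OddFree.hom_ext fun x => by
    rw [LinearMap.comp_apply, push_mk, push_mk, push_mk]
    exact congrArg OddFree.mk (by simp [OOver.push])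
  exact LinearMap.congr_fun this w

/-! ### The forest complex in its top degree -/

/-- The identity of an oriented graph as an element of the forest complex. -/
def one {n : ℕ} (y : OGraph Ω n) : Forest y.graph n := OddFree.mk ⟨y, 𝟙 _⟩

/-- A morphism between graphs of equal codimension collapses nothing, so every generator is the
identity up to sign. -/
theorem exists_smul_one {n : ℕ} (y : OGraph Ω n) (w : Forest y.graph n) :
    ∃ t : ℤ, w = t • one y := by
  have hmk : ∀ x : OOver y.graph n, ∃ t : ℤ, (OddFree.mk x : Forest y.graph n) = t • one y := by
    intro x
    have : IsIso x.map := Hom.isIso_of_codim x.map (by rw [x.top.codim_eq, y.codim_eq])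
    rcases preservesOr_or_neg (asIso x.map) x.top.or y.or with h | h
    · refine ⟨1, ?_⟩
      rw [one_smul]
      exact OddFree.mk_eq ⟨asIso x.map, h, by simp⟩
    · refine ⟨-1, ?_⟩
      rw [neg_smul, one_smul]
      let k : x.top.graph ≅ y.graph := asIso x.map
      have h' : x.IsoRel (⟨y, 𝟙 _⟩ : OOver y.graph n).neg := ⟨k, h, Category.comp_id _⟩
      exact (OddFree.mk_eq h').trans (OddFree.mk_neg _)
  obtain ⟨v, rfl⟩ := Submodule.Quotient.mk_surjective _ w
  induction v using Finsupp.induction_linear with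
  | zero => exact ⟨0, by simp⟩
  | add v v' hv hv' =>
    obtain ⟨t, ht⟩ := hv
    obtain ⟨t', ht'⟩ := hv'
    exact ⟨t + t', by rw [Submodule.Quotient.mk_add, ht, ht', add_smul]⟩
  | single x s =>
    obtain ⟨t, ht⟩ := hmk x
    refine ⟨s * t, ?_⟩
    rw [mul_smul, ← ht, OddFree.mk, ← Submodule.Quotient.mk_smul]
    simp

/-- A functional which does not vanish on the boundary of the identity. -/
theorem exists_functional [Infinite Ω] {n : ℕ} (y : OGraph Ω (n + 1)) :
    ∃ l : Forest y.graph n →ₗ[ℤ] ℤ, l (bdry y.graph n (one y)) = 1 := by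
  obtain ⟨c⟩ := Expansion.nonempty y
  let z : OOver y.graph n := ⟨c.source, c.map⟩
  have htrans : ∀ {x x' x'' : OOver y.graph n}, x.IsoRel x' → x'.IsoRel x'' → x.IsoRel x'' := by
    rintro x x' x'' ⟨l, hl, h⟩ ⟨l', hl', h'⟩
    exact ⟨l ≪≫ l', hl.trans hl', by simp [← h, ← h']⟩
  have hsymm : ∀ {x x' : OOver y.graph n}, x.IsoRel x' → x'.IsoRel x := by
    rintro x x' ⟨l, hl, h⟩
    exact ⟨l.symm, hl.symm, by simp [← h]⟩
  have hnn : ∀ x : OOver y.graph n, x.neg.neg = x := by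
    rintro ⟨⟨x, hx, o⟩, f⟩
    exact congrArg (fun o => (⟨⟨x, hx, o⟩, f⟩ : OOver y.graph n)) (Orn.neg_neg' o)
  have hneg : ∀ {x x' : OOver y.graph n}, x.IsoRel x' → x.neg.IsoRel x'.neg := by
    rintro x x' ⟨l, hl, h⟩
    exact ⟨l, hl.neg, h⟩
  refine ⟨OddFree.lift (fun x => ind (x.IsoRel z) - ind (x.IsoRel z.neg)) ?_ ?_, ?_⟩
  · intro x x' h
    have h1 : x.IsoRel z ↔ x'.IsoRel z := ⟨htrans (hsymm h), htrans h⟩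
    have h2 : x.IsoRel z.neg ↔ x'.IsoRel z.neg := ⟨htrans (hsymm h), htrans h⟩
    rw [h1, h2]
  · intro x
    have h1 : x.neg.IsoRel z ↔ x.IsoRel z.neg :=
      ⟨fun h => by simpa [hnn] using hneg h, fun h => by simpa [hnn] using hneg h⟩
    have h2 : x.neg.IsoRel z.neg ↔ x.IsoRel z :=
      ⟨fun h => by simpa [hnn] using hneg h, hneg⟩
    rw [h1, h2, neg_sub]
  -- The functional is the coefficient of the expansion `c`. Its class occurs once in the boundary
  -- of the identity, and with sign `+1`, since there are no automorphisms over `y` that could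
  -- reverse its orientation.
  · rw [one, bdry_mk, map_sum, Finset.sum_eq_single (Expansion.cls c)]
    · rw [OddFree.lift_mk]
      obtain ⟨k, hk, hk'⟩ := Expansion.rep_cls c
      have h1 : (expand ⟨y, 𝟙 _⟩ (Expansion.cls c)).IsoRel z :=
        ⟨k, hk, hk'.trans (Category.comp_id _).symm⟩
      have h2 : ¬(expand ⟨y, 𝟙 _⟩ (Expansion.cls c)).IsoRel z.neg := by
        rintro ⟨l, hl, h⟩
        obtain rfl : l = k := iso_comp_cancel (h.trans ((Category.comp_id _).trans hk'.symm))
        exact not_preservesOr_neg hk hl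
      rw [ind, ind, if_pos h1, if_neg h2, sub_zero]
    · intro q _ hq
      rw [OddFree.lift_mk]
      have h0 : ∀ k : (Expansion.rep q).source.graph ≅ c.source.graph,
          k.hom ≫ c.map ≠ (Expansion.rep q).map ≫ 𝟙 _ := by
        intro k hk
        refine hq (Eq.trans (Expansion.cls_rep q).symm (Expansion.cls_eq_iff.2
          (Expansion.rel_of_iso k (hk.trans (Category.comp_id _)))))
      have h1 : ¬(expand ⟨y, 𝟙 _⟩ q).IsoRel z := fun ⟨k, _, hk⟩ => h0 k hk
      have h2 : ¬(expand ⟨y, 𝟙 _⟩ q).IsoRel z.neg := fun ⟨k, _, hk⟩ => h0 k hk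
      rw [ind, ind, if_neg h1, if_neg h2, sub_zero]
    · simp

end Forest

end FatGraph

namespace FatGraph

open RibbonGraph OGraph

variable {Ω : Type u}

/-! ### The boundary map on the generators of the integral subcomplex -/

instance {Γ Δ : RibbonGraph Ω} : Fintype (Γ ≅ Δ) := Fintype.ofFinite _

instance {Γ Δ : RibbonGraph Ω} : Fintype (Γ ⟶ Δ) := Fintype.ofFinite _

/-- The sign of an isomorphism of oriented graphs. -/
def orSign {Γ Δ : RibbonGraph Ω} (k : Γ ≅ Δ) (o : Γ.Orientn) (o' : Δ.Orientn) : ℤ :=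
  ind (PreservesOr k o o') - ind (PreservesOr k o (-o'))

theorem orSign_of_preservesOr {Γ Δ : RibbonGraph Ω} {k : Γ ≅ Δ} {o : Γ.Orientn} {o' : Δ.Orientn}
    (h : PreservesOr k o o') : orSign k o o' = 1 := by
  rw [orSign, ind, ind, if_pos h, if_neg (not_preservesOr_neg h), sub_zero]

theorem orSign_neg {Γ Δ : RibbonGraph Ω} (k : Γ ≅ Δ) (o : Γ.Orientn) (o' : Δ.Orientn) :
    orSign k o (-o') = -orSign k o o' := by
  rw [orSign, orSign, Orn.neg_neg', neg_sub]

theorem orSign_of_preservesOr_neg {Γ Δ : RibbonGraph Ω} {k : Γ ≅ Δ} {o : Γ.Orientn}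
    {o' : Δ.Orientn} (h : PreservesOr k o (-o')) : orSign k o o' = -1 := by
  rw [← neg_eq_iff_eq_neg, ← orSign_neg, orSign_of_preservesOr h]

theorem orSign_comp {Γ Δ Θ : RibbonGraph Ω} (k : Γ ≅ Δ) (l : Δ ≅ Θ) (o : Γ.Orientn)
    (o' : Δ.Orientn) (o'' : Θ.Orientn) :
    orSign (k ≪≫ l) o o'' = orSign k o o' * orSign l o' o'' := by
  rcases preservesOr_or_neg k o o' with h | h <;> rcases preservesOr_or_neg l o' o'' with h' | h'
  · rw [orSign_of_preservesOr h, orSign_of_preservesOr h', orSign_of_preservesOr (h.trans h'),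
      mul_one]
  · rw [orSign_of_preservesOr h, orSign_of_preservesOr_neg h',
      orSign_of_preservesOr_neg (h.trans h'), one_mul]
  · rw [orSign_of_preservesOr_neg h, orSign_of_preservesOr h',
      orSign_of_preservesOr_neg (h.trans h'.neg), mul_one]
  · have h'' := h'.neg
    rw [Orn.neg_neg'] at h''
    rw [orSign_of_preservesOr_neg h, orSign_of_preservesOr_neg h',
      orSign_of_preservesOr (h.trans h'')]
    rfl

/-- If there is an orientation reversing automorphism, the signs cancel in pairs and `[Γ]^*` is
zero; otherwise all isomorphisms have the same sign and there are `|Aut Γ|` of them. So the factor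
in `⟨Γ⟩` turns it into a signed count. -/
theorem angle_mk {n : ℕ} (x y : OGraph Ω n) :
    angle x (OddFree.mk y) = ∑ k : y.graph ≅ x.graph, orSign k y.or x.or := by
  have hval : angle x (OddFree.mk y) =
      (Nat.card (Aut x.graph) : ℤ) * (ind (y.IsoRel x) - ind (y.IsoRel x.neg)) := by
    rw [angle, LinearMap.smul_apply, dualGen, OddFree.lift_mk, smul_eq_mul]
  rw [hval]
  by_cases he : Nonempty (y.graph ≅ x.graph)
  swap
  · have h1 : ¬y.IsoRel x := fun ⟨k, _⟩ => he ⟨k⟩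
    have h2 : ¬y.IsoRel x.neg := fun ⟨k, _⟩ => he ⟨k⟩
    rw [not_nonempty_iff] at he
    rw [ind, ind, if_neg h1, if_neg h2, Fintype.sum_empty]
    simp
  obtain ⟨k₀⟩ := he
  have hcard : Nat.card (Aut x.graph) = Nat.card (y.graph ≅ x.graph) :=
    Nat.card_congr (Iso.isoCongrLeft k₀).symm
  rw [hcard]
  by_cases h1 : y.IsoRel x <;> by_cases h2 : y.IsoRel x.neg
  · rw [ind, ind, if_pos h1, if_pos h2, sub_self, mul_zero]
    obtain ⟨k, hk⟩ := h1
    obtain ⟨l, hl⟩ : ∃ l : y.graph ≅ x.graph, PreservesOr l y.or (-x.or) := h2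
    have ha : orSign (k.symm ≪≫ l) x.or x.or = -1 :=
      orSign_of_preservesOr_neg (hk.symm.trans hl)
    have key : ∑ k : y.graph ≅ x.graph, orSign k y.or x.or =
        -∑ k : y.graph ≅ x.graph, orSign k y.or x.or := by
      conv_lhs => rw [← (Iso.isoCongrRight (k.symm ≪≫ l) : (y.graph ≅ x.graph) ≃ _).sum_comp]
      rw [← Finset.sum_neg_distrib]
      refine Finset.sum_congr rfl fun j _ => ?_
      refine (orSign_comp j (k.symm ≪≫ l) y.or x.or x.or).trans ?_
      rw [ha, mul_neg_one]
    omega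
  · rw [ind, ind, if_pos h1, if_neg h2, sub_zero, mul_one, Finset.sum_congr rfl fun k _ =>
      orSign_of_preservesOr ((preservesOr_or_neg k y.or x.or).resolve_right fun h => h2 ⟨k, h⟩)]
    simp [Nat.card_eq_fintype_card]
  · rw [ind, ind, if_neg h1, if_pos h2, zero_sub, mul_neg_one, ← neg_neg (Finset.sum _ _),
      ← Finset.sum_neg_distrib, Finset.sum_congr rfl fun k _ => (orSign_neg k y.or x.or).symm.trans
      (orSign_of_preservesOr ((preservesOr_or_neg k y.or x.or).resolve_left fun h => h1 ⟨k, h⟩))]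
    simp [Nat.card_eq_fintype_card]
  · rcases preservesOr_or_neg k₀ y.or x.or with h | h
    exacts [absurd ⟨k₀, h⟩ h1, absurd ⟨k₀, h⟩ h2]

/-- The sign of a morphism of oriented graphs which collapses a single edge. -/
def inducesSign {Γ Δ : RibbonGraph Ω} (f : Γ ⟶ Δ) (o : Γ.Orientn) (o' : Δ.Orientn) : ℤ :=
  ind (Induces f o o') - ind (Induces f o (-o'))

/-- Every one-edge collapse `y ⟶ x` is, in exactly one way, a representative of a class of collapses
of `y` followed by an isomorphism. -/
theorem sum_collapse_orSign {n : ℕ} (x : OGraph Ω (n + 1)) (y : OGraph Ω n) :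
    ∑ q : Collapse.Cls y, ∑ k : (Collapse.rep q).target.graph ≅ x.graph,
      orSign k (Collapse.rep q).target.or x.or =
    ∑ g : y.graph ⟶ x.graph, inducesSign g y.or x.or := by
  rw [← Fintype.sum_sigma']
  refine Fintype.sum_bijective
    (fun p : (q : Collapse.Cls y) × ((Collapse.rep q).target.graph ≅ x.graph) =>
      (Collapse.rep p.1).map ≫ p.2.hom) ⟨?_, ?_⟩ _ _ ?_
  · rintro ⟨q, k⟩ ⟨q', k'⟩ h
    replace h : (Collapse.rep q).map ≫ k.hom = (Collapse.rep q').map ≫ k'.hom := h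
    obtain rfl : q = q' := Collapse.eq_of_rel (Collapse.rel_of_iso (k ≪≫ k'.symm)
      (by rw [Iso.trans_hom, reassoc_of% h]; simp))
    obtain rfl : k = k' := Iso.ext ((cancel_epi _).1 h)
    rfl
  · intro g
    obtain ⟨o, ho⟩ := Induces.exists_target g (codim_succ y x) y.or
    obtain ⟨k, -, hk⟩ := Collapse.rep_cls (⟨⟨x.graph, x.codim_eq, o⟩, g, ho⟩ : y.Collapse)
    exact ⟨⟨_, k⟩, hk⟩
  · rintro ⟨q, k⟩
    have h : ∀ o : x.graph.Orientn, PreservesOr k (Collapse.rep q).target.or o ↔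
        Induces ((Collapse.rep q).map ≫ k.hom) y.or o := fun o =>
      ⟨fun h => (Collapse.rep q).induces.comp_iso h, fun h => preservesOr_iff.2
        (Induces.unique (codim_succ y x) h
          ((Collapse.rep q).induces.comp_iso (preservesOr_iff.2 rfl)))⟩
    simp only [orSign, inducesSign, h]

/-- Dually, it is in exactly one way an isomorphism followed by a representative of a class of
expansions of `x`; uniqueness uses rigidity over `x`. -/
theorem sum_expansion_orSign {n : ℕ} (x : OGraph Ω (n + 1)) (y : OGraph Ω n) :
    ∑ q : Expansion.Cls x, ∑ k : y.graph ≅ (Expansion.rep q).source.graph,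
      orSign k y.or (Expansion.rep q).source.or =
    ∑ g : y.graph ⟶ x.graph, inducesSign g y.or x.or := by
  rw [← Fintype.sum_sigma']
  refine Fintype.sum_bijective
    (fun p : (q : Expansion.Cls x) × (y.graph ≅ (Expansion.rep q).source.graph) =>
      p.2.hom ≫ (Expansion.rep p.1).map) ⟨?_, ?_⟩ _ _ ?_
  · rintro ⟨q, k⟩ ⟨q', k'⟩ h
    replace h : k.hom ≫ (Expansion.rep q).map = k'.hom ≫ (Expansion.rep q').map := h
    obtain rfl : q = q' := Expansion.eq_of_rel (Expansion.rel_of_iso (k.symm ≪≫ k')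
      (by rw [Iso.trans_hom, Category.assoc, ← h]; simp))
    obtain rfl : k = k' := iso_comp_cancel h
    rfl
  · intro g
    obtain ⟨o, ho⟩ := Expansion.exists_of_hom y.codim_eq g
    obtain ⟨k, -, hk⟩ := Expansion.rep_cls (⟨⟨y.graph, y.codim_eq, o⟩, g, ho⟩ : x.Expansion)
    exact ⟨⟨_, k.symm⟩, by simp [← hk]⟩
  · rintro ⟨q, k⟩
    have h : ∀ (o : (Expansion.rep q).source.graph.Orientn) (o' : x.graph.Orientn),
        Induces (Expansion.rep q).map o o' → (PreservesOr k y.or o ↔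
        Induces (k.hom ≫ (Expansion.rep q).map) y.or o') := fun o o' ho =>
      ⟨fun h => Induces.iso_comp h ho, fun h => by
        have h1 : PreservesOr k (o.map (isoCell k.symm)) o :=
          (preservesOr_iff (k := k.symm).2 rfl).symm
        rwa [Induces.source_unique (codim_succ y x) h (Induces.iso_comp h1 ho)]⟩
    simp only [orSign, inducesSign, h _ _ (Expansion.rep q).induces,
      h _ _ (Expansion.rep q).induces.neg]

/-- Evaluated on `[y]`, both sides are the signed number of morphisms `y ⟶ x` collapsing one edge,
sorted once by collapses of `y` and once by expansions of `x`. -/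
theorem integralBdry_gen {n : ℕ} (x : OGraph Ω (n + 1)) :
    integralBdry Ω n (gen x) = ∑ q : Expansion.Cls x, gen (Expansion.rep q).source := by
  refine Subtype.ext ?_
  rw [AddSubmonoidClass.coe_finsetSum]
  change dualBdry Ω n (angle x) = ∑ q : Expansion.Cls x, angle (Expansion.rep q).source
  refine OddFree.hom_ext fun y => ?_
  change angle x (graphBdry Ω n (OddFree.mk y)) = _
  rw [graphBdry, OddFree.lift_mk, collapseSum_eq, map_sum, LinearMap.sum_apply]
  simp only [angle_mk]
  rw [sum_collapse_orSign, sum_expansion_orSign]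

/-- By the formula for `d⟨Γ⟩` the span of the generators is closed under the boundary, so iterated
boundaries add nothing. -/
theorem span_gen (n : ℕ) : Submodule.span ℤ (Set.range (gen (Ω := Ω) (n := n))) = ⊤ := by
  have key : ∀ f, IntegralGen Ω n f → f ∈ Submodule.span ℤ (Set.range (angle (Ω := Ω) (n := n))) := by
    intro f hf
    induction hf with
    | angle x => exact Submodule.subset_span ⟨x, rfl⟩
    | @bdry n f _ ih =>
      have hle : Submodule.span ℤ (Set.range (angle (Ω := Ω) (n := n + 1))) ≤
          (Submodule.span ℤ (Set.range (angle (Ω := Ω) (n := n)))).comap (dualBdry Ω n) := by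
        rw [Submodule.span_le]
        rintro _ ⟨x, rfl⟩
        have h := congrArg Subtype.val (integralBdry_gen x)
        rw [AddSubmonoidClass.coe_finsetSum] at h
        rw [SetLike.mem_coe, Submodule.mem_comap]
        refine Eq.mpr (congrArg (· ∈ Submodule.span ℤ (Set.range angle)) h) ?_
        exact Submodule.sum_mem _ fun q _ => Submodule.subset_span ⟨_, rfl⟩
      exact hle ih
  rw [eq_top_iff]
  rintro ⟨f, hf⟩ -
  have h1 : f ∈ Submodule.span ℤ (Set.range (angle (Ω := Ω) (n := n))) :=
    (Submodule.span_le.2 key) hf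
  have h2 : (Submodule.span ℤ (Set.range (gen (Ω := Ω) (n := n)))).map (integralSub Ω n).subtype =
      Submodule.span ℤ (Set.range (angle (Ω := Ω) (n := n))) := by
    rw [Submodule.map_span, ← Set.range_comp]
    rfl
  rw [← h2] at h1
  obtain ⟨g, hg, hgf⟩ := h1
  rwa [show (⟨f, hf⟩ : integralSub Ω n) = g from Subtype.ext hgf.symm]

theorem integralSub_hom_ext {n : ℕ} {M : Type*} [AddCommGroup M]
    {f g : integralSub Ω n →ₗ[ℤ] M} (h : ∀ x, f (gen x) = g (gen x)) : f = g :=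
  LinearMap.ext_on_range (span_gen n) h

theorem Forest.integralBdry_proj {Γ₀ : RibbonGraph Ω} {k : ℕ} (w : Forest Γ₀ (k + 1)) :
    integralBdry Ω k (proj Γ₀ (k + 1) w) = proj Γ₀ k (bdry Γ₀ k w) := by
  have : integralBdry Ω k ∘ₗ proj Γ₀ (k + 1) = proj Γ₀ k ∘ₗ bdry Γ₀ k :=
    OddFree.hom_ext fun x => by
      refine (congrArg (integralBdry Ω k) (proj_mk x)).trans ((integralBdry_gen x.top).trans ?_)
      refine Eq.symm ((congrArg (proj Γ₀ k) (bdry_mk x)).trans ((map_sum (proj Γ₀ k) _ _).trans ?_))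
      exact Finset.sum_congr rfl fun q _ => proj_mk (expand x q)
  exact LinearMap.congr_fun this w

/-- The relation `2 d² = 0` is carried from the forest complex by the projection; functionals with
values in `ℤ` have no torsion, so the factor can be dropped. -/
theorem integralBdry_integralBdry (Ω : Type u) (n : ℕ) :
    integralBdry Ω n ∘ₗ integralBdry Ω (n + 1) = 0 := by
  refine integralSub_hom_ext fun x => ?_
  have h : integralBdry Ω n (integralBdry Ω (n + 1) (gen x)) =
      Forest.proj x.graph n (Forest.bdry x.graph n (Forest.bdry x.graph (n + 1) (Forest.one x))) := by
    rw [← Forest.integralBdry_proj, ← Forest.integralBdry_proj]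
    exact congrArg _ (congrArg _ (Forest.proj_mk (⟨x, 𝟙 _⟩ : OOver x.graph (n + 2))).symm)
  rw [LinearMap.comp_apply, h, LinearMap.zero_apply]
  have h2 := congrArg (Forest.proj x.graph n) (Forest.two_smul_bdry_bdry (Forest.one x))
  rw [map_zsmul, map_zero] at h2
  exact (smul_eq_zero.1 h2).resolve_left two_ne_zero

end FatGraph

namespace FatGraph

section OverSimplices

variable {C D : Type u} [Category.{u} C] [Category.{u} D]

/-! ### Appending an object to a simplex of the nerve -/

namespace Snoc

variable {n : ℕ} (z : ComposableArrows D n) {X : D} (g : z.obj (Fin.last n) ⟶ X)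

/-- The functor on `WithTop` given by a cocone. -/
def objTop : WithTop (Fin (n + 1)) → D
  | none => X
  | some i => z.obj i

/-- The action on morphisms of the functor on `WithTop` given by a cocone. -/
def mapTop : ∀ {a b : WithTop (Fin (n + 1))}, a ≤ b → (objTop z (X := X) a ⟶ objTop z (X := X) b)
  | none, none, _ => 𝟙 _
  | some i, none, _ => z.map (homOfLE (Fin.le_last i)) ≫ g
  | some _, some _, h => z.map (homOfLE (WithTop.coe_le_coe.1 h))
  | none, some i, h => absurd h (by exact WithTop.not_top_le_coe i)

/-- The functor on `WithTop` given by a cocone. -/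
def functorTop : WithTop (Fin (n + 1)) ⥤ D where
  obj := objTop z (X := X)
  map f := mapTop z g (leOfHom f)
  map_id a := by
    cases a with
    | top => rfl
    | coe i => exact z.map_id i
  map_comp {a b c} f h := by
    cases c with
    | top =>
      cases b with
      | top => 
        cases a with
        | top => exact (Category.comp_id _).symm
        | coe i => exact (Category.comp_id _).symm
      | coe j =>
        cases a with
        | top => exact absurd (leOfHom f) (WithTop.not_top_le_coe j)
        | coe i =>
          change z.map _ ≫ g = z.map _ ≫ z.map _ ≫ g
          rw [← Category.assoc, ← z.map_comp]
          rfl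
    | coe k =>
      cases b with
      | top => exact absurd (leOfHom h) (WithTop.not_top_le_coe k)
      | coe j =>
        cases a with
        | top => exact absurd (leOfHom f) (WithTop.not_top_le_coe j)
        | coe i => exact z.map_comp _ _

/-- Adding a greatest element to `Fin (n + 1)`. -/
def toTop (n : ℕ) : Fin (n + 2) →o WithTop (Fin (n + 1)) where
  toFun i := if h : (i : ℕ) < n + 1 then ((⟨i, h⟩ : Fin (n + 1)) : WithTop _) else ⊤
  monotone' i j hij := by
    by_cases hj : (j : ℕ) < n + 1
    · have hi : (i : ℕ) < n + 1 := lt_of_le_of_lt hij hj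
      beta_reduce
      rw [dif_pos hi, dif_pos hj, WithTop.coe_le_coe]
      exact hij
    · beta_reduce
      rw [dif_neg hj]
      exact le_top

theorem toTop_castSucc (i : Fin (n + 1)) : toTop n i.castSucc = (i : WithTop (Fin (n + 1))) :=
  dif_pos i.2

theorem toTop_last : toTop n (Fin.last (n + 1)) = ⊤ := dif_neg (lt_irrefl _)

end Snoc

open Snoc

/-- The simplex obtained by appending a morphism. -/
def snoc {n : ℕ} (z : ComposableArrows D n) {X : D} (g : z.obj (Fin.last n) ⟶ X) :
    ComposableArrows D (n + 1) :=
  (toTop n).monotone.functor ⋙ functorTop z g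

theorem snoc_last {n : ℕ} (z : ComposableArrows D n) {X : D} (g : z.obj (Fin.last n) ⟶ X) :
    (snoc z g).obj (Fin.last (n + 1)) = X :=
  congrArg (objTop z (X := X)) toTop_last

/-- Simplices below are precompositions with monotone maps; an equality of index maps thus becomes
an equality of simplices without transport along objects. -/
theorem monotone_functor_congr {A B : Type*} [Preorder A] [Preorder B] {f g : A → B}
    (hf : Monotone f) (hg : Monotone g) (h : f = g) : hf.functor = hg.functor := by
  subst h
  rfl

theorem face_last_snoc {n : ℕ} (z : ComposableArrows D n) {X : D} (g : z.obj (Fin.last n) ⟶ X) :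
    face (Fin.last (n + 1)) (snoc z g) = z := by
  have h : (toTop n) ∘ (Fin.last (n + 1)).succAbove = ((↑) : Fin (n + 1) → WithTop _) := by
    funext i
    rw [Function.comp_apply, Fin.succAbove_last_apply, toTop_castSucc]
  exact congrArg (· ⋙ functorTop z g) (monotone_functor_congr
    ((toTop n).monotone.comp (Fin.strictMono_succAbove _).monotone) (WithTop.coe_mono) h)

theorem snoc_face {n : ℕ} (w : ComposableArrows D (n + 1)) :
    snoc (face (Fin.last (n + 1)) w) (faceLast (Fin.last (n + 1)) w) = w := by
  -- `r` is inverse to `toTop`. It is defined by cases so that composition with `w` agrees with the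
  -- cocone functor by `rfl` on objects.
  let r : WithTop (Fin (n + 1)) → Fin (n + 2) := fun a =>
    match a with
    | none => Fin.last (n + 1)
    | some i => (Fin.last (n + 1)).succAbove i
  have hr : Monotone r := by
    intro a b h
    cases b with
    | top => exact Fin.le_last _
    | coe j =>
      cases a with
      | top => exact absurd h (WithTop.not_top_le_coe j)
      | coe i => exact (Fin.strictMono_succAbove _).monotone (WithTop.coe_le_coe.1 h)
  have hF : functorTop (face (Fin.last (n + 1)) w) (faceLast (Fin.last (n + 1)) w) =
      hr.functor ⋙ w := by
    refine CategoryTheory.Functor.hext (fun a => by cases a <;> rfl) fun a b f => ?_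
    cases b with
    | top =>
      cases a with
      | top => exact heq_of_eq (w.map_id _).symm
      | coe i => exact heq_of_eq (w.map_comp _ _).symm
    | coe j =>
      cases a with
      | top => exact absurd (leOfHom f) (WithTop.not_top_le_coe j)
      | coe i => exact HEq.rfl
  have h : r ∘ toTop n = id := by
    funext j
    rw [Function.comp_apply]
    induction j using Fin.lastCases with
    | last => rw [toTop_last]; rfl
    | cast j => rw [toTop_castSucc]; exact Fin.succAbove_last_apply j
  refine (congrArg ((toTop n).monotone.functor ⋙ ·) hF).trans ?_
  exact congrArg (· ⋙ w) (monotone_functor_congr (hr.comp (toTop n).monotone) monotone_id h)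

theorem succAbove_castSucc_last {n : ℕ} (i : Fin (n + 1)) :
    i.castSucc.succAbove (Fin.last n) = Fin.last (n + 1) := by
  rw [Fin.succAbove_of_le_castSucc _ _ (Fin.castSucc_le_castSucc_iff.2 (Fin.le_last i)),
    Fin.succ_last]

/-- Deleting an old vertex commutes with appending a new one, because both are restrictions along
the same maps to `WithTop`. If the deleted vertex was the last one, its outgoing morphism is
absorbed in the composite with `g`. -/
theorem face_castSucc_snoc {n : ℕ} (z : ComposableArrows D (n + 1)) {X : D}
    (g : z.obj (Fin.last (n + 1)) ⟶ X) (i : Fin (n + 2)) :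
    face i.castSucc (snoc z g) = snoc (face i z) (faceLast i z ≫ g) := by
  have h : (toTop (n + 1)) ∘ i.castSucc.succAbove = WithTop.map i.succAbove ∘ toTop n := by
    funext j
    rw [Function.comp_apply, Function.comp_apply]
    induction j using Fin.lastCases with
    | last => rw [toTop_last, WithTop.map_top, succAbove_castSucc_last, toTop_last]
    | cast j =>
      rw [toTop_castSucc, WithTop.map_coe, Fin.castSucc_succAbove_castSucc, toTop_castSucc]
  have hm : Monotone (WithTop.map i.succAbove : WithTop (Fin (n + 1)) → _) :=
    (Fin.strictMono_succAbove i).monotone.withTop_map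
  have hF : hm.functor ⋙ functorTop z g = functorTop (face i z) (faceLast i z ≫ g) := by
    refine CategoryTheory.Functor.hext (fun a => by cases a <;> rfl) fun a b f => ?_
    cases b with
    | top =>
      cases a with
      | top => exact HEq.rfl
      | coe i =>
        refine heq_of_eq ?_
        exact (congrArg (· ≫ g) (z.map_comp _ _)).trans (Category.assoc _ _ _)
    | coe j =>
      cases a with
      | top => exact absurd (leOfHom f) (WithTop.not_top_le_coe j)
      | coe i => exact HEq.rfl
  refine (congrArg (· ⋙ functorTop z g) (monotone_functor_congr
    ((toTop (n + 1)).monotone.comp (Fin.strictMono_succAbove _).monotone)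
    (hm.comp (toTop n).monotone) h)).trans ?_
  exact congrArg ((toTop n).monotone.functor ⋙ ·) hF

theorem map_eq_eqToHom {n : ℕ} (w : ComposableArrows D n) {i j : Fin (n + 1)} (h : i = j)
    (f : i ⟶ j) : w.map f = eqToHom (congrArg w.obj h) := by
  subst h
  exact w.map_id _

/-- The source and target of this morphism are those of `g` only up to propositional equality, hence
`HEq`; `snoc_ind` is there to avoid handling it again. -/
theorem faceLast_last_snoc {n : ℕ} (z : ComposableArrows D n) {X : D}
    (g : z.obj (Fin.last n) ⟶ X) : HEq (faceLast (Fin.last (n + 1)) (snoc z g)) g := by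
  have key : ∀ (a b : WithTop (Fin (n + 1))) (h : a ≤ b), a = (Fin.last n : Fin (n + 1)) → b = ⊤ →
      HEq (mapTop z g h) g := by
    rintro _ _ h rfl rfl
    refine heq_of_eq ?_
    change z.map _ ≫ g = g
    rw [map_eq_eqToHom z rfl, eqToHom_refl, Category.id_comp]
  refine key _ _ _ ?_ toTop_last
  change toTop n ((Fin.last (n + 1)).succAbove (Fin.last n)) = _
  rw [Fin.succAbove_last_apply, toTop_castSucc]

/-- Statements about `snoc z g` can be proved for all simplices with their last morphism. -/
theorem snoc_ind {n : ℕ} {Q : ∀ (z : ComposableArrows D n) (X : D) (_ : z.obj (Fin.last n) ⟶ X)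
    (w : ComposableArrows D (n + 1)), w.obj (Fin.last (n + 1)) = X → Prop}
    (h : ∀ w, Q (face (Fin.last (n + 1)) w) _ (faceLast (Fin.last (n + 1)) w) w rfl)
    (z : ComposableArrows D n) (X : D) (g : z.obj (Fin.last n) ⟶ X) :
    Q z X g (snoc z g) (snoc_last z g) := by
  have key : ∀ (w : ComposableArrows D (n + 1)) (z : ComposableArrows D n) (X : D)
      (g : z.obj (Fin.last n) ⟶ X) (_ : face (Fin.last (n + 1)) w = z)
      (hX : w.obj (Fin.last (n + 1)) = X) (_ : HEq (faceLast (Fin.last (n + 1)) w) g),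
      Q z X g w hX := by
    rintro w _ _ g rfl rfl hg
    obtain rfl := eq_of_heq hg
    exact h w
  exact key _ z X g (face_last_snoc z g) (snoc_last z g) (faceLast_last_snoc z g)

end OverSimplices

end FatGraph

namespace FatGraph

section OverChains

variable {C D : Type u} [Category.{u} C] [Category.{u} D]

/-! ### Chains of simplices over an object -/

/-- A simplex of the nerve of `D` with a morphism from its last object to `Γ`. -/
abbrev OverSimplex (J : D ⥤ C) (Γ : C) (n : ℕ) : Type u :=
  Σ z : ComposableArrows D n, (J.obj (z.obj (Fin.last n)) ⟶ Γ)

theorem OverSimplex.ext {J : D ⥤ C} {Γ : C} {n : ℕ} {p q : OverSimplex J Γ n} (h : p.1 = q.1)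
    (h' : J.map (eqToHom (congrArg (fun z : ComposableArrows D n => z.obj (Fin.last n)) h)) ≫ q.2 =
      p.2) : p = q := by
  obtain ⟨z, f⟩ := p
  obtain ⟨z', f'⟩ := q
  obtain rfl : z = z' := h
  rw [eqToHom_refl, J.map_id, Category.id_comp] at h'
  exact Sigma.ext rfl (heq_of_eq h'.symm)

theorem map_homOfLE_comp (J : D ⥤ C) {Γ : C} {n : ℕ} (z : ComposableArrows D n)
    {i j l : Fin (n + 1)} (hij : i ≤ j) (hjl : j ≤ l) (f : J.obj (z.obj l) ⟶ Γ) :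
    J.map (z.map (homOfLE (hij.trans hjl))) ≫ f =
      J.map (z.map (homOfLE hij)) ≫ J.map (z.map (homOfLE hjl)) ≫ f := by
  rw [← homOfLE_comp hij hjl, z.map_comp, J.map_comp, Category.assoc]

/-- The simplicial set of simplices over `Γ`. -/
def overNerve (J : D ⥤ C) (Γ : C) : SimplicialObject (Type u) where
  obj n := OverSimplex J Γ n.unop.len
  map α := ↾fun p => ⟨(nerve D).map α p.1, J.map (p.1.map (homOfLE (Fin.le_last _))) ≫ p.2⟩
  map_id n := by
    refine ConcreteCategory.hom_ext _ _ fun p => ?_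
    refine congrArg (fun t => (⟨p.1, t⟩ : OverSimplex J Γ n.unop.len)) ?_
    refine (congrArg (fun t => J.map t ≫ p.2) (p.1.map_id _)).trans ?_
    exact (congrArg (· ≫ p.2) (J.map_id _)).trans (Category.id_comp _)
  map_comp {l m n} α β := by
    refine ConcreteCategory.hom_ext _ _ fun p => ?_
    refine congrArg (fun t => (⟨(nerve D).map (α ≫ β) p.1, t⟩ : OverSimplex J Γ n.unop.len)) ?_
    exact map_homOfLE_comp J p.1 (α.unop.toOrderHom.monotone (Fin.le_last _)) (Fin.le_last _) p.2

variable (J : D ⥤ C)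

/-- The `i`-th face of a simplex over `Γ`. -/
def overFace {Γ : C} {n : ℕ} (i : Fin (n + 2)) (p : OverSimplex J Γ (n + 1)) :
    OverSimplex J Γ n :=
  ⟨face i p.1, J.map (faceLast i p.1) ≫ p.2⟩

/-- The rational chains of simplices over `Γ`. -/
abbrev OverChains (Γ : C) (n : ℕ) : Type u := OverSimplex J Γ n →₀ ℚ

namespace OverChains

/-- A simplex as a chain. -/
def of {Γ : C} {n : ℕ} (p : OverSimplex J Γ n) : OverChains J Γ n := Finsupp.single p 1

variable {J}

theorem hom_ext {Γ : C} {n : ℕ} {M : Type*} [AddCommGroup M] [Module ℚ M]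
    {f g : OverChains J Γ n →ₗ[ℚ] M} (h : ∀ p, f (of J p) = g (of J p)) : f = g :=
  Finsupp.lhom_ext' fun p => LinearMap.ext_ring (h p)

/-- The linear map with prescribed values on simplices. -/
def lift {Γ : C} {n : ℕ} {M : Type*} [AddCommGroup M] [Module ℚ M] (f : OverSimplex J Γ n → M) :
    OverChains J Γ n →ₗ[ℚ] M := Finsupp.linearCombination ℚ f

@[simp] theorem lift_of {Γ : C} {n : ℕ} {M : Type*} [AddCommGroup M] [Module ℚ M]
    (f : OverSimplex J Γ n → M) (p : OverSimplex J Γ n) : lift f (of J p) = f p := by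
  simp [lift, of]

/-- The boundary map. -/
def bdry (Γ : C) (n : ℕ) : OverChains J Γ (n + 1) →ₗ[ℚ] OverChains J Γ n :=
  lift fun p => ∑ i : Fin (n + 2), (-1 : ℚ) ^ (i : ℕ) • of J (overFace J i p)

theorem bdry_of {Γ : C} {n : ℕ} (p : OverSimplex J Γ (n + 1)) :
    bdry Γ n (of J p) = ∑ i : Fin (n + 2), (-1 : ℚ) ^ (i : ℕ) • of J (overFace J i p) :=
  lift_of _ _

/-- The free rational vector space functor. -/
def freeQ : Type u ⥤ ModuleCat.{u} ℚ where
  obj X := ModuleCat.of ℚ (X →₀ ℚ)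
  map f := ModuleCat.ofHom (Finsupp.lmapDomain ℚ ℚ f)

/-- The operator is the alternating sum of the faces of the simplicial vector space on `overNerve`,
for which the square is known to vanish. -/
theorem bdry_bdry {Γ : C} {n : ℕ} (w : OverChains J Γ (n + 2)) :
    bdry Γ n (bdry Γ (n + 1) w) = 0 := by
  let X := ((SimplicialObject.whiskering (Type u) (ModuleCat.{u} ℚ)).obj freeQ).obj (overNerve J Γ)
  have hX : ∀ m : ℕ, (AlgebraicTopology.AlternatingFaceMapComplex.objD X m).hom =
      bdry (J := J) Γ m := by
    intro m
    have hv : ∀ v, (AlgebraicTopology.AlternatingFaceMapComplex.objD X m).hom v =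
        ∑ i : Fin (m + 2), (-1 : ℚ) ^ (i : ℕ) • (X.δ i).hom v := by
      intro v
      rw [AlgebraicTopology.AlternatingFaceMapComplex.objD, ModuleCat.hom_sum,
        LinearMap.sum_apply]
      refine Finset.sum_congr rfl fun i _ => ?_
      rw [ModuleCat.hom_zsmul, LinearMap.smul_apply, ← Int.cast_smul_eq_zsmul ℚ, Int.cast_pow,
        Int.cast_neg, Int.cast_one]
    refine hom_ext (n := m + 1) fun p => (hv _).trans (Eq.trans ?_ (bdry_of (n := m) p).symm)
    exact Finset.sum_congr rfl fun i _ => congrArg _ Finsupp.mapDomain_single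
  have h := AlgebraicTopology.AlternatingFaceMapComplex.d_squared X n
  have h' := LinearMap.congr_fun (congrArg ModuleCat.Hom.hom h) w
  rw [ModuleCat.hom_comp, hX, hX] at h'
  exact h'

/-- Composition with a morphism of the base. -/
def push {Γ Γ' : C} (f : Γ ⟶ Γ') (n : ℕ) : OverChains J Γ n →ₗ[ℚ] OverChains J Γ' n :=
  lift fun p => of J ⟨p.1, p.2 ≫ f⟩

theorem push_of {Γ Γ' : C} (f : Γ ⟶ Γ') {n : ℕ} (p : OverSimplex J Γ n) :
    push f n (of J p) = of J ⟨p.1, p.2 ≫ f⟩ := lift_of _ _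

theorem push_push {Γ Γ' Γ'' : C} (f : Γ ⟶ Γ') (g : Γ' ⟶ Γ'') {n : ℕ} (w : OverChains J Γ n) :
    push g n (push f n w) = push (f ≫ g) n w := by
  have : push g n ∘ₗ push f n = push (J := J) (f ≫ g) n := hom_ext fun p => by
    simp only [LinearMap.comp_apply, push_of, Category.assoc]
  exact LinearMap.congr_fun this w

theorem push_id {Γ : C} {n : ℕ} (w : OverChains J Γ n) : push (𝟙 Γ) n w = w := by
  have : push (J := J) (𝟙 Γ) n = LinearMap.id := hom_ext fun p => by
    rw [push_of, Category.comp_id]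
    rfl
  exact LinearMap.congr_fun this w

theorem bdry_push {Γ Γ' : C} (f : Γ ⟶ Γ') {n : ℕ} (w : OverChains J Γ (n + 1)) :
    bdry Γ' n (push f (n + 1) w) = push f n (bdry Γ n w) := by
  have : bdry Γ' n ∘ₗ push f (n + 1) = push (J := J) f n ∘ₗ bdry Γ n := hom_ext fun p => by
    simp only [LinearMap.comp_apply, push_of, bdry_of, map_sum, map_smul, overFace,
      Category.assoc]
  exact LinearMap.congr_fun this w

/-- The augmentation. -/
def aug (Γ : C) : OverChains J Γ 0 →ₗ[ℚ] ℚ := lift fun _ => 1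

theorem aug_of {Γ : C} (p : OverSimplex J Γ 0) : aug Γ (of J p) = 1 := lift_of _ _

theorem aug_push {Γ Γ' : C} (f : Γ ⟶ Γ') (w : OverChains J Γ 0) :
    aug Γ' (push f 0 w) = aug Γ w := by
  have : aug Γ' ∘ₗ push f 0 = aug (J := J) Γ := hom_ext fun p => by
    simp only [LinearMap.comp_apply, push_of, aug_of]
  exact LinearMap.congr_fun this w

/-! ### The cone -/

/-- The simplex over `Γ` obtained by appending a morphism. -/
def snocOver {Γ : C} {n : ℕ} (z : ComposableArrows D n) {X : D} (g : z.obj (Fin.last n) ⟶ X)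
    (k : J.obj X ⟶ Γ) : OverSimplex J Γ (n + 1) :=
  ⟨snoc z g, J.map (eqToHom (snoc_last z g)) ≫ k⟩

theorem overFace_last_snocOver {Γ : C} {n : ℕ} (z : ComposableArrows D n) {X : D}
    (g : z.obj (Fin.last n) ⟶ X) (k : J.obj X ⟶ Γ) :
    overFace J (Fin.last (n + 1)) (snocOver z g k) = ⟨z, J.map g ≫ k⟩ := by
  refine snoc_ind (Q := fun z X g w h => ∀ k : J.obj X ⟶ Γ,
    overFace J (Fin.last (n + 1)) (⟨w, J.map (eqToHom h) ≫ k⟩ : OverSimplex J Γ (n + 1)) =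
      ⟨z, J.map g ≫ k⟩) (fun w k => ?_) z X g k
  rw [eqToHom_refl, J.map_id, Category.id_comp]
  rfl

theorem map_eqToHom_comp {a b c : D} {Γ : C} (h : a = b) (h' : b = c) (k : J.obj c ⟶ Γ) :
    J.map (eqToHom h) ≫ J.map (eqToHom h') ≫ k = J.map (eqToHom (h.trans h')) ≫ k := by
  subst h h'
  simp

theorem overFace_castSucc_snocOver {Γ : C} {n : ℕ} (z : ComposableArrows D (n + 1)) {X : D}
    (g : z.obj (Fin.last (n + 1)) ⟶ X) (k : J.obj X ⟶ Γ) (i : Fin (n + 2)) :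
    overFace J i.castSucc (snocOver z g k) = snocOver (face i z) (faceLast i z ≫ g) k := by
  refine OverSimplex.ext (face_castSucc_snoc z g i) ?_
  refine Eq.trans ?_ (congrArg (fun t => J.map t ≫ J.map (eqToHom (snoc_last z g)) ≫ k)
    (map_eq_eqToHom (snoc z g) (succAbove_castSucc_last i)
      (homOfLE (Fin.le_last (i.castSucc.succAbove (Fin.last (n + 1))))))).symm
  exact (map_eqToHom_comp _ _ _).trans (map_eqToHom_comp _ _ _).symm

/-- The zero-simplex over `Γ` given by a morphism. -/
def point {Γ : C} (X : D) (k : J.obj X ⟶ Γ) : OverSimplex J Γ 0 := ⟨ComposableArrows.mk₀ X, k⟩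

theorem overFace_zero_snocOver {Γ : C} (z : ComposableArrows D 0) {X : D}
    (g : z.obj (Fin.last 0) ⟶ X) (k : J.obj X ⟶ Γ) :
    overFace J 0 (snocOver z g k) = point X k := by
  have h : ∀ w : ComposableArrows D 0, w = ComposableArrows.mk₀ (w.obj (Fin.last 0)) := fun w =>
    ComposableArrows.ext₀ rfl
  refine snoc_ind (n := 0) (Q := fun z X g w h => ∀ k : J.obj X ⟶ Γ,
    overFace J 0 (⟨w, J.map (eqToHom h) ≫ k⟩ : OverSimplex J Γ 1) = point X k)
    (fun w k => ?_) z X g k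
  refine OverSimplex.ext (h _) ?_
  rw [eqToHom_refl, J.map_id, Category.id_comp]
  refine congrArg (fun t => J.map t ≫ k) ?_
  exact (map_eq_eqToHom w rfl _).symm

variable [J.Full]

/-- The cone on a simplex over an object isomorphic to `J X`. -/
def cone {Γ : C} {X : D} (k : J.obj X ≅ Γ) (n : ℕ) :
    OverChains J Γ n →ₗ[ℚ] OverChains J Γ (n + 1) :=
  lift fun p => of J (snocOver p.1 (J.preimage (p.2 ≫ k.inv)) k.hom)

theorem cone_of {Γ : C} {X : D} (k : J.obj X ≅ Γ) {n : ℕ} (p : OverSimplex J Γ n) :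
    cone k n (of J p) = of J (snocOver p.1 (J.preimage (p.2 ≫ k.inv)) k.hom) := lift_of _ _

/-- The appended vertex is the last one, so face `0` is the apex and face `1`, with sign `-1`, is
the original simplex. -/
theorem bdry_cone_zero {Γ : C} {X : D} (k : J.obj X ≅ Γ) (w : OverChains J Γ 0) :
    bdry Γ 0 (cone k 0 w) = aug Γ w • of J (point X k.hom) - w := by
  have : bdry Γ 0 ∘ₗ cone k 0 =
      (aug Γ).smulRight (of J (point X k.hom)) - LinearMap.id := hom_ext fun p => by
    rw [LinearMap.comp_apply, cone_of, bdry_of, Fin.sum_univ_two]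
    have h1 : overFace J 1 (snocOver p.1 (J.preimage (p.2 ≫ k.inv)) k.hom) = p := by
      refine (overFace_last_snocOver _ _ _).trans ?_
      rw [J.map_preimage, Category.assoc, k.inv_hom_id, Category.comp_id]
    rw [overFace_zero_snocOver, h1]
    simp [aug_of, sub_eq_add_neg]
  exact LinearMap.congr_fun this w

/-- The last face of the cone is the simplex itself, with sign `(-1)^{n+2} = (-1)^n`; the other
faces are the cones on the faces. -/
theorem bdry_cone_succ [J.Faithful] {Γ : C} {X : D} (k : J.obj X ≅ Γ) {n : ℕ} (w : OverChains J Γ (n + 1)) :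
    bdry Γ (n + 1) (cone k (n + 1) w) = cone k n (bdry Γ n w) + (-1 : ℚ) ^ n • w := by
  have : bdry Γ (n + 1) ∘ₗ cone k (n + 1) = cone k n ∘ₗ bdry Γ n + (-1 : ℚ) ^ n • LinearMap.id :=
      hom_ext fun p => by
    rw [LinearMap.comp_apply, cone_of, bdry_of, Fin.sum_univ_castSucc]
    have h1 : overFace J (Fin.last (n + 2)) (snocOver p.1 (J.preimage (p.2 ≫ k.inv)) k.hom) =
        p := by
      refine (overFace_last_snocOver _ _ _).trans ?_
      rw [J.map_preimage, Category.assoc, k.inv_hom_id, Category.comp_id]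
    rw [h1, LinearMap.add_apply, LinearMap.comp_apply, bdry_of, map_sum]
    congr 1
    · refine Finset.sum_congr rfl fun i _ => ?_
      rw [map_smul, cone_of, overFace_castSucc_snocOver]
      refine congrArg (fun t => (-1 : ℚ) ^ (i : ℕ) • of J (snocOver (face i p.1) t k.hom)) ?_
      refine J.map_injective ?_
      rw [J.map_comp, J.map_preimage]
      exact ((J.map_preimage _).trans (Category.assoc _ _ _)).symm
    · rw [Fin.val_last, pow_add]
      simp
  exact LinearMap.congr_fun this w

end OverChains

end OverChains

end FatGraph

namespace FatGraph

/-! ### Rationalization -/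

section Rat

variable {K L : ChainComplex (ModuleCat.{u} ℤ) ℕ}

theorem toRat_add {n : ℕ} (c c' : K.X n) : toRat K (c + c') = toRat K c + toRat K c' :=
  TensorProduct.tmul_add _ _ _

theorem toRat_zero {n : ℕ} : toRat K (0 : K.X n) = 0 := TensorProduct.tmul_zero _ _

/-- The map to the rationalization as a homomorphism. -/
def toRatHom (K : ChainComplex (ModuleCat.{u} ℤ) ℕ) (n : ℕ) : K.X n →+ (rat.obj K).X n where
  toFun c := toRat K c
  map_zero' := toRat_zero
  map_add' := toRat_add

theorem rat_hom_ext {n : ℕ} {M : Type u} [AddCommGroup M] [Module ℚ M]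
    {f g : (rat.obj K).X n →ₗ[ℚ] M} (h : ∀ c, f (toRat K c) = g (toRat K c)) : f = g := by
  have : (ModuleCat.ofHom f : (rat.obj K).X n ⟶ ModuleCat.of ℚ M) = ModuleCat.ofHom g :=
    ModuleCat.ExtendScalars.hom_ext fun c => h c
  exact congrArg ModuleCat.Hom.hom this

/-- The extension of a homomorphism to the rationalization. -/
def ratLift {n : ℕ} {M : Type u} [AddCommGroup M] [Module ℚ M] (f : K.X n →+ M) :
    (rat.obj K).X n →ₗ[ℚ] M :=
  (ModuleCat.ExtendRestrictScalarsAdj.HomEquiv.fromExtendScalars (Int.castRingHom ℚ)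
    (X := K.X n) (Y := ModuleCat.of ℚ M) (ModuleCat.ofHom
      (Y := (ModuleCat.restrictScalars (Int.castRingHom ℚ)).obj (ModuleCat.of ℚ M))
      { toFun := f
        map_add' := f.map_add
        map_smul' := fun m c => map_intCast_smul f ℤ ℚ m c })).hom

theorem ratLift_toRat {n : ℕ} {M : Type u} [AddCommGroup M] [Module ℚ M] (f : K.X n →+ M)
    (c : K.X n) : ratLift f (toRat K c) = f c :=
  one_smul ℚ (f c)

theorem rat_map_toRat (φ : K ⟶ L) {n : ℕ} (c : K.X n) :
    ((rat.map φ).f n).hom (toRat K c) = toRat L ((φ.f n).hom c) := rfl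

theorem rat_d_toRat {i j : ℕ} (c : K.X i) :
    ((rat.obj K).d i j).hom (toRat K c) = toRat K ((K.d i j).hom c) := rfl

end Rat

/-! ### Rational chains of the nerve -/

section Nerve

variable {C D : Type u} [Category.{u} C] [Category.{u} D]

theorem nerveChains_d {n : ℕ} (x : ComposableArrows C (n + 1)) :
    ((nerveChains C).d (n + 1) n).hom (simplex x) =
      ∑ i : Fin (n + 2), (-1 : ℤ) ^ (i : ℕ) • simplex (face i x) := by
  let X := ((SimplicialObject.whiskering (Type u) (ModuleCat.{u} ℤ)).obj freeZ).obj (nerve C)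
  have hv : ∀ v, (AlgebraicTopology.AlternatingFaceMapComplex.objD X n).hom v =
      ∑ i : Fin (n + 2), (-1 : ℤ) ^ (i : ℕ) • (X.δ i).hom v := by
    intro v
    rw [AlgebraicTopology.AlternatingFaceMapComplex.objD, ModuleCat.hom_sum,
      LinearMap.sum_apply]
    rfl
  have hd : (nerveChains C).d (n + 1) n = AlgebraicTopology.AlternatingFaceMapComplex.objD X n :=
    AlgebraicTopology.AlternatingFaceMapComplex.obj_d_eq X n
  rw [hd]
  exact (hv _).trans (Finset.sum_congr rfl fun i _ => congrArg _ Finsupp.mapDomain_single)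

theorem nerveChainsMap_simplex (G : C ⥤ D) {n : ℕ} (x : ComposableArrows C n) :
    ((nerveChainsMap G).f n).hom (simplex x) = simplex (x ⋙ G) :=
  Finsupp.mapDomain_single

/-- The linear map on rational chains with prescribed values on simplices. -/
def nerveLift {n : ℕ} {M : Type u} [AddCommGroup M] [Module ℚ M] (F : ComposableArrows C n → M) :
    (rat.obj (nerveChains C)).X n →ₗ[ℚ] M :=
  ratLift (K := nerveChains C)
    (Finsupp.liftAddHom fun x => zmultiplesHom M (F x) : (ComposableArrows C n →₀ ℤ) →+ M)

theorem nerveLift_simplex {n : ℕ} {M : Type u} [AddCommGroup M] [Module ℚ M]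
    (F : ComposableArrows C n → M) (x : ComposableArrows C n) :
    nerveLift F (toRat _ (simplex x)) = F x := by
  refine (ratLift_toRat _ _).trans ?_
  refine (Finsupp.liftAddHom_apply_single _ _ _).trans ?_
  simp

/-- Rational chains are spanned over `ℚ` by the integral ones, and these are spanned by the
simplices. -/
theorem nerve_hom_ext {n : ℕ} {M : Type u} [AddCommGroup M] [Module ℚ M]
    {f g : (rat.obj (nerveChains C)).X n →ₗ[ℚ] M}
    (h : ∀ x : ComposableArrows C n, f (toRat _ (simplex x)) = g (toRat _ (simplex x))) :
    f = g := by
  refine rat_hom_ext fun c => ?_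
  have : (f.toAddMonoidHom.comp (toRatHom (nerveChains C) n) : (ComposableArrows C n →₀ ℤ) →+ M) =
      g.toAddMonoidHom.comp (toRatHom (nerveChains C) n) := by
    refine Finsupp.addHom_ext' fun x => AddMonoidHom.ext_int ?_
    exact h x
  exact DFunLike.congr_fun this c

theorem rat_nerveChains_d {n : ℕ} (x : ComposableArrows C (n + 1)) :
    ((rat.obj (nerveChains C)).d (n + 1) n).hom (toRat _ (simplex x)) =
      ∑ i : Fin (n + 2), (-1 : ℚ) ^ (i : ℕ) • toRat _ (simplex (face i x)) := by
  rw [rat_d_toRat, nerveChains_d]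
  refine (map_sum (toRatHom (nerveChains C) n) _ _).trans (Finset.sum_congr rfl fun i _ => ?_)
  refine (map_intCast_smul (toRatHom (nerveChains C) n) ℤ ℚ ((-1) ^ (i : ℕ)) _).trans ?_
  rw [Int.cast_pow, Int.cast_neg, Int.cast_one]
  rfl

namespace OverChains

variable {J : D ⥤ C}

/-- The map which forgets the morphisms to `Γ`. -/
def forget (Γ : C) (n : ℕ) : OverChains J Γ n →ₗ[ℚ] (rat.obj (nerveChains D)).X n :=
  lift fun p => toRat _ (simplex p.1)

theorem forget_of {Γ : C} {n : ℕ} (p : OverSimplex J Γ n) :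
    forget Γ n (of J p) = toRat _ (simplex p.1) := lift_of _ _

theorem forget_push {Γ Γ' : C} (f : Γ ⟶ Γ') {n : ℕ} (w : OverChains J Γ n) :
    forget Γ' n (push f n w) = forget Γ n w := by
  have : forget Γ' n ∘ₗ push f n = forget (J := J) Γ n := hom_ext fun p => by
    rw [LinearMap.comp_apply, push_of, forget_of, forget_of]
  exact LinearMap.congr_fun this w

theorem d_forget {Γ : C} {n : ℕ} (w : OverChains J Γ (n + 1)) :
    ((rat.obj (nerveChains D)).d (n + 1) n).hom (forget Γ (n + 1) w) = forget Γ n (bdry Γ n w) := by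
  have : ((rat.obj (nerveChains D)).d (n + 1) n).hom ∘ₗ forget Γ (n + 1) =
      forget (J := J) Γ n ∘ₗ bdry Γ n := hom_ext fun p => by
    rw [LinearMap.comp_apply, LinearMap.comp_apply, bdry_of, forget_of, map_sum,
      rat_nerveChains_d]
    exact Finset.sum_congr rfl fun i _ => by rw [map_smul, forget_of]; rfl
  exact LinearMap.congr_fun this w

/-! ### Families of chains compatible with the boundary maps -/

/-- The simplex over its last object. -/
def diag (J : D ⥤ C) {n : ℕ} (x : ComposableArrows D n) :
    OverChains J (J.obj (x.obj (Fin.last n))) n := of J ⟨x, 𝟙 _⟩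

theorem push_diag {Γ : C} {n : ℕ} (x : ComposableArrows D n)
    (f : J.obj (x.obj (Fin.last n)) ⟶ Γ) : push f n (diag J x) = of J ⟨x, f⟩ := by
  rw [diag, push_of, Category.id_comp]

theorem bdry_diag {n : ℕ} (x : ComposableArrows D (n + 1)) :
    bdry _ n (diag J x) = ∑ i : Fin (n + 2), (-1 : ℚ) ^ (i : ℕ) •
      push (J.map (faceLast i x)) n (diag J (face i x)) := by
  rw [diag, bdry_of]
  refine Finset.sum_congr rfl fun i _ => congrArg _ ?_
  rw [push_diag]
  exact congrArg (fun t => of J ⟨face i x, t⟩) (Category.comp_id _)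

/-- The extension of a family of chains by naturality. -/
def extend {m n : ℕ} (A : ∀ x : ComposableArrows D n,
    OverChains J (J.obj (x.obj (Fin.last n))) m) (Γ : C) :
    OverChains J Γ n →ₗ[ℚ] OverChains J Γ m :=
  lift fun p => push p.2 m (A p.1)

theorem extend_of {m n : ℕ} (A : ∀ x : ComposableArrows D n,
    OverChains J (J.obj (x.obj (Fin.last n))) m) {Γ : C} (p : OverSimplex J Γ n) :
    extend A Γ (of J p) = push p.2 m (A p.1) := lift_of _ _

theorem extend_bdry_diag {m n : ℕ} (A : ∀ x : ComposableArrows D n,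
    OverChains J (J.obj (x.obj (Fin.last n))) m) (x : ComposableArrows D (n + 1)) :
    extend A _ (bdry _ n (diag J x)) =
      ∑ i : Fin (n + 2), (-1 : ℚ) ^ (i : ℕ) • push (J.map (faceLast i x)) m (A (face i x)) := by
  rw [bdry_diag, map_sum]
  refine Finset.sum_congr rfl fun i _ => ?_
  rw [map_smul, push_diag, extend_of]

theorem extend_push {m n : ℕ} (A : ∀ x : ComposableArrows D n,
    OverChains J (J.obj (x.obj (Fin.last n))) m) {Γ Γ' : C} (f : Γ ⟶ Γ') (w : OverChains J Γ n) :
    extend A Γ' (push f n w) = push f m (extend A Γ w) := by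
  have : extend A Γ' ∘ₗ push f n = push f m ∘ₗ extend A Γ := hom_ext fun p => by
    rw [LinearMap.comp_apply, LinearMap.comp_apply, push_of, extend_of, extend_of, push_push]
  exact LinearMap.congr_fun this w

variable [J.Full]

/-- The homotopy between a compatible family and the identity. -/
def homotopyOf (A : ∀ (n : ℕ) (x : ComposableArrows D n),
    OverChains J (J.obj (x.obj (Fin.last n))) n) :
    ∀ (n : ℕ) (x : ComposableArrows D n), OverChains J (J.obj (x.obj (Fin.last n))) (n + 1)
  -- The signs in both cases cancel those in the boundary of a cone. The apex is the last object of
  -- the simplex, hence `Iso.refl`.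
  | 0, x => -cone (Iso.refl _) 0 (A 0 x - diag J x)
  | n + 1, x => (-1 : ℚ) ^ n • cone (Iso.refl _) (n + 1) (A (n + 1) x - diag J x -
      extend (homotopyOf A n) _ (bdry _ n (diag J x)))

section

variable {A : ∀ (n : ℕ) (x : ComposableArrows D n), OverChains J (J.obj (x.obj (Fin.last n))) n}

theorem bdry_homotopyOf_zero (hA : ∀ x, aug _ (A 0 x) = 1) (x : ComposableArrows D 0) :
    bdry _ 0 (homotopyOf A 0 x) = A 0 x - diag J x := by
  rw [homotopyOf, map_neg, bdry_cone_zero, map_sub, hA, diag, aug_of, sub_self, zero_smul,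
    zero_sub, neg_neg]

theorem bdry_extend_homotopyOf_zero (hA : ∀ x, aug _ (A 0 x) = 1) {Γ : C}
    (w : OverChains J Γ 0) :
    bdry Γ 0 (extend (homotopyOf A 0) Γ w) = extend (A 0) Γ w - w := by
  have : bdry Γ 0 ∘ₗ extend (homotopyOf A 0) Γ = extend (A 0) Γ - LinearMap.id :=
    hom_ext fun p => by
      rw [LinearMap.comp_apply, extend_of, bdry_push, bdry_homotopyOf_zero hA, map_sub,
        LinearMap.sub_apply, extend_of, push_diag]
      rfl
  exact LinearMap.congr_fun this w

theorem bdry_extend_homotopyOf_of {n : ℕ}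
    (h : ∀ x : ComposableArrows D (n + 1), bdry _ (n + 1) (homotopyOf A (n + 1) x) =
      A (n + 1) x - diag J x - extend (homotopyOf A n) _ (bdry _ n (diag J x)))
    {Γ : C} (w : OverChains J Γ (n + 1)) :
    bdry Γ (n + 1) (extend (homotopyOf A (n + 1)) Γ w) =
      extend (A (n + 1)) Γ w - w - extend (homotopyOf A n) Γ (bdry Γ n w) := by
  have : bdry Γ (n + 1) ∘ₗ extend (homotopyOf A (n + 1)) Γ =
      extend (A (n + 1)) Γ - LinearMap.id - extend (homotopyOf A n) Γ ∘ₗ bdry Γ n :=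
    hom_ext fun p => by
      rw [LinearMap.comp_apply, extend_of, bdry_push, h, map_sub, map_sub, LinearMap.sub_apply,
        LinearMap.sub_apply, extend_of, push_diag, ← extend_push, ← bdry_push, push_diag]
      rfl
  exact LinearMap.congr_fun this w

/-- The acyclic carrier argument: by the previous step the chain that has to be bounded is a cycle,
and the cone on a cycle bounds it up to sign. -/
theorem bdry_homotopyOf_succ [J.Faithful] (hA0 : ∀ x, aug _ (A 0 x) = 1)
    (hA : ∀ n x, bdry _ n (A (n + 1) x) = extend (A n) _ (bdry _ n (diag J x)))
    (n : ℕ) (x : ComposableArrows D (n + 1)) :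
    bdry _ (n + 1) (homotopyOf A (n + 1) x) =
      A (n + 1) x - diag J x - extend (homotopyOf A n) _ (bdry _ n (diag J x)) := by
  have key : bdry _ n (A (n + 1) x - diag J x -
      extend (homotopyOf A n) _ (bdry _ n (diag J x))) = 0 := by
    rw [map_sub, map_sub, hA]
    cases n with
    | zero => rw [bdry_extend_homotopyOf_zero hA0, sub_self]
    | succ m =>
      rw [bdry_extend_homotopyOf_of (bdry_homotopyOf_succ hA0 hA m), bdry_bdry, map_zero, sub_zero,
        sub_self]
  rw [homotopyOf, map_smul, bdry_cone_succ, key, map_zero, zero_add, smul_smul, ← mul_pow]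
  simp

end

/-- A chain map which is given by a compatible family of augmented chains is homotopic to the
identity. -/
theorem nonempty_homotopy [J.Faithful]
    (A : ∀ (n : ℕ) (x : ComposableArrows D n), OverChains J (J.obj (x.obj (Fin.last n))) n)
    (hA0 : ∀ x, aug _ (A 0 x) = 1)
    (hA : ∀ n x, bdry _ n (A (n + 1) x) =
      ∑ i : Fin (n + 2), (-1 : ℚ) ^ (i : ℕ) • push (J.map (faceLast i x)) n (A n (face i x)))
    (F : rat.obj (nerveChains D) ⟶ rat.obj (nerveChains D))
    (hF : ∀ n x, (F.f n).hom (toRat _ (simplex x)) = forget _ n (A n x)) :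
    Nonempty (Homotopy F (𝟙 _)) := by
  simp only [← extend_bdry_diag] at hA
  let H : ∀ n, (rat.obj (nerveChains D)).X n ⟶ (rat.obj (nerveChains D)).X (n + 1) := fun n =>
    ModuleCat.ofHom (X := (rat.obj (nerveChains D)).X n) (Y := (rat.obj (nerveChains D)).X (n + 1))
      (nerveLift fun x => forget _ (n + 1) (homotopyOf A n x))
  have hH : ∀ n x, (H n).hom (toRat _ (simplex x)) = forget _ (n + 1) (homotopyOf A n x) :=
    fun n x => nerveLift_simplex (M := (rat.obj (nerveChains D)).X (n + 1))
      (fun x => forget _ (n + 1) (homotopyOf A n x)) x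
  have hH' : ∀ (n : ℕ) {Γ : C} (w : OverChains J Γ n),
      (H n).hom (forget Γ n w) = forget Γ (n + 1) (extend (homotopyOf A n) Γ w) := by
    intro n Γ w
    have : (H n).hom ∘ₗ forget Γ n = forget Γ (n + 1) ∘ₗ extend (homotopyOf A n) Γ :=
      hom_ext fun p => by
        rw [LinearMap.comp_apply, LinearMap.comp_apply, forget_of, extend_of, forget_push, hH]
    exact LinearMap.congr_fun this w
  have hs : ∀ (n : ℕ) (x : ComposableArrows D n),
      toRat (nerveChains D) (simplex x) = forget _ n (diag J x) := fun n x =>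
    (forget_of (J := J) ⟨x, 𝟙 _⟩).symm
  -- The shape required for null homotopic maps; the `eqToHom` disappears for consecutive degrees.
  let h : ∀ i j, (ComplexShape.down ℕ).Rel j i →
      ((rat.obj (nerveChains D)).X i ⟶ (rat.obj (nerveChains D)).X j) := fun i j hij =>
    H i ≫ eqToHom (congrArg (rat.obj (nerveChains D)).X hij)
  have hsucc : ∀ i, h i (i + 1) rfl = H i := fun i => Category.comp_id _
  have hnull : F - 𝟙 _ = Homotopy.nullHomotopicMap' h := by
    ext n : 1
    cases n with
    | zero =>
      rw [Homotopy.nullHomotopicMap'_f_of_not_rel_left (k₁ := 1) (k₀ := 0) rfl (by simp), hsucc]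
      refine ModuleCat.hom_ext (nerve_hom_ext fun x => ?_)
      have h1 := d_forget (J := J) (homotopyOf A 0 x)
      rw [← hH, bdry_homotopyOf_zero hA0, map_sub, ← hF, ← hs] at h1
      exact h1.symm
    | succ n =>
      rw [Homotopy.nullHomotopicMap'_f (k₂ := n + 2) (k₁ := n + 1) (k₀ := n) rfl rfl, hsucc,
        hsucc]
      refine ModuleCat.hom_ext (nerve_hom_ext fun x => ?_)
      have h1 := d_forget (J := J) (homotopyOf A (n + 1) x)
      rw [← hH, bdry_homotopyOf_succ hA0 hA, map_sub, map_sub, ← hF, ← hH', ← d_forget, ← hs,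
        eq_sub_iff_add_eq] at h1
      exact ((add_comm _ _).trans h1).symm
  exact ⟨(Homotopy.equivSubZero).symm ((Homotopy.ofEq hnull).trans (Homotopy.nullHomotopy' h))⟩

end OverChains

end Nerve

end FatGraph

namespace FatGraph

open RibbonGraph OGraph

variable {Ω : Type u}

/-! ### Orientations induced along a sequence -/

section DualCells

variable {S : ObjectProperty (RibbonGraph Ω)}

/-- The orientation of the last graph which is induced by the natural orientation of the first. -/
def ChainOrn {n : ℕ} (z : ComposableArrows S.FullSubcategory n)
    (o : (z.obj (Fin.last n)).obj.Orientn) : Prop :=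
  ∃ f : ∀ i : Fin (n + 1), (z.obj i).obj.Orientn,
    IsNatural (f 0) ∧
    (∀ i : Fin n, Induces (S.ι.map (z.map (homOfLE i.castSucc_lt_succ.le)))
      (f i.castSucc) (f i.succ)) ∧
    f (Fin.last n) = o

theorem DualSimplex.positive_iff {n : ℕ} {y : OGraph Ω n} (c : DualSimplex S y) :
    c.Positive ↔ ∃ o, ChainOrn c.chain o ∧ PreservesOr c.iso o y.or := by
  constructor
  · rintro ⟨f, h1, h2, h3⟩
    exact ⟨_, ⟨f, h1, h2, rfl⟩, h3⟩
  · rintro ⟨_, ⟨f, h1, h2, rfl⟩, h3⟩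
    exact ⟨f, h1, h2, h3⟩

/-- Orientations along the sequence are orientations along its last face together with one more
induced step. The proof only transports dependent families along `Fin.succAbove`. -/
theorem chainOrn_succ {n : ℕ} (w : ComposableArrows S.FullSubcategory (n + 1))
    (o : (w.obj (Fin.last (n + 1))).obj.Orientn) :
    ChainOrn w o ↔ ∃ o' : ((face (Fin.last (n + 1)) w).obj (Fin.last n)).obj.Orientn,
      ChainOrn (face (Fin.last (n + 1)) w) o' ∧
        Induces (S.ι.map (faceLast (Fin.last (n + 1)) w)) o' o := by
  constructor
  · rintro ⟨f, h1, h2, rfl⟩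
    have hnat : ∀ i, i = 0 → IsNatural (f i) := by
      rintro _ rfl
      exact h1
    have hind : ∀ (i j : Fin (n + 2)) (h : i ≤ j) (a : Fin (n + 1)), i = a.castSucc → j = a.succ →
        Induces (S.ι.map (w.map (homOfLE h))) (f i) (f j) := by
      rintro _ _ h a rfl rfl
      exact h2 a
    refine ⟨f ((Fin.last (n + 1)).succAbove (Fin.last n)),
      ⟨fun i => f ((Fin.last (n + 1)).succAbove i), hnat _ ?_, fun i => ?_, rfl⟩, ?_⟩
    · rw [Fin.succAbove_last_apply, Fin.castSucc_zero]
    · exact hind _ _ _ i.castSucc (Fin.succAbove_last_apply _)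
        ((Fin.succAbove_last_apply i.succ).trans (Fin.succ_castSucc i).symm)
    · exact hind _ _ _ (Fin.last n) (Fin.succAbove_last_apply _) (Fin.succ_last n).symm
  · rintro ⟨_, ⟨f, h1, h2, rfl⟩, h3⟩
    let f' : ∀ i, (w.obj i).obj.Orientn := Fin.insertNth (α := fun i => (w.obj i).obj.Orientn)
      (Fin.last (n + 1)) o f
    have hlast : f' (Fin.last (n + 1)) = o := Fin.insertNth_apply_same _ _ _
    have hsucc : ∀ i, f' ((Fin.last (n + 1)).succAbove i) = f i :=
      Fin.insertNth_apply_succAbove _ _ _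
    have hind : ∀ (i j : Fin (n + 2)) (h : i ≤ j) (a : Fin n),
        i = (Fin.last (n + 1)).succAbove a.castSucc → j = (Fin.last (n + 1)).succAbove a.succ →
        Induces (S.ι.map (w.map (homOfLE h))) (f' i) (f' j) := by
      rintro _ _ h a rfl rfl
      rw [hsucc, hsucc]
      exact h2 a
    have hind' : ∀ (i j : Fin (n + 2)) (h : i ≤ j),
        i = (Fin.last (n + 1)).succAbove (Fin.last n) → j = Fin.last (n + 1) →
        Induces (S.ι.map (w.map (homOfLE h))) (f' i) (f' j) := by
      rintro _ _ h rfl rfl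
      rw [hsucc, hlast]
      exact h3
    refine ⟨f', ?_, fun i => ?_, hlast⟩
    · have : ∀ i, i = (Fin.last (n + 1)).succAbove 0 → IsNatural (f' i) := by
        rintro _ rfl
        rw [hsucc]
        exact h1
      exact this _ (by rw [Fin.succAbove_last_apply, Fin.castSucc_zero])
    · induction i using Fin.lastCases with
      | last =>
        refine hind' _ _ _ ?_ ?_
        · rw [Fin.succAbove_last_apply]
        · rw [Fin.succ_last]
      | cast a =>
        refine hind _ _ _ a ?_ ?_
        · rw [Fin.succAbove_last_apply]
        · rw [Fin.succAbove_last_apply, Fin.succ_castSucc]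

/-- The `i`-th graph of the sequence has codimension `i`. -/
def Graded {n : ℕ} (z : ComposableArrows S.FullSubcategory n) : Prop :=
  ∀ i, (z.obj i).obj.codim = i

theorem Graded.face_last {n : ℕ} {w : ComposableArrows S.FullSubcategory (n + 1)} (h : Graded w) :
    Graded (face (Fin.last (n + 1)) w) := fun i => by
  refine (h ((Fin.last (n + 1)).succAbove i)).trans ?_
  rw [Fin.succAbove_last_apply, Fin.val_castSucc]

theorem Graded.of_face_last {n : ℕ} {w : ComposableArrows S.FullSubcategory (n + 1)}
    (h : Graded (face (Fin.last (n + 1)) w))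
    (h' : (w.obj (Fin.last (n + 1))).obj.codim = n + 1) : Graded w := fun i => by
  have key : ∀ a b, a = (Fin.last (n + 1)).succAbove b → (w.obj a).obj.codim = a := by
    rintro _ b rfl
    refine (h b).trans ?_
    rw [Fin.succAbove_last_apply, Fin.val_castSucc]
  induction i using Fin.lastCases with
  | last => rw [h', Fin.val_last]
  | cast a => exact key _ a (Fin.succAbove_last_apply a).symm

/-- The first graph is trivalent and has one natural orientation; afterwards every morphism raises
the codimension by one and induces exactly one orientation. -/
theorem existsUnique_chainOrn : ∀ {n : ℕ} {z : ComposableArrows S.FullSubcategory n},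
    Graded z → ∃! o, ChainOrn z o
  | 0, z, h => by
    have h0 : (z.obj 0).obj.codim = 0 := h 0
    refine ⟨natOrn h0, ⟨Fin.cases (motive := fun i => (z.obj i).obj.Orientn)
      (natOrn h0) fun i => i.elim0, ?_, fun i => i.elim0, rfl⟩, ?_⟩
    · exact (isNatural_iff h0).2 rfl
    · rintro _ ⟨f, h1, -, rfl⟩
      exact (isNatural_iff h0).1 h1
  | n + 1, w, h => by
    obtain ⟨o, ho, huniq⟩ := existsUnique_chainOrn h.face_last
    have hc : (w.obj (Fin.last (n + 1))).obj.codim =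
        ((face (Fin.last (n + 1)) w).obj (Fin.last n)).obj.codim + 1 := by
      rw [h, h.face_last, Fin.val_last, Fin.val_last]
    obtain ⟨o', ho'⟩ := Induces.exists_target (S.ι.map (faceLast (Fin.last (n + 1)) w)) hc o
    refine ⟨o', (chainOrn_succ _ _).2 ⟨o, ho, ho'⟩, fun o'' ho'' => ?_⟩
    obtain ⟨o₁, h1, h2⟩ := (chainOrn_succ _ _).1 ho''
    rw [huniq o₁ h1] at h2
    exact Induces.unique hc h2 ho'

namespace DualSimplex

variable {n : ℕ} {y : OGraph Ω n}

theorem sign_of_positive {c : DualSimplex S y} (h : c.Positive) : c.sign = 1 := if_pos h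

theorem sign_of_not_positive {c : DualSimplex S y} (h : ¬c.Positive) : c.sign = -1 := if_neg h

theorem sign_congr {m : ℕ} {x : OGraph Ω m} {c : DualSimplex S y} {c' : DualSimplex S x}
    (h : c.Positive ↔ c'.Positive) : c.sign = c'.sign := by
  by_cases h' : c.Positive
  · rw [sign_of_positive h', sign_of_positive (h.1 h')]
  · rw [sign_of_not_positive h', sign_of_not_positive fun h'' => h' (h.2 h'')]

/-- The coefficient of a simplex in the average dual cell. -/
def coeff (c : DualSimplex S y) : ℚ := c.sign / ∏ i, (Nat.card (Aut (c.chain.obj i).obj) : ℚ)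

/-- The underlying simplex over `y`. -/
def toOver (c : DualSimplex S y) : OverSimplex S.ι y.graph n := ⟨c.chain, c.iso.hom⟩

theorem toOver_injective : Function.Injective (toOver (S := S) (y := y)) := by
  rintro ⟨z, h, k⟩ ⟨z', h', k'⟩ hc
  obtain rfl : z = z' := congrArg Sigma.fst hc
  obtain rfl : k = k' := Iso.ext (eq_of_heq (Sigma.mk.inj_iff.1 hc).2)
  rfl

/-- Composition with an isomorphism. -/
def comp {x : OGraph Ω n} (k : y.graph ≅ x.graph) (c : DualSimplex S y) : DualSimplex S x :=
  ⟨c.chain, c.codim_eq, c.iso ≪≫ k⟩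

theorem comp_bijective {x : OGraph Ω n} (k : y.graph ≅ x.graph) :
    Function.Bijective (comp (S := S) k) := by
  refine Function.bijective_iff_has_inverse.2 ⟨comp k.symm, fun c => ?_, fun c => ?_⟩
  · exact toOver_injective (congrArg (Sigma.mk c.chain) (by simp [comp]))
  · exact toOver_injective (congrArg (Sigma.mk c.chain) (by simp [comp]))

theorem sign_comp {x : OGraph Ω n} {k : y.graph ≅ x.graph} (hk : PreservesOr k y.or x.or)
    (c : DualSimplex S y) : (c.comp k).sign = c.sign := by
  refine sign_congr ?_
  rw [positive_iff, positive_iff]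
  refine exists_congr fun o => and_congr_right fun _ => ⟨fun h => ?_, fun h => h.trans hk⟩
  have := h.trans hk.symm
  rwa [show (c.comp k).iso ≪≫ k.symm = c.iso by
    ext : 1; simp [comp]] at this

/-- The value `-1` is defined as mere failure of positivity. It really means the opposite
orientation because the orientation along the sequence exists and is unique. -/
theorem sign_comp_neg {x : OGraph Ω n} {k : y.graph ≅ x.graph} (hk : PreservesOr k y.or (-x.or))
    (c : DualSimplex S y) : (c.comp k).sign = -c.sign := by
  obtain ⟨o, ho, huniq⟩ := existsUnique_chainOrn (z := c.chain) c.codim_eq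
  have h1 : ∀ {x : OGraph Ω n} (k : y.graph ≅ x.graph),
      (c.comp k).Positive ↔ PreservesOr (c.iso ≪≫ k) o x.or := fun {x} k => by
    rw [positive_iff]
    constructor
    · rintro ⟨o', h1, h2⟩
      rwa [huniq o' h1] at h2
    · exact fun h => ⟨o, ho, h⟩
  have h2 : c.Positive ↔ PreservesOr c.iso o y.or := by
    rw [positive_iff]
    constructor
    · rintro ⟨o', h1, h2⟩
      rwa [huniq o' h1] at h2
    · exact fun h => ⟨o, ho, h⟩
  by_cases h : c.Positive
  · rw [sign_of_positive h, sign_of_not_positive]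
    rw [h1]
    exact fun h' => not_preservesOr_neg h' ((h2.1 h).trans hk)
  · rw [sign_of_not_positive h, sign_of_positive, neg_neg]
    rw [h1]
    have h3 := ((preservesOr_or_neg c.iso o y.or).resolve_left fun h' => h (h2.2 h')).trans hk.neg
    rwa [Orn.neg_neg'] at h3

end DualSimplex

/-- The average dual cell as a chain over `y`. -/
def dualChain (S : ObjectProperty (RibbonGraph Ω)) {n : ℕ} (y : OGraph Ω n) :
    OverChains S.ι y.graph n :=
  ∑ᶠ c : DualSimplex S y, c.coeff • OverChains.of S.ι c.toOver

end DualCells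

end FatGraph

namespace FatGraph

open RibbonGraph OGraph

variable {Ω : Type u} {S : ObjectProperty (RibbonGraph Ω)}

/-! ### The dual cells as iterated cones -/

/-- `X` is the only object of `S` which is isomorphic to `Γ`. -/
def IsModel (X : S.FullSubcategory) (Γ : RibbonGraph Ω) : Prop :=
  Nonempty (X.obj ≅ Γ) ∧ ∀ X' : S.FullSubcategory, Nonempty (X'.obj ≅ Γ) → X' = X

theorem IsSkeleton.exists_isModel (hS : IsSkeleton S) (Γ : RibbonGraph Ω) :
    ∃ X : S.FullSubcategory, IsModel X Γ := by
  obtain ⟨Δ, ⟨h1, ⟨k⟩⟩, h2⟩ := hS Γ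
  refine ⟨⟨Δ, h1⟩, ⟨k.symm⟩, ?_⟩
  rintro ⟨Δ', h'⟩ ⟨k'⟩
  obtain rfl : Δ' = Δ := h2 Δ' ⟨h', ⟨k'.symm⟩⟩
  rfl

namespace OverChains

variable {C D : Type u} [Category.{u} C] [Category.{u} D] {J : D ⥤ C}

theorem snocOver_face {Γ : C} {n : ℕ} (w : ComposableArrows D (n + 1))
    (k : J.obj (w.obj (Fin.last (n + 1))) ⟶ Γ) :
    snocOver (face (Fin.last (n + 1)) w) (faceLast (Fin.last (n + 1)) w) k = ⟨w, k⟩ :=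
  OverSimplex.ext (snoc_face w) rfl

theorem snocOver_injective {Γ : C} {n : ℕ} {z z' : ComposableArrows D n} {X : D}
    {g : z.obj (Fin.last n) ⟶ X} {g' : z'.obj (Fin.last n) ⟶ X} {k k' : J.obj X ⟶ Γ}
    (h : snocOver z g k = snocOver z' g' k') : k = k' := by
  let v : OverSimplex J Γ (n + 1) → Σ X : D, (J.obj X ⟶ Γ) := fun p => ⟨_, p.2⟩
  have hv : ∀ (z : ComposableArrows D n) (X : D) (g : z.obj (Fin.last n) ⟶ X) (k : J.obj X ⟶ Γ),
      v (snocOver z g k) = ⟨X, k⟩ :=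
    snoc_ind (Q := fun z X g w h => ∀ k : J.obj X ⟶ Γ, v ⟨w, J.map (eqToHom h) ≫ k⟩ = ⟨X, k⟩)
      fun w k => by
        rw [eqToHom_refl, J.map_id, Category.id_comp]
  have h' := congrArg v h
  rw [hv, hv] at h'
  exact eq_of_heq (Sigma.mk.inj_iff.1 h').2

end OverChains

open OverChains

namespace DualSimplex

/-- The zero-dimensional dual simplices. -/
def ofIso {y : OGraph Ω 0} {X : S.FullSubcategory} (k : X.obj ≅ y.graph) : DualSimplex S y where
  chain := ComposableArrows.mk₀ X
  codim_eq i := by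
    obtain rfl := Fin.fin_one_eq_zero i
    exact (iso_codim k).trans y.codim_eq
  iso := k

/-- A zero-dimensional dual simplex consists of an object of the skeleton and an isomorphism to `y`;
the object has to be the model. -/
theorem ofIso_bijective {y : OGraph Ω 0} {X : S.FullSubcategory} (hX : IsModel X y.graph) :
    Function.Bijective (ofIso (y := y) (X := X)) := by
  constructor
  · intro k k' h
    exact Iso.ext (eq_of_heq (Sigma.mk.inj_iff.1 (congrArg toOver h)).2)
  · intro c
    obtain rfl := hX.2 _ ⟨c.iso⟩
    exact ⟨c.iso, toOver_injective (OverSimplex.ext (ComposableArrows.ext₀ rfl)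
      (Category.id_comp _))⟩

theorem sign_ofIso {y : OGraph Ω 0} {X : S.FullSubcategory} (k : X.obj ≅ y.graph) :
    (ofIso k).sign = natSign y.or := by
  have h : (ofIso (S := S) k).Positive ↔ IsNatural y.or := by
    constructor
    · rintro ⟨f, h1, -, h3⟩
      exact IsNatural.iso h3 h1
    · intro h
      refine ⟨Fin.cases (motive := fun i => ((ofIso (S := S) k).chain.obj i).obj.Orientn)
        (y.or.map (isoCell k.symm)) fun i => i.elim0, ?_, fun i => i.elim0, ?_⟩
      · exact IsNatural.iso (preservesOr_iff (k := k.symm).2 rfl) h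
      · exact (preservesOr_iff (k := k.symm).2 rfl).symm
  by_cases h' : IsNatural y.or
  · rw [sign_of_positive (h.2 h'), (isNatural_iff y.codim_eq).1 h', natSign_natOrn, Int.cast_one]
  · rw [sign_of_not_positive fun h'' => h' (h.1 h''), natSign_eq_neg_one y.codim_eq h']
    simp

variable {n : ℕ} {y : OGraph Ω (n + 1)} {X : S.FullSubcategory}

theorem graded_snoc {z : ComposableArrows S.FullSubcategory n} (hz : Graded z)
    (hX : X.obj.codim = n + 1) (g : z.obj (Fin.last n) ⟶ X) : Graded (FatGraph.snoc z g) :=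
  snoc_ind (Q := fun z X _ w _ => Graded z → X.obj.codim = n + 1 → Graded w)
    (fun _ h h' => h.of_face_last h') z X g hz hX

/-- Appending a graph to a dual simplex. -/
def snoc (q : Expansion.Cls y) (k : X.obj ≅ y.graph) (c : DualSimplex S (Expansion.rep q).source) :
    DualSimplex S y where
  chain := FatGraph.snoc c.chain (S.ι.preimage (X := c.chain.obj (Fin.last n)) (Y := X)
    ((c.iso.hom ≫ (Expansion.rep q).map) ≫ k.inv))
  codim_eq := graded_snoc c.codim_eq ((iso_codim k).trans y.codim_eq) _
  iso := S.ι.mapIso (eqToIso (snoc_last _ _)) ≪≫ k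

theorem toOver_snoc (q : Expansion.Cls y) (k : X.obj ≅ y.graph)
    (c : DualSimplex S (Expansion.rep q).source) :
    (snoc q k c).toOver = snocOver (J := S.ι) c.chain
      (S.ι.preimage (X := c.chain.obj (Fin.last n)) (Y := X)
        ((c.iso.hom ≫ (Expansion.rep q).map) ≫ k.inv)) k.hom := rfl

/-- The index set of the cells of dimension `n + 1` in terms of those of dimension `n`. -/
abbrev SnocIndex (y : OGraph Ω (n + 1)) (X : S.FullSubcategory) : Type u :=
  Σ q : Expansion.Cls y, (X.obj ≅ y.graph) × DualSimplex S (Expansion.rep q).source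

/-- The final isomorphism recovers `k`, and the last face with its morphism to `y` recovers the
sequence. Rigidity over `y` then determines `q` and the isomorphism to its representative. -/
theorem snoc_injective :
    Function.Injective fun p : SnocIndex y X => snoc p.1 p.2.1 p.2.2 := by
  rintro ⟨q, k, c⟩ ⟨q', k', c'⟩ h
  replace h := congrArg toOver h
  simp only [toOver_snoc] at h
  obtain rfl : k = k' := Iso.ext (snocOver_injective h)
  have h' := congrArg (overFace S.ι (Fin.last (n + 1))) h
  rw [overFace_last_snocOver, overFace_last_snocOver] at h'
  obtain ⟨z, hz, l⟩ := c
  obtain ⟨z', hz', l'⟩ := c'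
  obtain rfl : z = z' := congrArg Sigma.fst h'
  have h2 := eq_of_heq (Sigma.mk.inj_iff.1 h').2
  rw [S.ι.map_preimage, S.ι.map_preimage, Category.assoc, k.inv_hom_id, Category.comp_id,
    Category.assoc, k.inv_hom_id, Category.comp_id] at h2
  obtain rfl : q = q' := Expansion.eq_of_rel (Expansion.rel_of_iso (l.symm ≪≫ l') (by
    rw [Iso.trans_hom, Category.assoc, ← h2, Iso.symm_hom, l.inv_hom_id_assoc]))
  obtain rfl : l = l' := iso_comp_cancel h2
  rfl

/-- The last morphism of the sequence is an expansion of `y` up to the final isomorphism; comparing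
it with the representative of its class supplies the shorter dual simplex. -/
theorem snoc_surjective (hX : IsModel X y.graph) :
    Function.Surjective fun p : SnocIndex y X => snoc p.1 p.2.1 p.2.2 := by
  intro c
  obtain rfl := hX.2 _ ⟨c.iso⟩
  have hg : Graded c.chain := c.codim_eq
  obtain ⟨o, ho⟩ := Expansion.exists_of_hom (y := y) (hg.face_last (Fin.last n))
    (S.ι.map (faceLast (Fin.last (n + 1)) c.chain) ≫ c.iso.hom)
  obtain ⟨l, -, hl⟩ := Expansion.rep_cls (⟨⟨_, hg.face_last (Fin.last n), o⟩, _, ho⟩ : y.Expansion)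
  refine ⟨⟨_, c.iso, ⟨face (Fin.last (n + 1)) c.chain, hg.face_last, l.symm⟩⟩, ?_⟩
  refine toOver_injective ((toOver_snoc _ _ _).trans (Eq.trans ?_
    (snocOver_face (J := S.ι) c.chain c.iso.hom)))
  refine congrArg (fun g => snocOver (J := S.ι) (face (Fin.last (n + 1)) c.chain) g c.iso.hom) ?_
  refine S.ι.map_injective ((S.ι.map_preimage _).trans ?_)
  rw [← hl]
  simp

theorem finite (hS : IsSkeleton S) : ∀ {n : ℕ} (y : OGraph Ω n), Finite (DualSimplex S y)
  | 0, y => by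
    obtain ⟨X, hX⟩ := hS.exists_isModel y.graph
    exact Finite.of_surjective _ (ofIso_bijective hX).2
  | n + 1, y => by
    obtain ⟨X, hX⟩ := hS.exists_isModel y.graph
    have : ∀ q : Expansion.Cls y, Finite (DualSimplex S (Expansion.rep q).source) :=
      fun q => finite hS _
    exact Finite.of_surjective _ (snoc_surjective hX)

/-- The representative carries the orientation inducing that of `y`. Since the source orientation is
unique, the sequence is positive exactly if its last face is. -/
theorem sign_snoc (q : Expansion.Cls y) (k : X.obj ≅ y.graph)
    (c : DualSimplex S (Expansion.rep q).source) : (snoc q k c).sign = c.sign := by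
  refine sign_congr ?_
  rw [positive_iff, positive_iff]
  have key := snoc_ind (n := n) (Q := fun z X g w h => ∀ (k : X.obj ≅ y.graph),
    (∃ o, ChainOrn w o ∧ PreservesOr (S.ι.mapIso (eqToIso h) ≪≫ k) o y.or) ↔
      ∃ o', ChainOrn z o' ∧ Induces (S.ι.map g ≫ k.hom) o' y.or)
    (fun w k => by
      have hk : S.ι.mapIso (eqToIso (rfl : w.obj (Fin.last (n + 1)) = _)) ≪≫ k = k := by
        ext : 1
        simp
      rw [hk]
      constructor
      · rintro ⟨o, h1, h2⟩
        obtain ⟨o', h3, h4⟩ := (chainOrn_succ _ _).1 h1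
        exact ⟨o', h3, h4.comp_iso h2⟩
      · rintro ⟨o', h3, h4⟩
        refine ⟨y.or.map (isoCell k.symm), (chainOrn_succ _ _).2 ⟨o', h3, ?_⟩,
          (preservesOr_iff (k := k.symm).2 rfl).symm⟩
        have := h4.comp_iso (preservesOr_iff (k := k.symm).2 rfl)
        have h5 : (S.ι.map (faceLast (Fin.last (n + 1)) w) ≫ k.hom) ≫ k.symm.hom =
            S.ι.map (faceLast (Fin.last (n + 1)) w) :=
          (Category.assoc _ _ _).trans
            ((congrArg (S.ι.map (faceLast (Fin.last (n + 1)) w) ≫ ·) k.hom_inv_id).trans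
              (Category.comp_id _))
        rwa [h5] at this)
    c.chain X (S.ι.preimage (X := c.chain.obj (Fin.last n)) (Y := X)
      ((c.iso.hom ≫ (Expansion.rep q).map) ≫ k.inv)) k
  refine key.trans (exists_congr fun o => and_congr_right fun _ => ?_)
  rw [S.ι.map_preimage]
  have hcodim : y.graph.codim = (c.chain.obj (Fin.last n)).obj.codim + 1 := by
    rw [c.codim_eq, y.codim_eq, Fin.val_last]
  rw [Category.assoc, k.inv_hom_id, Category.comp_id]
  constructor
  · intro h
    have h1 : PreservesOr c.iso ((Expansion.rep q).source.or.map (isoCell c.iso.symm))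
      (Expansion.rep q).source.or := (preservesOr_iff (k := c.iso.symm).2 rfl).symm
    rwa [Induces.source_unique hcodim h (Induces.iso_comp h1 (Expansion.rep q).induces)]
  · exact fun h => Induces.iso_comp h (Expansion.rep q).induces

theorem coeff_snoc (q : Expansion.Cls y) (k : X.obj ≅ y.graph)
    (c : DualSimplex S (Expansion.rep q).source) :
    (snoc q k c).coeff = (Nat.card (Aut X.obj) : ℚ)⁻¹ * c.coeff := by
  have key := snoc_ind (n := n) (Q := fun z X g w h =>
    ∏ i, (Nat.card (Aut (w.obj i).obj) : ℚ) =
      (Nat.card (Aut X.obj) : ℚ) * ∏ i, (Nat.card (Aut (z.obj i).obj) : ℚ))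
    (fun w => Fin.prod_univ_succAbove _ (Fin.last (n + 1)))
    c.chain X (S.ι.preimage (X := c.chain.obj (Fin.last n)) (Y := X)
      ((c.iso.hom ≫ (Expansion.rep q).map) ≫ k.inv))
  rw [coeff, coeff, sign_snoc, div_eq_mul_inv, div_eq_mul_inv]
  refine (congrArg (fun t => c.sign * t⁻¹) key).trans ?_
  rw [mul_inv]
  ring

end DualSimplex

end FatGraph

namespace FatGraph

open RibbonGraph OGraph OverChains

variable {Ω : Type u} {S : ObjectProperty (RibbonGraph Ω)}

/-! ### The boundary of a dual cell -/

theorem forget_dualChain (hS : IsSkeleton S) {n : ℕ} (y : OGraph Ω n) :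
    forget _ n (dualChain S y) = avgDualCell S y := by
  have := DualSimplex.finite hS y
  rw [dualChain, map_finsum _ (Set.toFinite _), avgDualCell]
  refine finsum_congr fun c => ?_
  rw [map_smul, forget_of]
  rfl

theorem push_dualChain (hS : IsSkeleton S) {n : ℕ} {x y : OGraph Ω n} {k : y.graph ≅ x.graph}
    (hk : PreservesOr k y.or x.or) : push k.hom n (dualChain S y) = dualChain S x := by
  have := DualSimplex.finite hS y
  rw [dualChain, map_finsum _ (Set.toFinite _), dualChain]
  refine finsum_eq_of_bijective _ (DualSimplex.comp_bijective k) fun c => ?_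
  rw [map_smul, push_of, DualSimplex.coeff, DualSimplex.coeff, DualSimplex.sign_comp hk]
  rfl

theorem dualChain_neg {n : ℕ} (y : OGraph Ω n) :
    dualChain S y.neg = -dualChain S y := by
  have hk : PreservesOr (Iso.refl y.graph) y.or (-y.neg.or) := by
    rw [show -y.neg.or = y.or from Orn.neg_neg' _]
    exact PreservesOr.refl _
  rw [dualChain, dualChain, ← finsum_neg_distrib]
  symm
  refine finsum_eq_of_bijective _
    (DualSimplex.comp_bijective (x := y.neg) (y := y) (Iso.refl y.graph)) fun c => ?_
  have h : (c.comp (x := y.neg) (Iso.refl y.graph)).coeff = -c.coeff := by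
    rw [DualSimplex.coeff, DualSimplex.coeff, DualSimplex.sign_comp_neg hk, neg_div]
    rfl
  rw [h, neg_smul]
  refine congrArg (fun t => -(c.coeff • of S.ι t)) ?_
  exact congrArg (Sigma.mk c.chain) (Category.comp_id _).symm

theorem IsModel.card_iso {X : S.FullSubcategory} {Γ : RibbonGraph Ω} (hX : IsModel X Γ) :
    Nat.card (X.obj ≅ Γ) = Nat.card (Aut X.obj) := by
  obtain ⟨k⟩ := hX.1
  exact Nat.card_congr (Iso.isoCongrRight k.symm)

/-- There are exactly `|Aut X|` isomorphisms from the model, so the factor makes the sum an average.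
-/
theorem IsModel.inv_smul_sum {X : S.FullSubcategory} {Γ : RibbonGraph Ω} (hX : IsModel X Γ)
    {M : Type*} [AddCommGroup M] [Module ℚ M] (v : M) :
    (Nat.card (Aut X.obj) : ℚ)⁻¹ • ∑ _k : X.obj ≅ Γ, v = v := by
  have : (Nat.card (Aut X.obj) : ℚ) ≠ 0 := Nat.cast_ne_zero.2 Nat.card_pos.ne'
  rw [Finset.sum_const, Finset.card_univ, ← Nat.card_eq_fintype_card, hX.card_iso,
    ← Nat.cast_smul_eq_nsmul ℚ, smul_smul, inv_mul_cancel₀ this, one_smul]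

theorem dualChain_zero {y : OGraph Ω 0} {X : S.FullSubcategory} (hX : IsModel X y.graph) :
    dualChain S y = (Nat.card (Aut X.obj) : ℚ)⁻¹ •
      ∑ k : X.obj ≅ y.graph, (natSign y.or : ℚ) • of S.ι (point X k.hom) := by
  rw [dualChain, Finset.smul_sum, ← finsum_eq_sum_of_fintype]
  symm
  refine finsum_eq_of_bijective _ (DualSimplex.ofIso_bijective hX) fun k => ?_
  rw [DualSimplex.coeff, DualSimplex.sign_ofIso, smul_smul, div_eq_inv_mul]
  refine congrArg (fun t : ℚ => (t⁻¹ * (natSign y.or : ℚ)) • of S.ι (point X k.hom)) ?_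
  exact (Fin.prod_univ_one fun i =>
    (Nat.card (Aut ((DualSimplex.ofIso (S := S) (y := y) k).chain.obj i).obj) : ℚ)).symm

theorem aug_dualChain (hS : IsSkeleton S) (y : OGraph Ω 0) :
    aug _ (dualChain S y) = natSign y.or := by
  obtain ⟨X, hX⟩ := hS.exists_isModel y.graph
  rw [dualChain_zero hX, map_smul, map_sum]
  simp only [map_smul, aug_of]
  rw [hX.inv_smul_sum, smul_eq_mul, mul_one]

/-- Dual simplices of `y` are triples of an expansion class, an isomorphism from the model and a
dual simplex of the expansion. The factor `1 / |Aut Γ_n|` of the coefficient is the one needed to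
average over the isomorphisms. -/
theorem dualChain_succ (hS : IsSkeleton S) {n : ℕ} {y : OGraph Ω (n + 1)} {X : S.FullSubcategory}
    (hX : IsModel X y.graph) :
    dualChain S y = (Nat.card (Aut X.obj) : ℚ)⁻¹ • ∑ k : X.obj ≅ y.graph,
      cone (J := S.ι) k n (∑ q : Expansion.Cls y,
        push (Expansion.rep q).map n (dualChain S (Expansion.rep q).source)) := by
  have : ∀ q : Expansion.Cls y, Finite (DualSimplex S (Expansion.rep q).source) :=
    fun q => DualSimplex.finite hS _
  have : ∀ q : Expansion.Cls y, Fintype (DualSimplex S (Expansion.rep q).source) :=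
    fun q => Fintype.ofFinite _
  have h1 : dualChain S y = ∑ p : DualSimplex.SnocIndex y X, ((Nat.card (Aut X.obj) : ℚ)⁻¹ *
      p.2.2.coeff) • cone (J := S.ι) p.2.1 n (push (Expansion.rep p.1).map n
        (of S.ι p.2.2.toOver)) := by
    rw [dualChain, ← finsum_eq_sum_of_fintype]
    symm
    refine finsum_eq_of_bijective _
      ⟨DualSimplex.snoc_injective (X := X), DualSimplex.snoc_surjective hX⟩ fun p => ?_
    rw [DualSimplex.coeff_snoc, DualSimplex.toOver_snoc, push_of, cone_of]
    rfl
  rw [h1, Fintype.sum_sigma, Finset.smul_sum]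
  simp only [map_sum, Finset.smul_sum]
  rw [Finset.sum_comm]
  refine Finset.sum_congr rfl fun q _ => ?_
  rw [Fintype.sum_prod_type]
  refine Finset.sum_congr rfl fun k _ => ?_
  rw [dualChain, finsum_eq_sum_of_fintype, map_sum, map_sum, Finset.smul_sum]
  refine Finset.sum_congr rfl fun c _ => ?_
  rw [map_smul, map_smul, smul_smul]

/-- The map from the forest complex which sends a graph over `Γ` to its dual cell. -/
def cellMap (hS : IsSkeleton S) (Γ : RibbonGraph Ω) (n : ℕ) :
    Forest Γ n →ₗ[ℤ] OverChains S.ι Γ n :=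
  OddFree.lift (fun x => push x.map n (dualChain S x.top))
    (fun x y ⟨l, hl, h⟩ => by rw [← h, ← push_push, push_dualChain hS hl])
    (fun x => by
      change push x.map n (dualChain S x.top.neg) = _
      rw [dualChain_neg, map_neg])

theorem cellMap_mk (hS : IsSkeleton S) {Γ : RibbonGraph Ω} {n : ℕ} (x : OOver Γ n) :
    cellMap hS Γ n (OddFree.mk x) = push x.map n (dualChain S x.top) := OddFree.lift_mk _ _ _ _

theorem cellMap_one (hS : IsSkeleton S) {n : ℕ} (y : OGraph Ω n) :
    cellMap hS y.graph n (Forest.one y) = dualChain S y := by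
  rw [Forest.one, cellMap_mk, push_id]

theorem cellMap_push (hS : IsSkeleton S) {Γ Γ' : RibbonGraph Ω} (f : Γ ⟶ Γ') {n : ℕ}
    (w : Forest Γ n) : cellMap hS Γ' n (Forest.push f n w) = push f n (cellMap hS Γ n w) := by
  have : cellMap hS Γ' n ∘ₗ Forest.push f n =
      (push f n).toAddMonoidHom.toIntLinearMap ∘ₗ cellMap hS Γ n := OddFree.hom_ext fun x => by
    rw [LinearMap.comp_apply, LinearMap.comp_apply, Forest.push_mk, cellMap_mk, cellMap_mk]
    exact (push_push _ _ _).symm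
  exact LinearMap.congr_fun this w

theorem cellMap_bdry_mk (hS : IsSkeleton S) {Γ : RibbonGraph Ω} {n : ℕ} (x : OOver Γ (n + 1)) :
    cellMap hS Γ n (Forest.bdry Γ n (OddFree.mk x)) = ∑ q : Expansion.Cls x.top,
      push x.map n (push (Expansion.rep q).map n (dualChain S (Expansion.rep q).source)) := by
  rw [Forest.bdry_mk, map_sum]
  refine Finset.sum_congr rfl fun q _ => ?_
  rw [cellMap_mk, push_push]
  rfl

theorem dualChain_succ_eq_cone (hS : IsSkeleton S) {n : ℕ} {y : OGraph Ω (n + 1)}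
    {X : S.FullSubcategory} (hX : IsModel X y.graph) :
    dualChain S y = (Nat.card (Aut X.obj) : ℚ)⁻¹ • ∑ k : X.obj ≅ y.graph,
      cone (J := S.ι) k n (cellMap hS y.graph n (Forest.bdry y.graph n (Forest.one y))) := by
  rw [dualChain_succ hS hX, Forest.one, cellMap_bdry_mk]
  simp only [push_id]

theorem aug_cellMap (hS : IsSkeleton S) {Γ : RibbonGraph Ω} (w : Forest Γ 0) :
    aug Γ (cellMap hS Γ 0 w) = Forest.aug Γ w := by
  have : (aug Γ).toAddMonoidHom.toIntLinearMap ∘ₗ cellMap hS Γ 0 =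
      (Int.castAddHom ℚ).toIntLinearMap ∘ₗ Forest.aug Γ := OddFree.hom_ext fun x => by
    rw [LinearMap.comp_apply, LinearMap.comp_apply, cellMap_mk, Forest.aug_mk]
    exact (aug_push _ _).trans (aug_dualChain hS _)
  exact LinearMap.congr_fun this w

/-- Both sides are natural in `Γ`, and every generator is the push-forward of an identity; so the
formula for dual chains suffices. It is stated with a hypothesis in order to serve inside the
induction. -/
theorem bdry_cellMap_of (hS : IsSkeleton S) {n : ℕ}
    (h : ∀ y : OGraph Ω (n + 1), bdry y.graph n (dualChain S y) =
      (-1 : ℚ) ^ (n + 1) • cellMap hS y.graph n (Forest.bdry y.graph n (Forest.one y)))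
    {Γ : RibbonGraph Ω} (w : Forest Γ (n + 1)) :
    bdry Γ n (cellMap hS Γ (n + 1) w) =
      (-1 : ℚ) ^ (n + 1) • cellMap hS Γ n (Forest.bdry Γ n w) := by
  have hz : ∀ v : OverChains S.ι Γ n, (-1 : ℚ) ^ (n + 1) • v = (-1 : ℤ) ^ (n + 1) • v := fun v => by
    rw [← Int.cast_smul_eq_zsmul ℚ, Int.cast_pow, Int.cast_neg, Int.cast_one]
  have : (bdry Γ n).toAddMonoidHom.toIntLinearMap ∘ₗ cellMap hS Γ (n + 1) =
      (-1 : ℤ) ^ (n + 1) • (cellMap hS Γ n ∘ₗ Forest.bdry Γ n) := OddFree.hom_ext fun x => by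
    rw [LinearMap.comp_apply, cellMap_mk, LinearMap.smul_apply, LinearMap.comp_apply, ← hz]
    refine (bdry_push _ _).trans ?_
    rw [h, map_smul, ← cellMap_push, ← Forest.bdry_push, Forest.one, Forest.push_mk]
    refine congrArg
      (fun t => (-1 : ℚ) ^ (n + 1) • cellMap hS Γ n (Forest.bdry Γ n (OddFree.mk t))) ?_
    exact congrArg (OOver.mk x.top) (Category.id_comp _)
  rw [hz]
  exact LinearMap.congr_fun this w

/-- The dual cell is an average of cones on the chain `c` of the dual cells of the expansions. By
induction, `2 d² = 0` (or `ε d = 0` in the lowest degree) makes `c` a cycle of augmentation zero, so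
each cone has boundary `± c`. -/
theorem bdry_dualChain [Infinite Ω] (hS : IsSkeleton S) : ∀ {n : ℕ} (y : OGraph Ω (n + 1)),
    bdry y.graph n (dualChain S y) =
      (-1 : ℚ) ^ (n + 1) • cellMap hS y.graph n (Forest.bdry y.graph n (Forest.one y))
  | 0, y => by
    obtain ⟨X, hX⟩ := hS.exists_isModel y.graph
    rw [dualChain_succ_eq_cone hS hX, map_smul, map_sum]
    simp only [bdry_cone_zero, aug_cellMap, Forest.aug_bdry]
    rw [Int.cast_zero]
    simp only [zero_smul, zero_sub]
    rw [hX.inv_smul_sum]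
    simp
  | n + 1, y => by
    obtain ⟨X, hX⟩ := hS.exists_isModel y.graph
    have h0 : bdry y.graph n (cellMap hS y.graph (n + 1)
        (Forest.bdry y.graph (n + 1) (Forest.one y))) = 0 := by
      rw [bdry_cellMap_of hS fun y => bdry_dualChain hS y]
      -- The factor two is harmless because the chains are rational.
      have h2 := congrArg (cellMap hS y.graph n) (Forest.two_smul_bdry_bdry (Forest.one y))
      rw [map_zsmul, map_zero, ← Int.cast_smul_eq_zsmul ℚ] at h2
      rw [(smul_eq_zero.1 h2).resolve_left (by norm_num), smul_zero]
    rw [dualChain_succ_eq_cone hS hX, map_smul, map_sum]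
    simp only [bdry_cone_succ, h0, map_zero, zero_add]
    rw [hX.inv_smul_sum, pow_add, pow_add]
    norm_num

theorem bdry_cellMap [Infinite Ω] (hS : IsSkeleton S) {n : ℕ} {Γ : RibbonGraph Ω}
    (w : Forest Γ (n + 1)) : bdry Γ n (cellMap hS Γ (n + 1) w) =
      (-1 : ℚ) ^ (n + 1) • cellMap hS Γ n (Forest.bdry Γ n w) :=
  bdry_cellMap_of hS (fun y => bdry_dualChain hS y) w

/-- The sign `(-1)^{n + 1 \choose 2}`. -/
def cellSign (n : ℕ) : ℚ := (-1 : ℚ) ^ ((n + 1).choose 2)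

theorem cellSign_zero : cellSign 0 = 1 := by simp [cellSign]

/-- The sign is the product of the signs `(-1)^i`, for `i ≤ n`, that appear in the successive
boundary formulas. -/
theorem cellSign_succ (n : ℕ) : cellSign (n + 1) = (-1 : ℚ) ^ (n + 1) * cellSign n := by
  rw [cellSign, cellSign, Nat.choose_succ_succ' (n + 1) 1, Nat.choose_one_right, pow_add]

theorem cellSign_mul_self (n : ℕ) : cellSign n * cellSign n = 1 := by
  rw [cellSign, ← mul_pow]
  simp

/-- The signed map from the forest complex which sends a graph over `Γ` to its dual cell. -/
def signedCellMap (hS : IsSkeleton S) (Γ : RibbonGraph Ω) (n : ℕ) (w : Forest Γ n) :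
    OverChains S.ι Γ n := cellSign n • cellMap hS Γ n w

theorem bdry_signedCellMap [Infinite Ω] (hS : IsSkeleton S) {n : ℕ} {Γ : RibbonGraph Ω}
    (w : Forest Γ (n + 1)) : bdry Γ n (signedCellMap hS Γ (n + 1) w) =
      signedCellMap hS Γ n (Forest.bdry Γ n w) := by
  rw [signedCellMap, signedCellMap, map_smul, bdry_cellMap, smul_smul, cellSign_succ,
    mul_comm ((-1 : ℚ) ^ (n + 1)) (cellSign n), mul_assoc, ← mul_pow]
  simp

end FatGraph

namespace FatGraph

open RibbonGraph OGraph OverChains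

variable {Ω : Type u} {S : ObjectProperty (RibbonGraph Ω)}

/-! ### Homomorphisms from the integral subcomplex -/

/-- The setoid of isomorphism of the underlying graphs. -/
def graphSetoid (Ω : Type u) (n : ℕ) : Setoid (OGraph Ω n) where
  r x y := Nonempty (x.graph ≅ y.graph)
  iseqv := ⟨fun _ => ⟨Iso.refl _⟩, fun ⟨k⟩ => ⟨k.symm⟩, fun ⟨k⟩ ⟨l⟩ => ⟨k ≪≫ l⟩⟩

section IntegralLift

variable {n : ℕ} {M : Type*} [AddCommGroup M]

/-- Each isomorphism `x ≅ y` turns `V x` into `V y` up to exactly the sign with which it is counted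
by `⟨y⟩`. -/
theorem angle_smul {V : OGraph Ω n → M} (hiso : ∀ x y, x.IsoRel y → V x = V y)
    (hneg : ∀ x, V x.neg = -V x) (x y : OGraph Ω n) :
    angle y (OddFree.mk x) • V x = Nat.card (x.graph ≅ y.graph) • V y := by
  rw [angle_mk, Finset.sum_smul, Nat.card_eq_fintype_card, ← Finset.card_univ,
    ← Finset.sum_const]
  refine Finset.sum_congr rfl fun k _ => ?_
  rcases preservesOr_or_neg k x.or y.or with h | h
  · rw [orSign_of_preservesOr h, one_smul, hiso x y ⟨k, h⟩]
  · rw [orSign_of_preservesOr_neg h, neg_smul, one_smul, hiso x y.neg ⟨k, h⟩, hneg, neg_neg]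

theorem angle_eq_zero {x y : OGraph Ω n} (h : IsEmpty (x.graph ≅ y.graph)) :
    angle y (OddFree.mk x) = 0 := by
  rw [angle_mk, Fintype.sum_empty]

theorem finite_support_integralSub (f : integralSub Ω n) :
    {q : Quotient (graphSetoid Ω n) | f.1 (OddFree.mk q.out) ≠ 0}.Finite := by
  have hf : f ∈ Submodule.span ℤ (Set.range (gen (Ω := Ω) (n := n))) := by
    rw [span_gen]
    trivial
  induction hf using Submodule.span_induction with
  | mem f h =>
    obtain ⟨y, rfl⟩ := h
    refine (Set.finite_singleton (Quotient.mk (graphSetoid Ω n) y)).subset fun q hq => ?_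
    by_contra hne
    refine hq (angle_eq_zero (not_nonempty_iff.1 fun h => hne ?_))
    exact (Quotient.out_eq q).symm.trans (Quotient.sound (s := graphSetoid Ω n) h)
  | zero => simp
  | add f g _ _ hf hg =>
    refine (hf.union hg).subset fun q hq => ?_
    by_contra hne
    simp only [Set.mem_union, Set.mem_ofPred_eq, not_or, not_not] at hne
    exact hq ((congrArg₂ (· + ·) hne.1 hne.2).trans (add_zero 0))
  | smul r f _ hf =>
    refine hf.subset fun q hq hz => hq ?_
    exact (congrArg (r • ·) hz).trans (smul_zero r)

/-- A homomorphism on the integral subcomplex is determined by arbitrary rational values on the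
generators which are compatible with isomorphism and reversal of orientation. -/
theorem exists_integralLift [Module ℚ M] (V : OGraph Ω n → M) (hiso : ∀ x y, x.IsoRel y → V x = V y)
    (hneg : ∀ x, V x.neg = -V x) : ∃ L : integralSub Ω n →+ M, ∀ y, L (gen y) = V y := by
  -- The map is `f ↦ ∑ f[q] V(q) / |Aut q|` over isomorphism classes `q`, a finite sum for each `f`.
  -- On `⟨y⟩` only the class of `y` contributes, and it contributes `|Aut|` copies of `V y`. A
  -- generator that vanishes causes no trouble, since then `V y = -V y`.
  let t : integralSub Ω n → Quotient (graphSetoid Ω n) → M := fun f q =>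
    (Nat.card (Aut q.out.graph) : ℚ)⁻¹ • (f.1 (OddFree.mk q.out) • V q.out)
  have ht : ∀ f, (Function.support (t f)).Finite := fun f =>
    (finite_support_integralSub f).subset fun q hq hz => hq (by
      change _ • (f.1 (OddFree.mk q.out) • V q.out) = 0
      rw [hz, zero_smul, smul_zero])
  refine ⟨AddMonoidHom.mk' (fun f => ∑ᶠ q, t f q) fun f g => ?_, fun y => ?_⟩
  · rw [← finsum_add_distrib (ht f) (ht g)]
    refine finsum_congr fun q => ?_
    change _ • ((f.1 (OddFree.mk q.out) + g.1 (OddFree.mk q.out)) • V q.out) = _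
    rw [add_smul, smul_add]
  · change ∑ᶠ q, t (gen y) q = V y
    rw [finsum_eq_single _ (Quotient.mk (graphSetoid Ω n) y)]
    · obtain ⟨k⟩ := Quotient.mk_out (s := graphSetoid Ω n) y
      change _ • (angle y (OddFree.mk _) • V _) = V y
      have hcard : Nat.card ((Quotient.mk (graphSetoid Ω n) y).out.graph ≅ y.graph) =
          Nat.card (Aut (Quotient.mk (graphSetoid Ω n) y).out.graph) :=
        Nat.card_congr (Iso.isoCongrRight k.symm)
      rw [angle_smul hiso hneg, ← Nat.cast_smul_eq_nsmul ℚ, smul_smul, hcard, inv_mul_cancel₀,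
        one_smul]
      exact Nat.cast_ne_zero.2 Nat.card_pos.ne'
    · intro q hq
      change _ • (angle y (OddFree.mk q.out) • V q.out) = 0
      rw [angle_eq_zero, zero_smul, smul_zero]
      refine not_nonempty_iff.1 fun h => hq ?_
      exact (Quotient.out_eq q).symm.trans (Quotient.sound (s := graphSetoid Ω n) h)

end IntegralLift

end FatGraph

namespace FatGraph

open RibbonGraph OGraph OverChains

variable {Ω : Type u} {S : ObjectProperty (RibbonGraph Ω)}

/-! ### The chain map given by the dual cells -/

/-- The integral subcomplex. -/
abbrev integralCx (Ω : Type u) : ChainComplex (ModuleCat.{u} ℤ) ℕ :=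
  integralComplex Ω (integralBdry_integralBdry Ω)

theorem integralCx_d (n : ℕ) (c : integralSub Ω (n + 1)) :
    ((integralCx Ω).d (n + 1) n).hom (c : (integralCx Ω).X (n + 1)) = integralBdry Ω n c := by
  have h : (integralCx Ω).d (n + 1) n = ModuleCat.ofHom (integralBdry Ω n) :=
    ChainComplex.of_d (fun n => ModuleCat.of ℤ (integralSub Ω n))
      (fun n => ModuleCat.ofHom (integralBdry Ω n)) n
  rw [h]
  rfl

/-- The image of an element of the forest complex in the rationalized integral subcomplex. -/
def ratProj (Γ : RibbonGraph Ω) (n : ℕ) : Forest Γ n →+ (rat.obj (integralCx Ω)).X n :=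
  (toRatHom (integralCx Ω) n).comp (Forest.proj Γ n).toAddMonoidHom

theorem ratProj_one {n : ℕ} (y : OGraph Ω n) :
    ratProj y.graph n (Forest.one y) = toRat (integralCx Ω) (gen y) :=
  congrArg (toRatHom (integralCx Ω) n) (Forest.proj_mk _)

theorem d_ratProj {Γ : RibbonGraph Ω} {n : ℕ} (w : Forest Γ (n + 1)) :
    ((rat.obj (integralCx Ω)).d (n + 1) n).hom (ratProj Γ (n + 1) w) =
      ratProj Γ n (Forest.bdry Γ n w) := by
  refine (rat_d_toRat _).trans (congrArg (toRatHom (integralCx Ω) n) ?_)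
  exact (integralCx_d n _).trans (Forest.integralBdry_proj w)

theorem ratIntegral_hom_ext {n : ℕ} {M : Type u} [AddCommGroup M] [Module ℚ M]
    {f g : (rat.obj (integralCx Ω)).X n →ₗ[ℚ] M}
    (h : ∀ y : OGraph Ω n, f (ratProj y.graph n (Forest.one y)) =
      g (ratProj y.graph n (Forest.one y))) : f = g := by
  refine rat_hom_ext fun c => ?_
  have : (f.toAddMonoidHom.comp (toRatHom (integralCx Ω) n) : integralSub Ω n →+ M).toIntLinearMap =
      (g.toAddMonoidHom.comp (toRatHom (integralCx Ω) n) : integralSub Ω n →+ M).toIntLinearMap :=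
    integralSub_hom_ext fun y => by
      have := h y
      rw [ratProj_one] at this
      exact this
  exact LinearMap.congr_fun this c

theorem avgDualCell_iso (hS : IsSkeleton S) {n : ℕ} (x y : OGraph Ω n) (h : x.IsoRel y) :
    avgDualCell S x = avgDualCell S y := by
  obtain ⟨k, hk⟩ := h
  rw [← forget_dualChain hS, ← forget_dualChain hS, ← push_dualChain hS hk, forget_push]

theorem avgDualCell_neg (hS : IsSkeleton S) {n : ℕ} (x : OGraph Ω n) :
    avgDualCell S x.neg = -avgDualCell S x := by
  rw [← forget_dualChain hS, ← forget_dualChain hS, dualChain_neg]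
  exact map_neg _ _

/-- Forgetting the base makes the signed cell map depend on the source graph alone, so it factors
through the projection to the integral subcomplex. -/
theorem exists_dualCellMap (hS : IsSkeleton S) (n : ℕ) :
    ∃ L : (rat.obj (integralCx Ω)).X n →ₗ[ℚ] (rat.obj (nerveChains S.FullSubcategory)).X n,
      ∀ (Γ : RibbonGraph Ω) (w : Forest Γ n),
        L (ratProj Γ n w) = forget Γ n (signedCellMap hS Γ n w) := by
  obtain ⟨L, hL⟩ := exists_integralLift
    (M := (rat.obj (nerveChains S.FullSubcategory)).X n)
    (fun y : OGraph Ω n => cellSign n • avgDualCell S y)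
    (fun x y h => by rw [avgDualCell_iso hS x y h])
    (fun x => by rw [avgDualCell_neg hS, smul_neg])
  refine ⟨ratLift (K := integralCx Ω) (M := (rat.obj (nerveChains S.FullSubcategory)).X n) L,
    fun Γ w => ?_⟩
  have hz : (L.comp (Forest.proj Γ n).toAddMonoidHom).toIntLinearMap =
      (((forget Γ n).toAddMonoidHom.comp ((cellSign n • LinearMap.id :
        OverChains S.ι Γ n →ₗ[ℚ] OverChains S.ι Γ n).toAddMonoidHom.comp
          (cellMap hS Γ n).toAddMonoidHom))).toIntLinearMap :=
    OddFree.hom_ext fun x => by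
      have h1 : L (Forest.proj Γ n (OddFree.mk x)) = cellSign n • avgDualCell S x.top := by
        rw [Forest.proj_mk, hL]
      refine h1.trans ?_
      have h2 : forget Γ n (cellSign n • cellMap hS Γ n (OddFree.mk x)) =
          cellSign n • avgDualCell S x.top := by
        rw [map_smul, cellMap_mk, forget_push, forget_dualChain hS]
      exact h2.symm
  exact (ratLift_toRat (K := integralCx Ω) L _).trans (LinearMap.congr_fun hz w)

/-- The chain map given by the dual cells. -/
theorem exists_dualCellChainMap [Infinite Ω] (hS : IsSkeleton S) :
    ∃ ψ : rat.obj (integralCx Ω) ⟶ rat.obj (nerveChains S.FullSubcategory),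
      ∀ (n : ℕ) (Γ : RibbonGraph Ω) (w : Forest Γ n),
        (ψ.f n).hom (ratProj Γ n w) = forget Γ n (signedCellMap hS Γ n w) := by
  choose L hL using exists_dualCellMap (Ω := Ω) hS
  refine ⟨{ f := fun n => ModuleCat.ofHom (X := (rat.obj (integralCx Ω)).X n)
              (Y := (rat.obj (nerveChains S.FullSubcategory)).X n) (L n)
            comm' := ?_ }, fun n Γ w => hL n Γ w⟩
  rintro _ n rfl
  refine ModuleCat.hom_ext (ratIntegral_hom_ext fun y => ?_)
  change ((rat.obj (nerveChains S.FullSubcategory)).d (n + 1) n).hom (L (n + 1) _) =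
    L n (((rat.obj (integralCx Ω)).d (n + 1) n).hom _)
  rw [hL, d_ratProj, hL, d_forget, bdry_signedCellMap]

end FatGraph

namespace FatGraph

open RibbonGraph OGraph OverChains

variable {Ω : Type u} {S : ObjectProperty (RibbonGraph Ω)}

/-! ### Carried chain maps -/

/-- A family of elements of the forest complexes which is compatible with the boundary maps and
the augmentations. -/
structure Lift (φ' : ∀ (n : ℕ) (x : ComposableArrows (RibbonGraph Ω) n),
    Forest (x.obj (Fin.last n)) n) : Prop where
  aug : ∀ x, Forest.aug _ (φ' 0 x) = 1
  bdry : ∀ n x, Forest.bdry _ n (φ' (n + 1) x) =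
    ∑ i : Fin (n + 2), (-1 : ℤ) ^ (i : ℕ) • Forest.push (faceLast i x) n (φ' n (face i x))

section

variable {φ' : ∀ (n : ℕ) (x : ComposableArrows (RibbonGraph Ω) n), Forest (x.obj (Fin.last n)) n}

theorem neg_one_pow_zsmul {M : Type*} [AddCommGroup M] [Module ℚ M] (n : ℕ) (v : M) :
    (-1 : ℤ) ^ n • v = (-1 : ℚ) ^ n • v := by
  rw [← Int.cast_smul_eq_zsmul ℚ, Int.cast_pow, Int.cast_neg, Int.cast_one]

theorem aug_signedCellMap (hS : IsSkeleton S) {Γ : RibbonGraph Ω} (w : Forest Γ 0) :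
    aug Γ (signedCellMap hS Γ 0 w) = Forest.aug Γ w := by
  rw [signedCellMap, cellSign_zero, one_smul, aug_cellMap]

/-- The lift turned into dual cells is a natural augmented family of chains over the last graph,
which is the input of the acyclic carrier argument. -/
theorem Lift.bdry_signedCellMap [Infinite Ω] (hφ : Lift φ') (hS : IsSkeleton S) (n : ℕ)
    (x : ComposableArrows (RibbonGraph Ω) (n + 1)) :
    OverChains.bdry _ n (signedCellMap hS _ (n + 1) (φ' (n + 1) x)) =
      ∑ i : Fin (n + 2), (-1 : ℚ) ^ (i : ℕ) • OverChains.push (faceLast i x) n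
        (signedCellMap hS _ n (φ' n (face i x))) := by
  rw [FatGraph.bdry_signedCellMap, hφ.bdry, signedCellMap, map_sum, Finset.smul_sum]
  refine Finset.sum_congr rfl fun i _ => ?_
  rw [map_zsmul, cellMap_push, neg_one_pow_zsmul, smul_comm, signedCellMap, map_smul]

/-- The inclusion of the chains of a subcategory. -/
def incl (S : ObjectProperty (RibbonGraph Ω)) (Γ : RibbonGraph Ω) (n : ℕ) :
    OverChains S.ι Γ n →ₗ[ℚ] OverChains (𝟭 (RibbonGraph Ω)) Γ n :=
  OverChains.lift fun p => OverChains.of (𝟭 (RibbonGraph Ω)) ⟨p.1 ⋙ S.ι, p.2⟩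

theorem incl_of {Γ : RibbonGraph Ω} {n : ℕ} (p : OverSimplex S.ι Γ n) :
    incl S Γ n (OverChains.of S.ι p) = OverChains.of (𝟭 (RibbonGraph Ω)) ⟨p.1 ⋙ S.ι, p.2⟩ :=
  OverChains.lift_of _ _

theorem bdry_incl {Γ : RibbonGraph Ω} {n : ℕ} (w : OverChains S.ι Γ (n + 1)) :
    OverChains.bdry Γ n (incl S Γ (n + 1) w) = incl S Γ n (OverChains.bdry Γ n w) := by
  have : OverChains.bdry Γ n ∘ₗ incl S Γ (n + 1) = incl S Γ n ∘ₗ OverChains.bdry Γ n :=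
    OverChains.hom_ext fun p => by
      rw [LinearMap.comp_apply, LinearMap.comp_apply, incl_of, bdry_of, bdry_of, map_sum]
      refine Finset.sum_congr rfl fun i _ => ?_
      rw [map_smul, incl_of]
      rfl
  exact LinearMap.congr_fun this w

theorem incl_push {Γ Γ' : RibbonGraph Ω} (f : Γ ⟶ Γ') {n : ℕ} (w : OverChains S.ι Γ n) :
    incl S Γ' n (OverChains.push f n w) = OverChains.push f n (incl S Γ n w) := by
  have : incl S Γ' n ∘ₗ OverChains.push f n = OverChains.push f n ∘ₗ incl S Γ n :=
    OverChains.hom_ext fun p => by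
      rw [LinearMap.comp_apply, LinearMap.comp_apply, incl_of, push_of, push_of, incl_of]
  exact LinearMap.congr_fun this w

theorem aug_incl {Γ : RibbonGraph Ω} (w : OverChains S.ι Γ 0) :
    OverChains.aug Γ (incl S Γ 0 w) = OverChains.aug Γ w := by
  have : OverChains.aug Γ ∘ₗ incl S Γ 0 = OverChains.aug Γ := OverChains.hom_ext fun p => by
    rw [LinearMap.comp_apply, incl_of, aug_of, aug_of]
  exact LinearMap.congr_fun this w

theorem forget_incl {Γ : RibbonGraph Ω} {n : ℕ} (w : OverChains S.ι Γ n) :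
    forget Γ n (incl S Γ n w) = ((rat.map (nerveChainsMap S.ι)).f n).hom (forget Γ n w) := by
  have : forget Γ n ∘ₗ incl S Γ n = ((rat.map (nerveChainsMap S.ι)).f n).hom ∘ₗ forget Γ n :=
    OverChains.hom_ext fun p => by
      rw [LinearMap.comp_apply, LinearMap.comp_apply, incl_of, forget_of, forget_of,
        rat_map_toRat, nerveChainsMap_simplex]
  exact LinearMap.congr_fun this w

variable {φ : nerveChains (RibbonGraph Ω) ⟶ integralCx Ω}
  {ψ : rat.obj (integralCx Ω) ⟶ rat.obj (nerveChains S.FullSubcategory)}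

theorem rat_map_simplex
    (hp : ∀ n x, (φ.f n).hom (simplex x) = Forest.proj _ n (φ' n x)) (n : ℕ)
    (x : ComposableArrows (RibbonGraph Ω) n) :
    ((rat.map φ).f n).hom (toRat _ (simplex x)) = ratProj _ n (φ' n x) := by
  rw [rat_map_toRat, hp]
  rfl

/-- The carrier argument within the skeleton: cells lie in the chains of `S` over the last graph,
which is itself an object of `S` and can be the apex of a cone. -/
theorem nonempty_homotopy_sub [Infinite Ω] (hS : IsSkeleton S) (hφ : Lift φ')
    (hp : ∀ n x, (φ.f n).hom (simplex x) = Forest.proj _ n (φ' n x))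
    (hψ : ∀ (n : ℕ) (Γ : RibbonGraph Ω) (w : Forest Γ n),
        (ψ.f n).hom (ratProj Γ n w) = forget Γ n (signedCellMap hS Γ n w)) :
    Nonempty (Homotopy (rat.map (nerveChainsMap S.ι) ≫ rat.map φ ≫ ψ) (𝟙 _)) := by
  refine nonempty_homotopy (J := S.ι) (fun n x => signedCellMap hS _ n (φ' n (x ⋙ S.ι)))
    (fun x => ?_) (fun n x => ?_) _ fun n x => ?_
  · exact (aug_signedCellMap hS _).trans
      ((congrArg (Int.cast : ℤ → ℚ) (hφ.aug (x ⋙ S.ι))).trans Int.cast_one)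
  · exact hφ.bdry_signedCellMap hS n (x ⋙ S.ι)
  · change (ψ.f n).hom (((rat.map φ).f n).hom (((rat.map (nerveChainsMap S.ι)).f n).hom _)) = _
    rw [rat_map_toRat, nerveChainsMap_simplex, rat_map_simplex hp, hψ]
    rfl

/-- Over the whole category the last graph need not lie in `S`, so the cells are first included into
the chains of all ribbon graphs. -/
theorem nonempty_homotopy_id [Infinite Ω] (hS : IsSkeleton S) (hφ : Lift φ')
    (hp : ∀ n x, (φ.f n).hom (simplex x) = Forest.proj _ n (φ' n x))
    (hψ : ∀ (n : ℕ) (Γ : RibbonGraph Ω) (w : Forest Γ n),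
        (ψ.f n).hom (ratProj Γ n w) = forget Γ n (signedCellMap hS Γ n w)) :
    Nonempty (Homotopy (rat.map φ ≫ ψ ≫ rat.map (nerveChainsMap S.ι)) (𝟙 _)) := by
  refine nonempty_homotopy (J := 𝟭 (RibbonGraph Ω))
    (fun n x => incl S _ n (signedCellMap hS _ n (φ' n x)))
    (fun x => ?_) (fun n x => ?_) _ fun n x => ?_
  · exact (aug_incl _).trans ((aug_signedCellMap hS _).trans
      ((congrArg (Int.cast : ℤ → ℚ) (hφ.aug x)).trans Int.cast_one))
  · refine (bdry_incl _).trans ?_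
    refine (congrArg (incl S _ n) (hφ.bdry_signedCellMap hS n x)).trans ((map_sum _ _ _).trans ?_)
    refine Finset.sum_congr rfl fun i _ => ?_
    exact (map_smul _ _ _).trans (congrArg _ (incl_push _ _))
  · change ((rat.map (nerveChainsMap S.ι)).f n).hom ((ψ.f n).hom (((rat.map φ).f n).hom _)) = _
    rw [rat_map_simplex hp, hψ]
    exact (forget_incl _).symm

end

end FatGraph

namespace FatGraph

open RibbonGraph OGraph OverChains
open scoped TensorProduct

variable {Ω : Type u} {S : ObjectProperty (RibbonGraph Ω)}

/-! ### The composition with the dual cells -/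

theorem ratProj_push {Γ Γ' : RibbonGraph Ω} (f : Γ ⟶ Γ') {n : ℕ} (w : Forest Γ n) :
    ratProj Γ' n (Forest.push f n w) = ratProj Γ n w :=
  congrArg (toRatHom (integralCx Ω) n) (Forest.proj_push f w)

/-- The rational forest complex. -/
abbrev RatForest (Γ : RibbonGraph Ω) (n : ℕ) : Type u := ℚ ⊗[ℤ] Forest Γ n

/-- The projection from the rational forest complex to the rationalized integral subcomplex. -/
def RatForest.proj (Γ : RibbonGraph Ω) (n : ℕ) :
    RatForest Γ n →ₗ[ℤ] (rat.obj (integralCx Ω)).X n :=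
  TensorProduct.lift
    (LinearMap.mk₂ ℤ (fun (r : ℚ) (w : Forest Γ n) =>
        (r • ratProj Γ n w : (rat.obj (integralCx Ω)).X n))
      (fun _ _ _ => add_smul _ _ _) (fun _ _ _ => smul_assoc _ _ _)
      (fun _ _ _ => by rw [map_add, smul_add])
      (fun t r w => by rw [map_zsmul, smul_comm]))

theorem RatForest.proj_tmul {Γ : RibbonGraph Ω} {n : ℕ} (r : ℚ) (w : Forest Γ n) :
    RatForest.proj Γ n (r ⊗ₜ w) = r • ratProj Γ n w := rfl

theorem RatForest.exists_smul_one {n : ℕ} (y : OGraph Ω n) (v : RatForest y.graph n) :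
    ∃ t : ℚ, v = t ⊗ₜ Forest.one y := by
  induction v using TensorProduct.induction_on with
  | zero => exact ⟨0, (TensorProduct.zero_tmul _ _).symm⟩
  | tmul r w =>
    obtain ⟨t, rfl⟩ := Forest.exists_smul_one y w
    exact ⟨t • r, by rw [TensorProduct.tmul_smul, TensorProduct.smul_tmul']⟩
  | add v w hv hw =>
    obtain ⟨s, rfl⟩ := hv
    obtain ⟨t, rfl⟩ := hw
    exact ⟨s + t, (TensorProduct.add_tmul _ _ _).symm⟩

section

variable (φ' : ∀ (n : ℕ) (x : ComposableArrows (RibbonGraph Ω) n), Forest (x.obj (Fin.last n)) n)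

/-- The linear extension of a family of elements of the forest complexes. -/
def forestMap (S : ObjectProperty (RibbonGraph Ω)) (Γ : RibbonGraph Ω) (n : ℕ) :
    OverChains S.ι Γ n →ₗ[ℚ] RatForest Γ n :=
  OverChains.lift fun p => (1 : ℚ) ⊗ₜ[ℤ] Forest.push p.2 n (φ' n (p.1 ⋙ S.ι))

theorem forestMap_of {Γ : RibbonGraph Ω} {n : ℕ} (p : OverSimplex S.ι Γ n) :
    forestMap φ' S Γ n (OverChains.of S.ι p) =
      (1 : ℚ) ⊗ₜ[ℤ] Forest.push p.2 n (φ' n (p.1 ⋙ S.ι)) :=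
  OverChains.lift_of _ _

theorem forestMap_push {Γ Γ' : RibbonGraph Ω} (f : Γ ⟶ Γ') {n : ℕ} (w : OverChains S.ι Γ n) :
    forestMap φ' S Γ' n (OverChains.push f n w) =
      (Forest.push f n).baseChange ℚ (forestMap φ' S Γ n w) := by
  have : forestMap φ' S Γ' n ∘ₗ OverChains.push f n =
      (Forest.push f n).baseChange ℚ ∘ₗ forestMap φ' S Γ n := OverChains.hom_ext fun p => by
    rw [LinearMap.comp_apply, LinearMap.comp_apply, push_of, forestMap_of, forestMap_of,
      LinearMap.baseChange_tmul, Forest.push_push]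
  exact LinearMap.congr_fun this w

variable {φ'}

/-- The boundary condition in `Lift` says precisely that the natural extension of the family
commutes with the boundary maps. -/
theorem Lift.bdry_forestMap (hφ : Lift φ') {Γ : RibbonGraph Ω} {n : ℕ}
    (w : OverChains S.ι Γ (n + 1)) :
    (Forest.bdry Γ n).baseChange ℚ (forestMap φ' S Γ (n + 1) w) =
      forestMap φ' S Γ n (OverChains.bdry Γ n w) := by
  have : (Forest.bdry Γ n).baseChange ℚ ∘ₗ forestMap φ' S Γ (n + 1) =
      forestMap φ' S Γ n ∘ₗ OverChains.bdry Γ n := OverChains.hom_ext fun p => by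
    rw [LinearMap.comp_apply, LinearMap.comp_apply, forestMap_of, LinearMap.baseChange_tmul,
      Forest.bdry_push, OverChains.bdry_of, map_sum]
    refine (congrArg (fun t => (1 : ℚ) ⊗ₜ[ℤ] Forest.push p.2 n t)
      (hφ.bdry n (p.1 ⋙ S.ι))).trans ?_
    refine (congrArg (fun t => (1 : ℚ) ⊗ₜ[ℤ] t) (map_sum _ _ _)).trans ?_
    refine (TensorProduct.tmul_sum _ _ _).trans (Finset.sum_congr rfl fun i _ => ?_)
    rw [map_smul, TensorProduct.tmul_smul, map_smul, forestMap_of, neg_one_pow_zsmul,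
      Forest.push_push]
    rfl
  exact LinearMap.congr_fun this w

theorem Lift.aug_forestMap (hφ : Lift φ') {Γ : RibbonGraph Ω} (w : OverChains S.ι Γ 0) :
    (Forest.aug Γ).baseChange ℚ (forestMap φ' S Γ 0 w) = OverChains.aug Γ w ⊗ₜ[ℤ] (1 : ℤ) := by
  have : (Forest.aug Γ).baseChange ℚ ∘ₗ forestMap φ' S Γ 0 =
      (TensorProduct.rid ℤ ℚ).symm.toAddMonoidHom.toRatLinearMap ∘ₗ OverChains.aug Γ :=
    OverChains.hom_ext fun p => by
      rw [LinearMap.comp_apply, LinearMap.comp_apply, forestMap_of, LinearMap.baseChange_tmul,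
        Forest.aug_push, aug_of]
      exact congrArg (fun t : ℤ => (1 : ℚ) ⊗ₜ[ℤ] t) (hφ.aug (p.1 ⋙ S.ι))
  exact LinearMap.congr_fun this w

/-- By naturality, the value on the dual cell of each graph determines the composite on all of the
forest complex. -/
theorem Lift.forestMap_cellMap_of (hS : IsSkeleton S) {n : ℕ}
    (h : ∀ y : OGraph Ω n, forestMap φ' S y.graph n (dualChain S y) = cellSign n ⊗ₜ Forest.one y)
    {Γ : RibbonGraph Ω} (w : Forest Γ n) :
    forestMap φ' S Γ n (cellMap hS Γ n w) = cellSign n ⊗ₜ w := by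
  have : (forestMap φ' S Γ n).toAddMonoidHom.toIntLinearMap ∘ₗ cellMap hS Γ n =
      TensorProduct.mk ℤ ℚ (Forest Γ n) (cellSign n) := OddFree.hom_ext fun x => by
    rw [LinearMap.comp_apply, cellMap_mk]
    refine (forestMap_push φ' _ _).trans ?_
    rw [h, LinearMap.baseChange_tmul, Forest.one, Forest.push_mk]
    exact congrArg (fun t => cellSign n ⊗ₜ[ℤ] (OddFree.mk (OOver.mk x.top t) : Forest Γ n))
      (Category.id_comp _)
  exact LinearMap.congr_fun this w

/-- The image is a multiple of the identity of `y`, by `RatForest.exists_smul_one`. Comparing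
boundaries determines the multiple from the previous degree; in degree zero the augmentations are
compared. -/
theorem Lift.forestMap_dualChain [Infinite Ω] (hφ : Lift φ') (hS : IsSkeleton S) :
    ∀ {n : ℕ} (y : OGraph Ω n),
      forestMap φ' S y.graph n (dualChain S y) = cellSign n ⊗ₜ Forest.one y
  | 0, y => by
    obtain ⟨t, ht⟩ := RatForest.exists_smul_one y (forestMap φ' S y.graph 0 (dualChain S y))
    have h := hφ.aug_forestMap (dualChain S y)
    rw [ht, LinearMap.baseChange_tmul, aug_dualChain hS] at h
    have h' := congrArg (TensorProduct.rid ℤ ℚ) h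
    rw [TensorProduct.rid_tmul, TensorProduct.rid_tmul, one_smul, Forest.one, Forest.aug_mk,
      zsmul_eq_mul] at h'
    -- Dual cell and identity both have augmentation `natSign y.or`; this is a unit, so the multiple
    -- is one.
    have hn : (natSign y.or : ℚ) ≠ 0 := fun h0 => by
      have := natSign_mul_self y.codim_eq y.or
      rw [Int.cast_eq_zero.1 h0] at this
      simp at this
    rw [ht, cellSign_zero, mul_left_cancel₀ hn (h'.trans (mul_one _).symm)]
  | n + 1, y => by
    obtain ⟨t, ht⟩ := RatForest.exists_smul_one y (forestMap φ' S y.graph (n + 1) (dualChain S y))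
    have h := hφ.bdry_forestMap (dualChain S y)
    rw [ht, LinearMap.baseChange_tmul, bdry_dualChain hS, map_smul,
      Lift.forestMap_cellMap_of hS fun y => hφ.forestMap_dualChain hS y,
      TensorProduct.smul_tmul', smul_eq_mul, ← cellSign_succ] at h
    -- Both sides of `h` are multiples of the boundary of the identity. The functional extracts the
    -- coefficients, which agree because that boundary has value one.
    obtain ⟨l, hl⟩ := Forest.exists_functional y
    have h' := congrArg (TensorProduct.rid ℤ ℚ) (congrArg (l.baseChange ℚ) h)
    rw [LinearMap.baseChange_tmul, LinearMap.baseChange_tmul, hl, TensorProduct.rid_tmul,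
      TensorProduct.rid_tmul, one_smul, one_smul] at h'
    rw [ht, h']

variable {φ : nerveChains (RibbonGraph Ω) ⟶ integralCx Ω}
  {ψ : rat.obj (integralCx Ω) ⟶ rat.obj (nerveChains S.FullSubcategory)}

theorem proj_forestMap
    (hp : ∀ n x, (φ.f n).hom (simplex x) = Forest.proj _ n (φ' n x)) {Γ : RibbonGraph Ω} {n : ℕ}
    (w : OverChains S.ι Γ n) :
    ((rat.map φ).f n).hom (((rat.map (nerveChainsMap S.ι)).f n).hom (forget Γ n w)) =
      RatForest.proj Γ n (forestMap φ' S Γ n w) := by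
  have : ((rat.map φ).f n).hom ∘ₗ ((rat.map (nerveChainsMap S.ι)).f n).hom ∘ₗ forget Γ n =
      (RatForest.proj Γ n).toAddMonoidHom.toRatLinearMap ∘ₗ forestMap φ' S Γ n :=
    OverChains.hom_ext fun p => by
      rw [LinearMap.comp_apply, LinearMap.comp_apply, LinearMap.comp_apply, forget_of,
        rat_map_toRat, nerveChainsMap_simplex, rat_map_simplex hp, forestMap_of]
      refine Eq.trans ?_ (RatForest.proj_tmul _ _).symm
      rw [one_smul, ratProj_push]
      rfl
  exact LinearMap.congr_fun this w

/-- The sign in `ψ` and the sign with which the lift of `φ` maps the dual cell to the identity are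
the same, and their product is one. -/
theorem dualCell_comp_eq_id [Infinite Ω] (hS : IsSkeleton S) (hφ : Lift φ')
    (hp : ∀ n x, (φ.f n).hom (simplex x) = Forest.proj _ n (φ' n x))
    (hψ : ∀ (n : ℕ) (Γ : RibbonGraph Ω) (w : Forest Γ n),
        (ψ.f n).hom (ratProj Γ n w) = forget Γ n (signedCellMap hS Γ n w)) :
    ψ ≫ rat.map (nerveChainsMap S.ι) ≫ rat.map φ = 𝟙 _ := by
  refine HomologicalComplex.hom_ext _ _ fun n => ModuleCat.hom_ext (ratIntegral_hom_ext fun y => ?_)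
  change ((rat.map φ).f n).hom (((rat.map (nerveChainsMap S.ι)).f n).hom ((ψ.f n).hom _)) = _
  rw [hψ, proj_forestMap hp, signedCellMap, cellMap_one, map_smul, hφ.forestMap_dualChain hS,
    TensorProduct.smul_tmul', smul_eq_mul, cellSign_mul_self, RatForest.proj_tmul, one_smul]
  rfl

end

/-! ### Existence of a skeleton -/

theorem exists_isSkeleton (Ω : Type u) : ∃ S : ObjectProperty (RibbonGraph Ω), IsSkeleton S := by
  let s := isIsomorphicSetoid (RibbonGraph Ω)
  refine ⟨fun Γ => Γ = (Quotient.mk s Γ).out, fun Γ => ⟨(Quotient.mk s Γ).out, ⟨?_, ?_⟩, ?_⟩⟩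
  · change _ = (Quotient.mk s (Quotient.mk s Γ).out).out
    rw [Quotient.out_eq]
  · exact s.symm (Quotient.mk_out (s := s) Γ)
  · rintro Δ ⟨hΔ, h⟩
    rw [hΔ]
    exact congrArg Quotient.out (Quotient.sound (s := s) (s.symm h))

end FatGraph

end

/-! ### The main theorem -/

theorem mainTheorem5 (Ω : Type u) [Infinite Ω] :
    ∃ hd : ∀ n, integralBdry Ω n ∘ₗ integralBdry Ω (n + 1) = 0,
      (∀ φ : nerveChains (RibbonGraph Ω) ⟶ integralComplex Ω hd,
        CarriedByForest φ → IsRationalHomotopyEquiv φ) ∧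
      ∀ S : ObjectProperty (RibbonGraph Ω), IsSkeleton S →
        ∃ ψ : rat.obj (integralComplex Ω hd) ⟶ rat.obj (nerveChains S.FullSubcategory),
          (∀ (n : ℕ) (y : OGraph Ω n),
            (ψ.f n).hom (toRat _ (genX y)) = (-1 : ℚ) ^ ((n + 1).choose 2) • avgDualCell S y) ∧
          ∀ φ : nerveChains (RibbonGraph Ω) ⟶ integralComplex Ω hd, CarriedByForest φ →
            ψ ≫ rat.map (nerveChainsMap S.ι) ≫ rat.map φ = 𝟙 _ ∧
            Nonempty (Homotopy (rat.map (nerveChainsMap S.ι) ≫ rat.map φ ≫ ψ) (𝟙 _)) ∧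
            ∃ e : HomotopyEquiv (rat.obj (nerveChains (RibbonGraph Ω)))
                (rat.obj (integralComplex Ω hd)),
              e.hom = rat.map φ ∧ e.inv = ψ ≫ rat.map (nerveChainsMap S.ι) := by
  have key : ∀ S : ObjectProperty (RibbonGraph Ω), IsSkeleton S →
      ∃ ψ : rat.obj (integralCx Ω) ⟶ rat.obj (nerveChains S.FullSubcategory),
        (∀ (n : ℕ) (y : OGraph Ω n),
          (ψ.f n).hom (toRat _ (genX y)) = (-1 : ℚ) ^ ((n + 1).choose 2) • avgDualCell S y) ∧
        ∀ φ : nerveChains (RibbonGraph Ω) ⟶ integralCx Ω, CarriedByForest φ →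
          ψ ≫ rat.map (nerveChainsMap S.ι) ≫ rat.map φ = 𝟙 _ ∧
          Nonempty (Homotopy (rat.map (nerveChainsMap S.ι) ≫ rat.map φ ≫ ψ) (𝟙 _)) ∧
          ∃ e : HomotopyEquiv (rat.obj (nerveChains (RibbonGraph Ω))) (rat.obj (integralCx Ω)),
            e.hom = rat.map φ ∧ e.inv = ψ ≫ rat.map (nerveChainsMap S.ι) := by
    intro S hS
    obtain ⟨ψ, hψ⟩ := exists_dualCellChainMap hS
    refine ⟨ψ, fun n y => ?_, ?_⟩
    · refine (congrArg (ψ.f n).hom (ratProj_one y).symm).trans ((hψ n _ _).trans ?_)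
      rw [signedCellMap, cellMap_one, map_smul, forget_dualChain hS]
      rfl
    · rintro φ ⟨φ', hp, haug, hbdry⟩
      have hφ : Lift φ' := ⟨haug, hbdry⟩
      have hid := dualCell_comp_eq_id hS hφ hp hψ
      obtain ⟨h⟩ := nonempty_homotopy_id hS hφ hp hψ
      exact ⟨hid, nonempty_homotopy_sub hS hφ hp hψ,
        { hom := rat.map φ
          inv := ψ ≫ rat.map (nerveChainsMap S.ι)
          homotopyHomInvId := h
          homotopyInvHomId := Homotopy.ofEq ((Category.assoc _ _ _).trans hid) }, rfl, rfl⟩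
  -- The first assertion does not mention a skeleton; any one gives the homotopy inverse.
  refine ⟨integralBdry_integralBdry Ω, fun φ hφ => ?_, key⟩
  obtain ⟨S, hS⟩ := exists_isSkeleton Ω
  obtain ⟨ψ, -, h⟩ := key S hS
  obtain ⟨-, -, e, he, -⟩ := h φ hφ
  exact ⟨e, he⟩
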